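/- Let $M$ be a compact (boundaryless, smooth) Riemannian manifold and let $f:M\to M$ be a $C^2$ diffeomorphism with a dominated splitting $TM=E^{cu}\oplus_{\succ}E^{cs}$, i.e. $E^{cu},E^{cs}$ are continuous $Df$-invariant subbundles with $T_xM=E^{cu}(x)\oplus E^{cs}(x)$ and $$\|Df|_{E^{cs}(x)}\|\cdot\|Df^{-1}|_{E^{cu}(f(x))}\|<\tfrac12\qquad\text{for all }x\in M .$$ Let $\{T,\{\theta_\varepsilon\}_{\varepsilon>0}\}$ be a regular random perturbation of $f$: $\mathcal T$ is a metric space, $T:\mathcal T\to \mathrm{Diff}^2(M)$, $\omega\mapsto f_\omega$, is continuous for the $C^2$ topology, $f_{\omega_f}=f$ for some $\omega_f\in\mathcal T$, and the $\theta_\varepsilon$ are Borel probability measures on $\mathcal T$, carried by their supports, such that the sets $\operatorname{supp}\theta_\varepsilon$ are compact, nested (increasing in $\varepsilon$) and converge to $\{\omega_f\}$ as $\varepsilon\to0$, and such that for all $\varepsilon>0$, $x\in M$ the law of $\omega\mapsto f_\omega(x)$ under $\theta_\varepsilon$ is absolutely continuous with respect to Lebesgue measure on $M$. Put $\Omega_\varepsilon=\operatorname{supp}(\theta_\varepsilon^{\mathbb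 Z})\subset\mathcal T^{\mathbb Z}$, $\mathcal F(\underline\omega,x)=(\sigma\underline\omega,f_{\omega_0}(x))$ with $\sigma$ the left shift, and for $n\ge 0$ put $f^n_{\underline\omega}=f_{\omega_{n-1}}\circ\dots\circ f_{\omega_0}$, $f^{-n}_{\underline\omega}=f_{\omega_{-n}}^{-1}\circ\dots\circ f_{\omega_{-1}}^{-1}$. A random dominated splitting over $\Omega_{\varepsilon_0}$ extending that of $f$ is a splitting $T_xM=E^{cu}(\underline\omega,x)\oplus E^{cs}(\underline\omega,x)$, $(\underline\omega,x)\in\Omega_{\varepsilon_0}\times M$, which depends continuously on $(\underline\omega,x)$, satisfies $Df_{\omega_0}(x)E^{*}(\underline\omega,x)=E^{*}(\mathcal F(\underline\omega,x))$ for $*=cu,cs$ and $\|Df_{\omega_0}|_{E^{cs}(\underline\omega,x)}\|\cdot\|Df_{\omega_0}^{-1}|_{E^{cu}(\mathcal F(\underline\omega,x))}\|<\frac12$, and coincides with $E^{cu}(x)\oplus E^{cs}(x)$ at $\underline\omega=(\dots,\omega_f,\omega_f,\dots)$. For such a splitting, $\alpha>0$ and $\ell\in\mathbb N$, the hyperbolic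 block $\mathcal B_\ell(\alpha)$ is the set of $(\underline\omega,x)\in\Omega_{\varepsilon_0}\times M$ such that for all $n\in\mathbb N$ $$\prod_{i=0}^{n-1}\big\|Df^{\ell}_{\sigma^{i\ell}\underline\omega}|_{E^{cs}(\mathcal F^{i\ell}(\underline\omega,x))}\big\|\le e^{-\alpha\ell n}\quad\text{and}\quad \prod_{i=0}^{n-1}\big\|Df^{-\ell}_{\sigma^{-i\ell}\underline\omega}|_{E^{cu}(\mathcal F^{-i\ell}(\underline\omega,x))}\big\|\le e^{-\alpha\ell n}.$$ A probability measure $\mu$ on $M$ is stationary for $\theta_\varepsilon$ if $\int\mu\circ f_\omega^{-1}\,d\theta_\varepsilon(\omega)=\mu$; its lift $\mu^*$ is the unique $\mathcal F$-invariant measure on $\mathcal T^{\mathbb Z}\times M$ whose image under $(\underline\omega,x)\mapsto((\omega_0,\omega_1,\dots),x)$ is $\theta_\varepsilon^{\mathbb N}\times\mu$. Then random dominated splittings over $\Omega_{\varepsilon_0}$ extending that of $f$ exist for some $\varepsilon_0>0$, and for every $\varepsilon_0>0$ and every such splitting the following holds. Let $0<\alpha<\beta$, let $\varepsilon_n>0$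 with $\varepsilon_n\to0$, let $\mu_n$ be a stationary measure for $\theta_{\varepsilon_n}$, and suppose that $\mu_n\to\mu$ in the weak* topology, where for $\mu$-almost every $x\in M$ the following limits exist in $[-\infty,\infty]$ and satisfy (with $\log 0=-\infty$) $$\lim_{n\to\infty}\frac1n\log\|Df^n|_{E^{cs}(x)}\|<-\beta,\qquad \lim_{n\to\infty}\frac1n\log\|Df^{-n}|_{E^{cu}(x)}\|<-\beta .$$ Then $$\lim_{\ell\to\infty}\ \liminf_{n\to\infty}\ \mu_n^*\big(\mathcal B_\ell(\alpha)\big)=1 .$$ -/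

import Mathlib

open MeasureTheory Filter Set Bundle
open scoped Manifold Topology ContDiff

noncomputable section

/-- The set `Diff²(M)` of `C²` diffeomorphisms of a `d`-dimensional manifold `M`. -/
abbrev Diff2 (d : ℕ) (M : Type*) [TopologicalSpace M]
    [ChartedSpace (EuclideanSpace ℝ (Fin d)) M] : Type _ :=
  Diffeomorph (𝓡 d) (𝓡 d) M M 2

/-- The second tangent map `T(T g) : T(TM) → T(TM)` of a `C²` diffeomorphism, as a continuous
map. -/
def secondTangentMap {d : ℕ} {M : Type*} [TopologicalSpace M]
    [ChartedSpace (EuclideanSpace ℝ (Fin d)) M] [IsManifold (𝓡 d) ∞ M] (g : Diff2 d M) :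
    C(TangentBundle (𝓡 d).tangent (TangentBundle (𝓡 d) M),
      TangentBundle (𝓡 d).tangent (TangentBundle (𝓡 d) M)) where
  toFun := tangentMap (𝓡 d).tangent (𝓡 d).tangent (tangentMap (𝓡 d) (𝓡 d) g)
  continuous_toFun :=
    (g.contMDiff_toFun.contMDiff_tangentMap (m := 1) (by norm_num)).continuous_tangentMap le_rfl

/-- The `C²` topology on `Diff²(M)`: the topology induced by the map `g ↦ T(T g)` from the
compact-open topology (uniform convergence on compact sets of `g` and its derivatives up to
order two, in charts). -/
instance Diff2.instTopologicalSpace {d : ℕ} {M : Type*} [TopologicalSpace M]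
    [ChartedSpace (EuclideanSpace ℝ (Fin d)) M] [IsManifold (𝓡 d) ∞ M] :
    TopologicalSpace (Diff2 d M) :=
  TopologicalSpace.induced secondTangentMap inferInstance

/-- `‖Dg|_V‖`: the operator norm, for the Riemannian norms, of the derivative of `g` at `x`
restricted to the subspace `V` of `T_x M` (it is `0` if `V = 0`). -/
def restrNorm {d : ℕ} {M : Type*} [TopologicalSpace M]
    [ChartedSpace (EuclideanSpace ℝ (Fin d)) M] [IsManifold (𝓡 d) ∞ M]
    [RiemannianBundle (fun x : M => TangentSpace (𝓡 d) x)]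
    (g : M → M) (x : M) (V : Submodule ℝ (TangentSpace (𝓡 d) x)) : ℝ :=
  ‖(mfderiv (𝓡 d) (𝓡 d) g x).comp V.subtypeL‖

/-- `log ‖Dg|_V‖` as an extended real number, with `log 0 = -∞`. -/
def logRestrNorm {d : ℕ} {M : Type*} [TopologicalSpace M]
    [ChartedSpace (EuclideanSpace ℝ (Fin d)) M] [IsManifold (𝓡 d) ∞ M]
    [RiemannianBundle (fun x : M => TangentSpace (𝓡 d) x)]
    (g : M → M) (x : M) (V : Submodule ℝ (TangentSpace (𝓡 d) x)) : EReal :=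
  ENNReal.log (ENNReal.ofReal (restrNorm g x V))

/-- Let `b : X → M` be a map and `V p ⊆ T_{b p} M` a family of subspaces, `p ∈ X`. The family is
continuous on `S ⊆ X` if near every point of `S` it is spanned by a continuous frame
(`s 0, …, s (k-1)`). -/
def IsContinuousFamilyOn {d : ℕ} {M : Type*} [TopologicalSpace M]
    [ChartedSpace (EuclideanSpace ℝ (Fin d)) M] [IsManifold (𝓡 d) ∞ M]
    {X : Type*} [TopologicalSpace X] (b : X → M)
    (V : ∀ p : X, Submodule ℝ (TangentSpace (𝓡 d) (b p))) (S : Set X) : Prop :=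
  ∀ p₀ ∈ S, ∃ U ∈ 𝓝 p₀, ∃ (k : ℕ) (s : Fin k → ∀ p : X, TangentSpace (𝓡 d) (b p)),
    (∀ i, ContinuousOn (fun p => (⟨b p, s i p⟩ : TangentBundle (𝓡 d) M)) (U ∩ S)) ∧
    ∀ p ∈ U ∩ S, LinearIndependent ℝ (fun i => s i p) ∧
      Submodule.span ℝ (Set.range fun i => s i p) = V p

/-- `TM = E^cu ⊕ E^cs` is a dominated splitting for the diffeomorphism `f`, with `E^cu`
dominating `E^cs`. -/
structure IsDominatedSplitting {d : ℕ} {M : Type*} [TopologicalSpace M]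
    [ChartedSpace (EuclideanSpace ℝ (Fin d)) M] [IsManifold (𝓡 d) ∞ M]
    [RiemannianBundle (fun x : M => TangentSpace (𝓡 d) x)]
    (f : Diff2 d M) (Ecu Ecs : ∀ x : M, Submodule ℝ (TangentSpace (𝓡 d) x)) : Prop where
  continuous_cu : IsContinuousFamilyOn (fun x : M => x) Ecu univ
  continuous_cs : IsContinuousFamilyOn (fun x : M => x) Ecs univ
  isCompl : ∀ x, IsCompl (Ecu x) (Ecs x)
  map_cu : ∀ x, (Ecu x).map (mfderiv (𝓡 d) (𝓡 d) f x).toLinearMap = Ecu (f x)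
  map_cs : ∀ x, (Ecs x).map (mfderiv (𝓡 d) (𝓡 d) f x).toLinearMap = Ecs (f x)
  dominated : ∀ x, restrNorm f x (Ecs x) * restrNorm f.symm (f x) (Ecu (f x)) < 1 / 2

/-- A subset of `M` is Lebesgue null (for the Riemannian volume) iff its image in every chart is
a null set for the Lebesgue measure of `ℝ^d`. -/
def IsLebNull (d : ℕ) {M : Type*} [TopologicalSpace M]
    [ChartedSpace (EuclideanSpace ℝ (Fin d)) M] (A : Set M) : Prop :=
  ∀ x : M, volume ((chartAt (EuclideanSpace ℝ (Fin d)) x) ''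
    (A ∩ (chartAt (EuclideanSpace ℝ (Fin d)) x).source)) = 0

/-- `{T, (θ_ε)_{ε > 0}}` is a regular random perturbation of `f`, based at the parameter `w₀`.
Only the values `θ ε` with `ε > 0` matter. -/
structure IsRegularPerturbation {d : ℕ} {M : Type*} [TopologicalSpace M]
    [ChartedSpace (EuclideanSpace ℝ (Fin d)) M] [IsManifold (𝓡 d) ∞ M]
    [MeasurableSpace M]
    {𝒯 : Type*} [MetricSpace 𝒯] [MeasurableSpace 𝒯]
    (f : Diff2 d M) (T : 𝒯 → Diff2 d M) (w₀ : 𝒯) (θ : ℝ → ProbabilityMeasure 𝒯) : Prop where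
  continuous_T : Continuous T
  T_base : T w₀ = f
  isCompact_support : ∀ ε, 0 < ε → IsCompact (θ ε : Measure 𝒯).support
  /-- `θ_ε` is carried by its support (automatic when `𝒯` is separable). -/
  compl_support : ∀ ε, 0 < ε → (θ ε : Measure 𝒯) (θ ε : Measure 𝒯).supportᶜ = 0
  nested : ∀ ε ε', 0 < ε → ε ≤ ε' → (θ ε : Measure 𝒯).support ⊆ (θ ε' : Measure 𝒯).support
  /-- Every neighbourhood of `w₀` contains `supp θ_ε` for all small `ε`. -/
  tendsto_support : Tendsto (fun ε => (θ ε : Measure 𝒯).support) (𝓝[>] 0) (𝓝 w₀).smallSets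
  /-- The transition probabilities `P(x, A) = θ_ε {ω | f_ω x ∈ A}` are absolutely continuous
  with respect to Lebesgue measure. -/
  absolutelyContinuous : ∀ ε, 0 < ε → ∀ (x : M) (A : Set M), MeasurableSet A → IsLebNull d A →
    (θ ε : Measure 𝒯) {w | T w x ∈ A} = 0

/-- `μ` is stationary for the law `θ` of the random maps: `∫ μ ∘ f_ω⁻¹ dθ(ω) = μ`. -/
def IsStationaryMeasure {d : ℕ} {M : Type*} [TopologicalSpace M]
    [ChartedSpace (EuclideanSpace ℝ (Fin d)) M] [MeasurableSpace M]
    {𝒯 : Type*} [MeasurableSpace 𝒯] (T : 𝒯 → Diff2 d M)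
    (θ : Measure 𝒯) (μ : Measure M) : Prop :=
  ∀ A : Set M, MeasurableSet A → ∫⁻ w, μ (T w ⁻¹' A) ∂θ = μ A

/-- The skew product `𝓕(ω, x) = (σ ω, f_{ω₀} x)` on `𝒯^ℤ × M`, with its inverse
`(ω, x) ↦ (σ⁻¹ ω, f_{ω₋₁}⁻¹ x)`. -/
def skew {d : ℕ} {M : Type*} [TopologicalSpace M]
    [ChartedSpace (EuclideanSpace ℝ (Fin d)) M] {𝒯 : Type*} (T : 𝒯 → Diff2 d M) :
    ((ℤ → 𝒯) × M) ≃ ((ℤ → 𝒯) × M) where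
  toFun p := (fun k => p.1 (k + 1), T (p.1 0) p.2)
  invFun p := (fun k => p.1 (k - 1), (T (p.1 (-1))).symm p.2)
  left_inv p := by simp
  right_inv p := by simp

/-- `f_ω^n = f_{ω_{n-1}} ∘ ⋯ ∘ f_{ω_0}` for `n ≥ 0`. -/
def fwd {d : ℕ} {M : Type*} [TopologicalSpace M]
    [ChartedSpace (EuclideanSpace ℝ (Fin d)) M] {𝒯 : Type*} (T : 𝒯 → Diff2 d M)
    (w : ℤ → 𝒯) : ℕ → M → M
  | 0 => id
  | n + 1 => T (w n) ∘ fwd T w n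

/-- `f_ω^{-n} = f_{ω_{-n}}⁻¹ ∘ ⋯ ∘ f_{ω_{-1}}⁻¹` for `n ≥ 0`. -/
def bwd {d : ℕ} {M : Type*} [TopologicalSpace M]
    [ChartedSpace (EuclideanSpace ℝ (Fin d)) M] {𝒯 : Type*} (T : 𝒯 → Diff2 d M)
    (w : ℤ → 𝒯) : ℕ → M → M
  | 0 => id
  | n + 1 => (T (w (-((n : ℤ) + 1)))).symm ∘ bwd T w n

/-- `Ω_ε = supp (θ_ε^ℤ)`, in the product topology of `𝒯^ℤ`. -/
def noiseSpace {𝒯 : Type*} [MetricSpace 𝒯] [MeasurableSpace 𝒯]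
    (θ : ℝ → ProbabilityMeasure 𝒯) (ε : ℝ) : Set (ℤ → 𝒯) :=
  (Measure.infinitePi fun _ : ℤ => (θ ε : Measure 𝒯)).support

/-- `T_x M = E^cu(ω, x) ⊕ E^cs(ω, x)`, `(ω, x) ∈ Ω × M`, is a random dominated splitting which
extends the splitting `Ecu₀ ⊕ Ecs₀` of the unperturbed map. Values outside `Ω × M` do not
matter. -/
structure IsRandomDominatedSplitting {d : ℕ} {M : Type*} [TopologicalSpace M]
    [ChartedSpace (EuclideanSpace ℝ (Fin d)) M] [IsManifold (𝓡 d) ∞ M]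
    [RiemannianBundle (fun x : M => TangentSpace (𝓡 d) x)]
    {𝒯 : Type*} [MetricSpace 𝒯] (T : 𝒯 → Diff2 d M) (w₀ : 𝒯)
    (Ecu₀ Ecs₀ : ∀ x : M, Submodule ℝ (TangentSpace (𝓡 d) x)) (Ω : Set (ℤ → 𝒯))
    (Ecu Ecs : ∀ p : (ℤ → 𝒯) × M, Submodule ℝ (TangentSpace (𝓡 d) p.2)) : Prop where
  continuous_cu : IsContinuousFamilyOn Prod.snd Ecu (Ω ×ˢ univ)
  continuous_cs : IsContinuousFamilyOn Prod.snd Ecs (Ω ×ˢ univ)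
  isCompl : ∀ p ∈ Ω ×ˢ (univ : Set M), IsCompl (Ecu p) (Ecs p)
  map_cu : ∀ p ∈ Ω ×ˢ (univ : Set M),
    (Ecu p).map (mfderiv (𝓡 d) (𝓡 d) (T (p.1 0)) p.2).toLinearMap = Ecu (skew T p)
  map_cs : ∀ p ∈ Ω ×ˢ (univ : Set M),
    (Ecs p).map (mfderiv (𝓡 d) (𝓡 d) (T (p.1 0)) p.2).toLinearMap = Ecs (skew T p)
  dominated : ∀ p ∈ Ω ×ˢ (univ : Set M),
    restrNorm (T (p.1 0)) p.2 (Ecs p) *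
      restrNorm (T (p.1 0)).symm (skew T p).2 (Ecu (skew T p)) < 1 / 2
  extends_cu : ∀ x, Ecu (fun _ => w₀, x) = Ecu₀ x
  extends_cs : ∀ x, Ecs (fun _ => w₀, x) = Ecs₀ x

/-- The hyperbolic block `𝓑_ℓ(α)` of level `ℓ` with respect to `α`. -/
def hyperbolicBlock {d : ℕ} {M : Type*} [TopologicalSpace M]
    [ChartedSpace (EuclideanSpace ℝ (Fin d)) M] [IsManifold (𝓡 d) ∞ M]
    [RiemannianBundle (fun x : M => TangentSpace (𝓡 d) x)]
    {𝒯 : Type*} (T : 𝒯 → Diff2 d M) (Ω : Set (ℤ → 𝒯))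
    (Ecu Ecs : ∀ p : (ℤ → 𝒯) × M, Submodule ℝ (TangentSpace (𝓡 d) p.2))
    (α : ℝ) (ℓ : ℕ) : Set ((ℤ → 𝒯) × M) :=
  {p | p.1 ∈ Ω ∧ ∀ n : ℕ,
    ∏ i ∈ Finset.range n, (let q := (skew T)^[i * ℓ] p
      restrNorm (fwd T q.1 ℓ) q.2 (Ecs q)) ≤ Real.exp (-α * ℓ * n) ∧
    ∏ i ∈ Finset.range n, (let q := (skew T).symm^[i * ℓ] p
      restrNorm (bwd T q.1 ℓ) q.2 (Ecu q)) ≤ Real.exp (-α * ℓ * n)}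

/-- `m` is an `𝓕`-invariant measure on `𝒯^ℤ × M` which projects to `θ^ℕ × μ` under
`(ω, x) ↦ (ω⁺, x)`, where `ω⁺ = (ω₀, ω₁, …)`. -/
def IsLift {d : ℕ} {M : Type*} [TopologicalSpace M]
    [ChartedSpace (EuclideanSpace ℝ (Fin d)) M] [MeasurableSpace M]
    {𝒯 : Type*} [MeasurableSpace 𝒯] (T : 𝒯 → Diff2 d M)
    (θ : Measure 𝒯) (μ : Measure M) (m : Measure ((ℤ → 𝒯) × M)) : Prop :=
  MeasurePreserving (skew T) m m ∧
    m.map (fun p => ((fun k : ℕ => p.1 k), p.2)) =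
      (Measure.infinitePi fun _ : ℕ => θ).prod μ

open Classical in
/-- The lifted measure `μ^*`: the (unique) measure with the property `IsLift`; by convention `0`
if there is none. -/
def liftedMeasure {d : ℕ} {M : Type*} [TopologicalSpace M]
    [ChartedSpace (EuclideanSpace ℝ (Fin d)) M] [MeasurableSpace M]
    {𝒯 : Type*} [MeasurableSpace 𝒯] (T : 𝒯 → Diff2 d M)
    (θ : Measure 𝒯) (μ : Measure M) : Measure ((ℤ → 𝒯) × M) :=
  if h : ∃ m, IsLift T θ μ m then h.choose else 0

end

/-! Persistence of the splitting. For noise near `w₀` the derivatives almost preserve the splitting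
of `f`, and `E^cu` still dominates. The graph transform is then a contraction, and the vectors whose
whole forward orbit stays in a cone about `E^cs` form the graph of an invariant family
(`IsNearlyDominated.exists_family`). Such a family is cut out by closed conditions, and with a fixed
continuous complement closedness gives continuity (`isContinuousFamilyOn_of_isCompl`). The
centre-unstable family comes from the inverse maps under time reversal. Domination is an open
condition, since norms along closed families are upper semicontinuous
(`IsClosedFamilyOn.eventually_restrNorm_lt`) and `M` is compact; see
`exists_randomDominatedSplitting`.

Lifts. A limit of the images of `θ^ℤ × μ` under the iterates of the skew product has the right law
in the future of every past time, hence is invariant (`IsStationaryMeasure.exists_isLift`).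

Hyperbolic blocks. By the exponent assumption the set of `x` with `‖Df^ℓ|E^cs‖ < e^{-βℓ}` has
`μ`-measure close to 1 for large `ℓ`. It is open and contains a compact set of nearly full measure;
semicontinuity extends the inequality to a neighbourhood `U` of that compact set and to all nearby
noises. Weak* convergence keeps `μ_n(U)` close to 1. Off `U` only a bound `e^{Cℓ}` is available. A
maximal ergodic inequality for `𝓕^ℓ` shows that, off a set of measure at most `(C+β)/(β-α)` times
that of the complement of `U`, visits to this complement are too rare to spoil the decay at rate `α`
at any time (`MeasureTheory.MeasurePreserving.mul_measure_not_forall_prod_le`). The factor `ℓ`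
cancels in this ratio, so one choice of smallness serves all `ℓ`. The inverse skew product is
treated in the same way, and the two exceptional sets are added. -/

set_option linter.unusedSectionVars false

noncomputable section

/-! ### Limits in the total space of a vector bundle -/

section VectorBundle

variable {B F : Type*} {E : B → Type*} [TopologicalSpace B] [NormedAddCommGroup F]
  [NormedSpace ℝ F] [∀ b, TopologicalSpace (E b)] [∀ b, AddCommGroup (E b)]
  [∀ b, Module ℝ (E b)] [TopologicalSpace (TotalSpace F E)] [FiberBundle F E]
  [VectorBundle ℝ F E]
  {ι : Type*} {l : Filter ι} {b : ι → B} {x : B}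

lemma FiberBundle.tendsto_totalSpace_iff {v : ∀ i, E (b i)} {v₀ : E x} :
    Tendsto (fun i => (⟨b i, v i⟩ : TotalSpace F E)) l (𝓝 ⟨x, v₀⟩) ↔
      Tendsto b l (𝓝 x) ∧
      Tendsto (fun i => ((trivializationAt F E x) ⟨b i, v i⟩).2) l
        (𝓝 ((trivializationAt F E x) ⟨x, v₀⟩).2) :=
  (trivializationAt F E x).tendsto_nhds_iff
    (FiberBundle.mem_trivializationAt_proj_source (x := (⟨x, v₀⟩ : TotalSpace F E)))

lemma eventually_mem_baseSet_trivializationAt (h : Tendsto b l (𝓝 x)) :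
    ∀ᶠ i in l, b i ∈ (trivializationAt F E x).baseSet :=
  h ((trivializationAt F E x).open_baseSet.mem_nhds (FiberBundle.mem_baseSet_trivializationAt' x))

lemma trivialization_snd_add (e : Trivialization F (π F E)) [e.IsLinear ℝ] {y : B}
    (hy : y ∈ e.baseSet) (v w : E y) : (e ⟨y, v + w⟩).2 = (e ⟨y, v⟩).2 + (e ⟨y, w⟩).2 :=
  (e.linear ℝ hy).map_add v w

lemma trivialization_snd_smul (e : Trivialization F (π F E)) [e.IsLinear ℝ] {y : B}
    (hy : y ∈ e.baseSet) (c : ℝ) (v : E y) : (e ⟨y, c • v⟩).2 = c • (e ⟨y, v⟩).2 :=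
  (e.linear ℝ hy).map_smul c v

lemma Filter.Tendsto.totalSpace_add {v w : ∀ i, E (b i)} {v₀ w₀ : E x}
    (hv : Tendsto (fun i => (⟨b i, v i⟩ : TotalSpace F E)) l (𝓝 ⟨x, v₀⟩))
    (hw : Tendsto (fun i => (⟨b i, w i⟩ : TotalSpace F E)) l (𝓝 ⟨x, w₀⟩)) :
    Tendsto (fun i => (⟨b i, v i + w i⟩ : TotalSpace F E)) l (𝓝 ⟨x, v₀ + w₀⟩) := by
  rw [FiberBundle.tendsto_totalSpace_iff] at *
  refine ⟨hv.1, ?_⟩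
  rw [trivialization_snd_add _ (FiberBundle.mem_baseSet_trivializationAt' x)]
  refine (hv.2.add hw.2).congr' ?_
  filter_upwards [eventually_mem_baseSet_trivializationAt (F := F) (E := E) hv.1] with i hi
  rw [trivialization_snd_add _ hi]

lemma Filter.Tendsto.totalSpace_smul {v : ∀ i, E (b i)} {v₀ : E x} {c : ι → ℝ} {c₀ : ℝ}
    (hc : Tendsto c l (𝓝 c₀))
    (hv : Tendsto (fun i => (⟨b i, v i⟩ : TotalSpace F E)) l (𝓝 ⟨x, v₀⟩)) :
    Tendsto (fun i => (⟨b i, c i • v i⟩ : TotalSpace F E)) l (𝓝 ⟨x, c₀ • v₀⟩) := by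
  rw [FiberBundle.tendsto_totalSpace_iff] at *
  refine ⟨hv.1, ?_⟩
  rw [trivialization_snd_smul _ (FiberBundle.mem_baseSet_trivializationAt' x)]
  refine (hc.smul hv.2).congr' ?_
  filter_upwards [eventually_mem_baseSet_trivializationAt (F := F) (E := E) hv.1] with i hi
  rw [trivialization_snd_smul _ hi]

lemma Filter.Tendsto.totalSpace_sub {v w : ∀ i, E (b i)} {v₀ w₀ : E x}
    (hv : Tendsto (fun i => (⟨b i, v i⟩ : TotalSpace F E)) l (𝓝 ⟨x, v₀⟩))
    (hw : Tendsto (fun i => (⟨b i, w i⟩ : TotalSpace F E)) l (𝓝 ⟨x, w₀⟩)) :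
    Tendsto (fun i => (⟨b i, v i - w i⟩ : TotalSpace F E)) l (𝓝 ⟨x, v₀ - w₀⟩) := by
  have := hv.totalSpace_add (Filter.Tendsto.totalSpace_smul (tendsto_const_nhds (x := (-1 : ℝ))) hw)
  simpa [sub_eq_add_neg] using this

lemma Filter.Tendsto.totalSpace_zero (hb : Tendsto b l (𝓝 x)) :
    Tendsto (fun i => (⟨b i, 0⟩ : TotalSpace F E)) l (𝓝 ⟨x, 0⟩) :=
  ((Bundle.Trivialization.continuous_zeroSection ℝ (F := F) (E := E)).tendsto x).comp hb

lemma Filter.Tendsto.totalSpace_sum {κ : Type*} (s : Finset κ) {v : κ → ∀ i, E (b i)}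
    {v₀ : κ → E x} (hb : Tendsto b l (𝓝 x))
    (hv : ∀ k ∈ s, Tendsto (fun i => (⟨b i, v k i⟩ : TotalSpace F E)) l (𝓝 ⟨x, v₀ k⟩)) :
    Tendsto (fun i => (⟨b i, ∑ k ∈ s, v k i⟩ : TotalSpace F E)) l (𝓝 ⟨x, ∑ k ∈ s, v₀ k⟩) := by
  classical
  induction s using Finset.induction_on with
  | empty => simpa using Filter.Tendsto.totalSpace_zero hb
  | insert a s ha ih =>
    simp only [Finset.sum_insert ha]
    exact (hv a (by simp)).totalSpace_add (ih fun k hk => hv k (by simp [hk]))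

-- Limits of an ultrafilter first agree in the base, then have the same coordinate in a single
-- trivialization.
variable (F E) in
lemma t2Space_totalSpace [T2Space B] : T2Space (TotalSpace F E) := by
  rw [t2_iff_ultrafilter]
  rintro ⟨x, v⟩ ⟨y, w⟩ 𝒰 h₁ h₂
  have h₁' : Tendsto (fun V : TotalSpace F E => (⟨V.proj, V.2⟩ : TotalSpace F E)) 𝒰
    (𝓝 ⟨x, v⟩) := h₁
  have h₂' : Tendsto (fun V : TotalSpace F E => (⟨V.proj, V.2⟩ : TotalSpace F E)) 𝒰
    (𝓝 ⟨y, w⟩) := h₂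
  rw [FiberBundle.tendsto_totalSpace_iff] at h₁' h₂'
  obtain rfl := tendsto_nhds_unique h₁'.1 h₂'.1
  have h := tendsto_nhds_unique h₁'.2 h₂'.2
  have hx := FiberBundle.mem_baseSet_trivializationAt' (F := F) (E := E) x
  refine (trivializationAt F E x).injOn ?_ ?_ (Prod.ext ?_ h)
  · exact (trivializationAt F E x).mem_source.2 hx
  · exact (trivializationAt F E x).mem_source.2 hx
  · exact ((trivializationAt F E x).coe_fst' (x := ⟨x, v⟩) hx).trans
      ((trivializationAt F E x).coe_fst' (x := ⟨x, w⟩) hx).symm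

end VectorBundle

/-! ### Compactness of disc bundles -/

section Riemannian
variable {B F : Type*} {E : B → Type*} [TopologicalSpace B] [NormedAddCommGroup F]
  [NormedSpace ℝ F] [∀ b, NormedAddCommGroup (E b)]
  [∀ b, InnerProductSpace ℝ (E b)] [TopologicalSpace (TotalSpace F E)] [FiberBundle F E]
  [VectorBundle ℝ F E] [IsContinuousRiemannianBundle F E]

variable (F E) in
lemma continuous_norm_totalSpace : Continuous (fun V : TotalSpace F E => ‖V.2‖) := by
  have h : Continuous (fun V : TotalSpace F E => inner ℝ V.2 V.2) :=
    Continuous.inner_bundle (F := F) (E := E) (b := fun V : TotalSpace F E => V.1)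
      (v := fun V => V.2) (w := fun V => V.2) continuous_id continuous_id
  simp only [real_inner_self_eq_norm_sq] at h
  simpa using h.sqrt

-- The trivialization at the limit base point distorts fibre norms by a locally bounded factor, so
-- along an ultrafilter the coordinates stay in a closed ball of the finite-dimensional model fibre.
variable (F E) in
lemma isCompact_norm_le_totalSpace [CompactSpace B] [FiniteDimensional ℝ F] (C : ℝ) :
    IsCompact {V : TotalSpace F E | ‖V.2‖ ≤ C} := by
  rw [isCompact_iff_ultrafilter_le_nhds]
  intro 𝒰 h𝒰
  obtain ⟨x, -, hx⟩ := isCompact_univ.ultrafilter_le_nhds (𝒰.map (π F E)) (by simp)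
  have hx' : Tendsto (π F E) 𝒰 (𝓝 x) := hx
  set e := trivializationAt F E x
  obtain ⟨D, hD, hD'⟩ := eventually_norm_trivializationAt_lt F E x
  have hbase : ∀ᶠ V in (𝒰 : Filter (TotalSpace F E)), V.proj ∈ e.baseSet :=
    eventually_mem_baseSet_trivializationAt (F := F) (E := E) hx'
  have hle : ∀ᶠ V in (𝒰 : Filter (TotalSpace F E)), (e V).2 ∈ Metric.closedBall (0 : F) (D * C) := by
    filter_upwards [hbase, hx'.eventually hD', le_principal_iff.1 h𝒰] with V hV hV' hV''
    have : (e V).2 = e.continuousLinearMapAt ℝ V.proj V.2 := by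
      rw [Trivialization.continuousLinearMapAt_apply, e.linearMapAt_apply, if_pos hV]
    rw [mem_closedBall_zero_iff, this]
    refine (ContinuousLinearMap.le_opNorm _ _).trans ?_
    have h0 : ‖V.2‖ ≤ C := hV''
    gcongr
  obtain ⟨y, -, hy⟩ := (isCompact_closedBall (0 : F) (D * C)).ultrafilter_le_nhds
    (𝒰.map fun V => (e V).2) (le_principal_iff.2 hle)
  have hy' : Tendsto (fun V => (e V).2) 𝒰 (𝓝 y) := hy
  have hxb := FiberBundle.mem_baseSet_trivializationAt' (F := F) (E := E) x
  have key : (𝒰 : Filter (TotalSpace F E)) ≤ 𝓝 ⟨x, e.symm x y⟩ := by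
    have : Tendsto (fun V : TotalSpace F E => (⟨V.proj, V.2⟩ : TotalSpace F E)) 𝒰
        (𝓝 ⟨x, e.symm x y⟩) := by
      rw [FiberBundle.tendsto_totalSpace_iff]
      refine ⟨hx', ?_⟩
      change Tendsto _ _ (𝓝 (e _).2)
      rw [e.apply_mk_symm hxb]
      exact hy'
    exact this
  refine ⟨_, ?_, key⟩
  exact le_of_tendsto (((continuous_norm_totalSpace F E).tendsto _).comp key)
    (le_principal_iff.1 h𝒰)
end Riemannian

/-! ### Continuous and closed families of subspaces -/

section TangentBundle

variable {d : ℕ} {M : Type*} [TopologicalSpace M]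
    [ChartedSpace (EuclideanSpace ℝ (Fin d)) M] [IsManifold (𝓡 d) ∞ M]

instance finiteDimensional_tangentSpace (x : M) : FiniteDimensional ℝ (TangentSpace (𝓡 d) x) :=
  inferInstanceAs (FiniteDimensional ℝ (EuclideanSpace ℝ (Fin d)))

/-- The graph `{(p, v) | p ∈ S, v ∈ V p}` of a family of subspaces. -/
def familyGraph {X : Type*} (b : X → M) (V : ∀ p : X, Submodule ℝ (TangentSpace (𝓡 d) (b p)))
    (S : Set X) : Set (X × TangentBundle (𝓡 d) M) :=
  {z | z.1 ∈ S ∧ ∃ v ∈ V z.1, z.2 = ⟨b z.1, v⟩}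

/-- A family of subspaces is closed on `S` if limits of its vectors over points of `S` belong to
it. -/
def IsClosedFamilyOn {X : Type*} [TopologicalSpace X] (b : X → M)
    (V : ∀ p : X, Submodule ℝ (TangentSpace (𝓡 d) (b p))) (S : Set X) : Prop :=
  ∀ p₀ ∈ S, ∀ v₀ : TangentSpace (𝓡 d) (b p₀),
    (p₀, (⟨b p₀, v₀⟩ : TangentBundle (𝓡 d) M)) ∈ closure (familyGraph b V S) → v₀ ∈ V p₀

lemma IsClosedFamilyOn.mem_of_tendsto {X ι : Type*} [TopologicalSpace X] {b : X → M}
    {V : ∀ p : X, Submodule ℝ (TangentSpace (𝓡 d) (b p))} {S : Set X}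
    (h : IsClosedFamilyOn b V S) {l : Filter ι} [l.NeBot] {p : ι → X}
    {v : ∀ i, TangentSpace (𝓡 d) (b (p i))} {p₀ : X} {v₀ : TangentSpace (𝓡 d) (b p₀)}
    (hp₀ : p₀ ∈ S) (hp : Tendsto p l (𝓝 p₀)) (hS : ∀ᶠ i in l, p i ∈ S)
    (hv : Tendsto (fun i => (⟨b (p i), v i⟩ : TangentBundle (𝓡 d) M)) l (𝓝 ⟨b p₀, v₀⟩))
    (hmem : ∀ᶠ i in l, v i ∈ V (p i)) : v₀ ∈ V p₀ := by
  refine h p₀ hp₀ v₀ (mem_closure_of_tendsto (hp.prodMk_nhds hv) ?_)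
  filter_upwards [hS, hmem] with i h₁ h₂ using ⟨h₁, v i, h₂, rfl⟩

/-- Coefficients in a local frame converge along an ultrafilter unless they escape to infinity.
After division by `1 + ‖a‖`, an escape would give a nontrivial vanishing combination of the frame at
the limit point. -/
lemma IsContinuousFamilyOn.isClosedFamilyOn [T2Space M] {X : Type*} [TopologicalSpace X]
    {b : X → M} (hb : Continuous b) {V : ∀ p : X, Submodule ℝ (TangentSpace (𝓡 d) (b p))}
    {S : Set X} (h : IsContinuousFamilyOn b V S) : IsClosedFamilyOn b V S := by
  intro p₀ hp₀ v₀ hv₀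
  have : T2Space (TangentBundle (𝓡 d) M) :=
    t2Space_totalSpace (EuclideanSpace ℝ (Fin d)) (TangentSpace (𝓡 d) : M → Type _)
  obtain ⟨U, hU, k, s, hs, hV⟩ := h p₀ hp₀
  rw [mem_closure_iff_ultrafilter] at hv₀
  obtain ⟨𝒰, h𝒰, hlim⟩ := hv₀
  have hp : Tendsto Prod.fst (𝒰 : Filter (X × TangentBundle (𝓡 d) M)) (𝓝 p₀) :=
    (continuous_fst.tendsto _).mono_left hlim
  have hv : Tendsto Prod.snd (𝒰 : Filter (X × TangentBundle (𝓡 d) M)) (𝓝 ⟨b p₀, v₀⟩) :=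
    (continuous_snd.tendsto _).mono_left hlim
  have hUS : ∀ᶠ z in (𝒰 : Filter (X × TangentBundle (𝓡 d) M)), z.1 ∈ U ∩ S := by
    filter_upwards [hp hU, h𝒰] with z h₁ h₂ using ⟨h₁, h₂.1⟩
  -- Coefficients in the frame are chosen for every `z`; the value 0 off the graph or off `U` is
  -- irrelevant along the ultrafilter.
  have hcoef : ∀ z : X × TangentBundle (𝓡 d) M, ∃ a : Fin k → ℝ, z ∈ familyGraph b V S →
      z.1 ∈ U → z.2 = ⟨b z.1, ∑ j, a j • s j z.1⟩ := by
    intro z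
    by_cases hz : z ∈ familyGraph b V S ∧ z.1 ∈ U
    · obtain ⟨⟨hzS, v, hvV, hzv⟩, hzU⟩ := hz
      rw [← (hV z.1 ⟨hzU, hzS⟩).2, Submodule.mem_span_range_iff_exists_fun] at hvV
      obtain ⟨a, ha⟩ := hvV
      exact ⟨a, fun _ _ => by rw [hzv, ha]⟩
    · exact ⟨0, fun h₁ h₂ => absurd ⟨h₁, h₂⟩ hz⟩
  choose a ha using hcoef
  have hpos : ∀ z, 0 < 1 + ‖a z‖ := fun z => by positivity
  obtain ⟨t, -, ht⟩ := (isCompact_Icc (a := (0 : ℝ)) (b := 1)).ultrafilter_le_nhds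
    (𝒰.map fun z => (1 + ‖a z‖)⁻¹) (tendsto_principal.2 (Filter.Eventually.of_forall fun z =>
      ⟨(inv_pos.2 (hpos z)).le, inv_le_one_of_one_le₀ (by linarith [norm_nonneg (a z)])⟩))
  have ht' : Tendsto (fun z => (1 + ‖a z‖)⁻¹) 𝒰 (𝓝 t) := ht
  have hnorm : ∀ z, ‖(1 + ‖a z‖)⁻¹ • a z‖ = 1 - (1 + ‖a z‖)⁻¹ := by
    intro z
    rw [norm_smul, norm_inv, Real.norm_of_nonneg (hpos z).le]
    have := (hpos z).ne'
    field_simp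
    ring
  obtain ⟨c, -, hc⟩ := (isCompact_closedBall (0 : Fin k → ℝ) 1).ultrafilter_le_nhds
    (𝒰.map fun z => (1 + ‖a z‖)⁻¹ • a z) (tendsto_principal.2 (Filter.Eventually.of_forall fun z =>
      mem_closedBall_zero_iff.2 (by rw [hnorm]; linarith [inv_pos.2 (hpos z)])))
  have hc' : Tendsto (fun z => (1 + ‖a z‖)⁻¹ • a z) 𝒰 (𝓝 c) := hc
  have hcn : ‖c‖ = 1 - t := by
    refine tendsto_nhds_unique hc'.norm ?_
    simp only [hnorm]
    exact tendsto_const_nhds.sub ht'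
  have hsum : Tendsto (fun z : X × TangentBundle (𝓡 d) M =>
      (⟨b z.1, ∑ j, ((1 + ‖a z‖)⁻¹ • a z) j • s j z.1⟩ : TangentBundle (𝓡 d) M)) 𝒰
      (𝓝 ⟨b p₀, ∑ j, c j • s j p₀⟩) := by
    refine Filter.Tendsto.totalSpace_sum _ ((hb.tendsto p₀).comp hp) fun j _ => ?_
    refine Filter.Tendsto.totalSpace_smul ((continuous_apply j).tendsto c |>.comp hc') ?_
    exact ((hs j p₀ ⟨mem_of_mem_nhds hU, hp₀⟩).tendsto.comp
      (tendsto_nhdsWithin_iff.2 ⟨hp, hUS⟩))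
  have hsum' : Tendsto (fun z : X × TangentBundle (𝓡 d) M =>
      (⟨b z.1, ∑ j, ((1 + ‖a z‖)⁻¹ • a z) j • s j z.1⟩ : TangentBundle (𝓡 d) M)) 𝒰
      (𝓝 ⟨b p₀, t • v₀⟩) := by
    have h1 : Tendsto (fun z : X × TangentBundle (𝓡 d) M =>
        (⟨z.2.1, (1 + ‖a z‖)⁻¹ • z.2.2⟩ : TangentBundle (𝓡 d) M)) 𝒰 (𝓝 ⟨b p₀, t • v₀⟩) :=
      Filter.Tendsto.totalSpace_smul (b := fun z : X × TangentBundle (𝓡 d) M => z.2.1)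
        (v := fun z => z.2.2) ht' hv
    refine h1.congr' ?_
    filter_upwards [h𝒰, hUS] with z h₁ h₂
    rw [ha z h₁ h₂.1]
    simp [Finset.smul_sum, smul_smul]
  have heq : ∑ j, c j • s j p₀ = t • v₀ := by
    have := tendsto_nhds_unique hsum hsum'
    simpa using this
  obtain ⟨hli, hspan⟩ := hV p₀ ⟨mem_of_mem_nhds hU, hp₀⟩
  -- `t = 0` means that the coefficients escape: then `‖c‖ = 1`, while linear independence forces `c
  -- = 0`.
  have ht0 : t ≠ 0 := by
    rintro rfl
    rw [zero_smul] at heq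
    have hc0 : c = 0 := funext fun j => Fintype.linearIndependent_iff.1 hli c heq j
    simp [hc0] at hcn
  have : v₀ = t⁻¹ • ∑ j, c j • s j p₀ := by rw [heq, smul_smul, inv_mul_cancel₀ ht0, one_smul]
  rw [this, ← hspan]
  exact Submodule.smul_mem _ _ (Submodule.sum_mem _ fun j _ =>
    Submodule.smul_mem _ _ (Submodule.subset_span ⟨j, rfl⟩))

variable [RiemannianBundle (fun x : M => TangentSpace (𝓡 d) x)]
    [IsContMDiffRiemannianBundle (𝓡 d) ∞ (EuclideanSpace ℝ (Fin d))
      (fun x : M => TangentSpace (𝓡 d) x)]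

variable (d M) in
lemma isContinuousRiemannianBundle_tangentSpace :
    IsContinuousRiemannianBundle (EuclideanSpace ℝ (Fin d))
      (fun x : M => TangentSpace (𝓡 d) x) := by
  obtain ⟨g, hg, h⟩ := IsContMDiffRiemannianBundle.exists_contMDiff (IB := 𝓡 d) (n := ∞)
    (F := EuclideanSpace ℝ (Fin d)) (E := fun x : M => TangentSpace (𝓡 d) x)
  exact ⟨g, hg.continuous, h⟩

variable (d M) in
lemma continuous_norm_tangentBundle :
    Continuous (fun V : TangentBundle (𝓡 d) M => ‖V.2‖) :=
  have := isContinuousRiemannianBundle_tangentSpace d M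
  continuous_norm_totalSpace (EuclideanSpace ℝ (Fin d)) (fun x : M => TangentSpace (𝓡 d) x)

variable (M) in
lemma isCompact_norm_le_tangentBundle [CompactSpace M] (C : ℝ) :
    IsCompact {V : TangentBundle (𝓡 d) M | ‖V.2‖ ≤ C} :=
  have := isContinuousRiemannianBundle_tangentSpace d M
  isCompact_norm_le_totalSpace (EuclideanSpace ℝ (Fin d)) (fun x : M => TangentSpace (𝓡 d) x) C

end TangentBundle

/-! ### Graph transform of a dominated cocycle -/

section GraphTransform

variable {P : Type*} {F : P → P} {S U : P → Type*}
  [∀ p, NormedAddCommGroup (S p)] [∀ p, NormedSpace ℝ (S p)] [∀ p, FiniteDimensional ℝ (S p)]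
  [∀ p, NormedAddCommGroup (U p)] [∀ p, NormedSpace ℝ (U p)] [∀ p, FiniteDimensional ℝ (U p)]
  (Ass : ∀ p, S p →ₗ[ℝ] S (F p)) (Asu : ∀ p, U p →ₗ[ℝ] S (F p))
  (Aus : ∀ p, S p →ₗ[ℝ] U (F p)) (Auu : ∀ p, U p ≃ₗ[ℝ] U (F p))

/-- The graph transform of a family of linear maps `G p : S p → U p` under the cocycle with blocks
`Ass`, `Asu`, `Aus`, `Auu`. -/
def graphTransform (G : ∀ p, S p →ₗ[ℝ] U p) (p : P) : S p →ₗ[ℝ] U p :=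
  (Auu p).symm.toLinearMap ∘ₗ (G (F p) ∘ₗ (Ass p + Asu p ∘ₗ G p) - Aus p)

lemma graphTransform_apply (G : ∀ p, S p →ₗ[ℝ] U p) (p : P) (s : S p) :
    graphTransform Ass Asu Aus Auu G p s =
      (Auu p).symm (G (F p) (Ass p s + Asu p (G p s)) - Aus p s) := rfl

variable {Ass Asu Aus Auu} {c δ : ℝ}

/-- Domination is used in this form: pulling back by `Auu` what was carried forward by `Ass` gains a
factor `1/2`, while an error `e‖s‖` costs the expansion constant `c`. Both follow by writing `y =
Auu z` and cancelling `‖Auu z‖`. -/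
lemma norm_symm_le_of_dominated (hc : 0 < c)
    (huu : ∀ p u, c * ‖u‖ ≤ ‖Auu p u‖)
    (hdom : ∀ p s u, 2 * ‖Ass p s‖ * ‖u‖ ≤ ‖Auu p u‖ * ‖s‖) {p : P} {s : S p} {y : U (F p)}
    {D e : ℝ} (hD : 0 ≤ D) (he : 0 ≤ e) (hy : ‖y‖ ≤ D * ‖Ass p s‖ + e * ‖s‖) :
    ‖(Auu p).symm y‖ ≤ (D / 2 + e / c) * ‖s‖ := by
  obtain ⟨z, rfl⟩ := (Auu p).surjective y
  rw [LinearEquiv.symm_apply_apply]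
  have h1 := huu p z
  have h2 := hdom p s z
  by_cases hz : ‖z‖ = 0
  · rw [hz]; positivity
  have hz' : 0 < ‖z‖ := lt_of_le_of_ne (norm_nonneg _) (Ne.symm hz)
  have hY : 0 < ‖Auu p z‖ := lt_of_lt_of_le (by positivity) h1
  have h3 : ‖z‖ * ‖Auu p z‖ ≤ (D / 2 + e / c) * ‖s‖ * ‖Auu p z‖ := by
    calc ‖z‖ * ‖Auu p z‖ ≤ ‖z‖ * (D * ‖Ass p s‖ + e * ‖s‖) := by gcongr
      _ = D / 2 * (2 * ‖Ass p s‖ * ‖z‖) + e * ‖s‖ / c * (c * ‖z‖) := by field_simp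
      _ ≤ D / 2 * (‖Auu p z‖ * ‖s‖) + e * ‖s‖ / c * ‖Auu p z‖ := by gcongr
      _ = (D / 2 + e / c) * ‖s‖ * ‖Auu p z‖ := by ring
  exact le_of_mul_le_mul_right h3 hY

/-- Here `D = 1/2` and `e = 5δ/4`, and `1/4 + 5/32 < 1/2` since `δ/c ≤ 1/8`. -/
lemma norm_graphTransform_le (hc : 0 < c) (hδ : 0 ≤ δ) (hδc : 8 * δ ≤ c)
    (huu : ∀ p u, c * ‖u‖ ≤ ‖Auu p u‖)
    (hdom : ∀ p s u, 2 * ‖Ass p s‖ * ‖u‖ ≤ ‖Auu p u‖ * ‖s‖)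
    (hsu : ∀ p u, ‖Asu p u‖ ≤ δ * ‖u‖) (hus : ∀ p s, ‖Aus p s‖ ≤ δ * ‖s‖)
    {G : ∀ p, S p →ₗ[ℝ] U p} (hG : ∀ p s, ‖G p s‖ ≤ 1 / 2 * ‖s‖) (p : P) (s : S p) :
    ‖graphTransform Ass Asu Aus Auu G p s‖ ≤ 1 / 2 * ‖s‖ := by
  have hy : ‖G (F p) (Ass p s + Asu p (G p s)) - Aus p s‖ ≤
      1 / 2 * ‖Ass p s‖ + 5 / 4 * δ * ‖s‖ := by
    calc ‖G (F p) (Ass p s + Asu p (G p s)) - Aus p s‖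
        ≤ 1 / 2 * (‖Ass p s‖ + δ * (1 / 2 * ‖s‖)) + δ * ‖s‖ := by
          refine (norm_sub_le _ _).trans (add_le_add ((hG _ _).trans ?_) (hus _ _))
          gcongr
          refine (norm_add_le _ _).trans (add_le_add le_rfl ((hsu _ _).trans ?_))
          gcongr
          exact hG _ _
      _ = _ := by ring
  refine (norm_symm_le_of_dominated hc huu hdom (by norm_num) (by positivity) hy).trans ?_
  gcongr
  have : δ / c ≤ 1 / 8 := by rw [div_le_iff₀ hc]; linarith
  rw [mul_div_assoc]
  linarith

/-- The contraction factor obtained is `1/2 + δ/c ≤ 5/8`, rounded up to `3/4`. -/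
lemma norm_graphTransform_sub_le (hc : 0 < c) (hδ : 0 ≤ δ) (hδc : 8 * δ ≤ c)
    (huu : ∀ p u, c * ‖u‖ ≤ ‖Auu p u‖)
    (hdom : ∀ p s u, 2 * ‖Ass p s‖ * ‖u‖ ≤ ‖Auu p u‖ * ‖s‖)
    (hsu : ∀ p u, ‖Asu p u‖ ≤ δ * ‖u‖)
    {G H : ∀ p, S p →ₗ[ℝ] U p} (hG : ∀ p s, ‖G p s‖ ≤ 1 / 2 * ‖s‖)
    (hH : ∀ p s, ‖H p s‖ ≤ 1 / 2 * ‖s‖) {D : ℝ} (hD : 0 ≤ D)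
    (hGH : ∀ p s, ‖G p s - H p s‖ ≤ D * ‖s‖) (p : P) (s : S p) :
    ‖graphTransform Ass Asu Aus Auu G p s - graphTransform Ass Asu Aus Auu H p s‖ ≤
      3 / 4 * D * ‖s‖ := by
  rw [graphTransform_apply, graphTransform_apply, ← map_sub]
  have hy : ‖G (F p) (Ass p s + Asu p (G p s)) - Aus p s -
      (H (F p) (Ass p s + Asu p (H p s)) - Aus p s)‖ ≤ D * ‖Ass p s‖ + D * δ * ‖s‖ := by
    have h : G (F p) (Ass p s + Asu p (G p s)) - Aus p s -
        (H (F p) (Ass p s + Asu p (H p s)) - Aus p s) =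
        (G (F p) (Ass p s + Asu p (G p s)) - H (F p) (Ass p s + Asu p (G p s))) +
        H (F p) (Asu p (G p s - H p s)) := by
      simp only [map_add, map_sub]; abel
    rw [h]
    calc _ ≤ D * (‖Ass p s‖ + δ * (1 / 2 * ‖s‖)) + 1 / 2 * (δ * (D * ‖s‖)) := by
          refine (norm_add_le _ _).trans (add_le_add ((hGH _ _).trans ?_) ((hH _ _).trans ?_))
          · gcongr
            refine (norm_add_le _ _).trans (add_le_add le_rfl ((hsu _ _).trans ?_))
            gcongr
            exact hG _ _
          · gcongr
            refine (hsu _ _).trans ?_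
            gcongr
            exact hGH _ _
      _ = _ := by ring
  refine (norm_symm_le_of_dominated hc huu hdom hD (by positivity) hy).trans ?_
  gcongr
  have : δ / c ≤ 1 / 8 := by rw [div_le_iff₀ hc]; linarith
  rw [mul_div_assoc]
  nlinarith

/-- A dominated cocycle has an invariant family of graphs. -/
theorem exists_invariant_graph (hc : 0 < c) (hδ : 0 ≤ δ) (hδc : 8 * δ ≤ c)
    (huu : ∀ p u, c * ‖u‖ ≤ ‖Auu p u‖)
    (hdom : ∀ p s u, 2 * ‖Ass p s‖ * ‖u‖ ≤ ‖Auu p u‖ * ‖s‖)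
    (hsu : ∀ p u, ‖Asu p u‖ ≤ δ * ‖u‖) (hus : ∀ p s, ‖Aus p s‖ ≤ δ * ‖s‖) :
    ∃ G : ∀ p, S p →ₗ[ℝ] U p, (∀ p s, ‖G p s‖ ≤ 1 / 2 * ‖s‖) ∧
      ∀ p s, Aus p s + Auu p (G p s) = G (F p) (Ass p s + Asu p (G p s)) := by
  set Γ : (∀ p, S p →ₗ[ℝ] U p) → ∀ p, S p →ₗ[ℝ] U p := graphTransform Ass Asu Aus Auu with hΓ
  -- Iteration starts at the zero graph. A geometric bound at each vector suffices for the limit, so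
  -- the space of all families needs no norm.
  set Gn : ℕ → ∀ p, S p →ₗ[ℝ] U p := fun n => Γ^[n] 0 with hGn
  have hsucc : ∀ n, Gn (n + 1) = Γ (Gn n) := fun n => Function.iterate_succ_apply' _ _ _
  have hball : ∀ n p s, ‖Gn n p s‖ ≤ 1 / 2 * ‖s‖ := by
    intro n
    induction n with
    | zero => intro p s; simp [hGn]
    | succ n ih =>
      rw [hsucc]
      exact norm_graphTransform_le hc hδ hδc huu hdom hsu hus ih
  have hdist : ∀ n p s, ‖Gn n p s - Gn (n + 1) p s‖ ≤ 1 / 2 * (3 / 4) ^ n * ‖s‖ := by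
    intro n
    induction n with
    | zero =>
      intro p s
      simpa [hGn] using hball 1 p s
    | succ n ih =>
      intro p s
      rw [hsucc n, hsucc (n + 1)]
      refine (norm_graphTransform_sub_le hc hδ hδc huu hdom hsu (hball _) (hball _)
        (by positivity) ih p s).trans (le_of_eq ?_)
      rw [pow_succ]; ring
  have hlim : ∀ p s, ∃ y, Tendsto (fun n => Gn n p s) atTop (𝓝 y) := by
    intro p s
    have : CompleteSpace (U p) := FiniteDimensional.complete ℝ (U p)
    refine cauchySeq_tendsto_of_complete
      (cauchySeq_of_le_geometric (3 / 4) (1 / 2 * ‖s‖) (by norm_num) fun n => ?_)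
    rw [dist_eq_norm]
    exact (hdist n p s).trans (le_of_eq (by ring))
  choose g hg using hlim
  have hg' : ∀ p, Tendsto (fun n s => Gn n p s) atTop (𝓝 (g p)) := fun p =>
    tendsto_pi_nhds.2 (hg p)
  set G : ∀ p, S p →ₗ[ℝ] U p := fun p => linearMapOfTendsto (g p) (fun n => Gn n p) (hg' p)
  have hG : ∀ p s, Tendsto (fun n => Gn n p s) atTop (𝓝 (G p s)) := hg
  have hGle : ∀ p s, ‖G p s‖ ≤ 1 / 2 * ‖s‖ := fun p s =>
    le_of_tendsto (hG p s).norm (Eventually.of_forall fun n => hball n p s)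
  refine ⟨G, hGle, fun p s => ?_⟩
  have h1 : Tendsto (fun n => Aus p s + Auu p (Gn (n + 1) p s)) atTop
      (𝓝 (Aus p s + Auu p (G p s))) := by
    refine tendsto_const_nhds.add ?_
    exact ((Auu p).toLinearMap.continuous_of_finiteDimensional.tendsto _).comp
      ((tendsto_add_atTop_iff_nat 1).2 (hG p s))
  have hx : Tendsto (fun n => Ass p s + Asu p (Gn n p s)) atTop
      (𝓝 (Ass p s + Asu p (G p s))) :=
    tendsto_const_nhds.add (((Asu p).continuous_of_finiteDimensional.tendsto _).comp (hG p s))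
  have h2 : Tendsto (fun n => Gn n (F p) (Ass p s + Asu p (Gn n p s))) atTop
      (𝓝 (G (F p) (Ass p s + Asu p (G p s)))) := by
    -- Both the graph and its argument vary with `n`; the uniform Lipschitz bound `1/2` absorbs the
    -- motion of the argument.
    have h3 : Tendsto (fun n => Gn n (F p) ((Ass p s + Asu p (Gn n p s)) -
        (Ass p s + Asu p (G p s)))) atTop (𝓝 0) := by
      refine squeeze_zero_norm (fun n => hball n _ _) ?_
      have := (tendsto_const_nhds (x := (1 / 2 : ℝ))).mul
        (hx.sub (tendsto_const_nhds (x := Ass p s + Asu p (G p s)))).norm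
      simpa using this
    have h4 := h3.add (hG (F p) (Ass p s + Asu p (G p s)))
    rw [zero_add] at h4
    refine h4.congr fun n => ?_
    rw [← map_add, sub_add_cancel]
  refine tendsto_nhds_unique h1 (h2.congr fun n => ?_)
  rw [hsucc, hΓ, graphTransform_apply, LinearEquiv.apply_symm_apply]
  abel

/-- The distance to an invariant family of graphs, relative to the stable component, is contracted
backwards along orbits in the stable cone. -/
lemma norm_mul_norm_sub_le_of_dominated (hc : 0 < c) (hδc : 8 * δ ≤ c)
    (huu : ∀ p u, c * ‖u‖ ≤ ‖Auu p u‖)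
    (hdom : ∀ p s u, 2 * ‖Ass p s‖ * ‖u‖ ≤ ‖Auu p u‖ * ‖s‖)
    (hsu : ∀ p u, ‖Asu p u‖ ≤ δ * ‖u‖)
    {G : ∀ p, S p →ₗ[ℝ] U p} (hG : ∀ p s, ‖G p s‖ ≤ 1 / 2 * ‖s‖) {p : P} {s : S p} {u : U p}
    (hsmall : ‖u‖ ≤ 1 / 2 * ‖s‖) (D : U p) :
    ‖Ass p s + Asu p u‖ * ‖D‖ ≤ 3 / 5 * (‖Auu p D - G (F p) (Asu p D)‖ * ‖s‖) := by
  have h1 : ‖Auu p D‖ ≤ ‖Auu p D - G (F p) (Asu p D)‖ + 1 / 16 * ‖Auu p D‖ := by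
    have h2 : ‖G (F p) (Asu p D)‖ ≤ 1 / 2 * (δ * ‖D‖) := by
      refine (hG _ _).trans ?_
      gcongr
      exact hsu _ _
    have h3 := norm_sub_norm_le (Auu p D) (G (F p) (Asu p D))
    have h4 := huu p D
    have h5 : 8 * δ * ‖D‖ ≤ c * ‖D‖ := by gcongr
    linarith
  have h2 : ‖Ass p s + Asu p u‖ ≤ ‖Ass p s‖ + c / 16 * ‖s‖ := by
    refine (norm_add_le _ _).trans (add_le_add le_rfl ((hsu _ _).trans ?_))
    calc δ * ‖u‖ ≤ c / 8 * (1 / 2 * ‖s‖) := by gcongr; linarith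
      _ = _ := by ring
  have h3 := hdom p s D
  have h4 : c * ‖D‖ * ‖s‖ ≤ ‖Auu p D‖ * ‖s‖ := by
    gcongr; exact huu _ _
  -- `9/16` is `1/2` from domination plus `1/16` from the off-diagonal block; the loss `16/15` below
  -- turns it into `3/5`.
  have h5 : ‖Ass p s + Asu p u‖ * ‖D‖ ≤ 9 / 16 * (‖Auu p D‖ * ‖s‖) := by
    calc _ ≤ (‖Ass p s‖ + c / 16 * ‖s‖) * ‖D‖ := by gcongr
      _ = 1 / 2 * (2 * ‖Ass p s‖ * ‖D‖) + 1 / 16 * (c * ‖D‖ * ‖s‖) := by ring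
      _ ≤ _ := by linarith
  have h6 : ‖Auu p D‖ * ‖s‖ ≤ 16 / 15 * ‖Auu p D - G (F p) (Asu p D)‖ * ‖s‖ := by
    gcongr; linarith
  linarith

/-- The correction `G (Asu D)` is at most `(c/16)‖D‖`, too small to cancel `Auu D`. This covers the
case in which the stable component of an image vanishes and the preceding inequality gives nothing.
-/
lemma eq_zero_of_sub_eq_zero_of_dominated (hc : 0 < c) (hδc : 8 * δ ≤ c)
    (huu : ∀ p u, c * ‖u‖ ≤ ‖Auu p u‖) (hsu : ∀ p u, ‖Asu p u‖ ≤ δ * ‖u‖)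
    {G : ∀ p, S p →ₗ[ℝ] U p} (hG : ∀ p s, ‖G p s‖ ≤ 1 / 2 * ‖s‖) {p : P} {D : U p}
    (hD : Auu p D - G (F p) (Asu p D) = 0) : D = 0 := by
  have h1 := huu p D
  rw [sub_eq_zero.1 hD] at h1
  have h2 := hG (F p) (Asu p D)
  have h3 := hsu p D
  by_contra hne
  have hpos : 0 < ‖D‖ := norm_pos_iff.2 hne
  have h4 : 8 * δ * ‖D‖ ≤ c * ‖D‖ := by gcongr
  have h5 : 0 < c * ‖D‖ := by positivity
  linarith

end GraphTransform

/-! ### Invariant families inside the stable cone -/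

section Cocycle

variable {P : Type*} {V : P → Type*} [∀ p, NormedAddCommGroup (V p)] [∀ p, NormedSpace ℝ (V p)]

/-- The action on the total space of the cocycle `A p : V p → V (F p)`. -/
def cocycleStep {F : P → P} (A : ∀ p, V p →ₗ[ℝ] V (F p)) (z : Σ p, V p) : Σ p, V p :=
  ⟨F z.1, A z.1 z.2⟩

/-- The cone of width `1 / 2` about the subspaces `S p`, along the subspaces `U p`. -/
def stableCone {S U : ∀ p, Submodule ℝ (V p)} (hSU : ∀ p, IsCompl (S p) (U p)) : Set (Σ p, V p) :=
  {z | ‖(U z.1).projection (S z.1) (hSU z.1).symm z.2‖ ≤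
    1 / 2 * ‖(S z.1).projection (U z.1) (hSU z.1) z.2‖}

/-- The cocycle `A` nearly preserves the splitting `S ⊕ U`, and `U` dominates `S`. -/
structure IsNearlyDominated {F : P → P} (A : ∀ p, V p →ₗ[ℝ] V (F p))
    {S U : ∀ p, Submodule ℝ (V p)} (hSU : ∀ p, IsCompl (S p) (U p)) (c δ : ℝ) : Prop where
  pos : 0 < c
  nonneg : 0 ≤ δ
  le : 8 * δ ≤ c
  us : ∀ p, ∀ s ∈ S p, ‖(U (F p)).projection (S (F p)) (hSU (F p)).symm (A p s)‖ ≤ δ * ‖s‖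
  su : ∀ p, ∀ u ∈ U p, ‖(S (F p)).projection (U (F p)) (hSU (F p)) (A p u)‖ ≤ δ * ‖u‖
  uu : ∀ p, ∀ u ∈ U p, c * ‖u‖ ≤ ‖(U (F p)).projection (S (F p)) (hSU (F p)).symm (A p u)‖
  dom : ∀ p, ∀ s ∈ S p, ∀ u ∈ U p,
    2 * ‖(S (F p)).projection (U (F p)) (hSU (F p)) (A p s)‖ * ‖u‖ ≤
      ‖(U (F p)).projection (S (F p)) (hSU (F p)).symm (A p u)‖ * ‖s‖
  finrank : ∀ p, Module.finrank ℝ (U p) = Module.finrank ℝ (U (F p))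

variable [∀ p, FiniteDimensional ℝ (V p)]

/-- The vectors whose forward orbit stays in the stable cone form an invariant family of subspaces
which is transverse to `U`. -/
theorem IsNearlyDominated.exists_family {F : P → P} {A : ∀ p, V p →ₗ[ℝ] V (F p)}
    {S U : ∀ p, Submodule ℝ (V p)} {hSU : ∀ p, IsCompl (S p) (U p)} {c δ : ℝ}
    (h : IsNearlyDominated A hSU c δ) :
    ∃ E : ∀ p, Submodule ℝ (V p),
      (∀ p v, v ∈ E p ↔ ∀ n, (cocycleStep A)^[n] ⟨p, v⟩ ∈ stableCone hSU) ∧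
      (∀ p, IsCompl (E p) (U p)) := by
  obtain ⟨hc, hδ, hδc, hus, hsu, huu, hdom, hrank⟩ := h
  set Ps : ∀ p, V p →ₗ[ℝ] S p := fun p => (S p).projectionOnto (U p) (hSU p) with hPs
  set Pu : ∀ p, V p →ₗ[ℝ] U p := fun p => (U p).projectionOnto (S p) (hSU p).symm with hPu
  have hadd : ∀ p v, (Ps p v : V p) + Pu p v = v := fun p v =>
    Submodule.projection_add_projection_eq_self (hSU p) v
  have hPss : ∀ p (s : S p), Ps p s = s := fun p s => Submodule.projectionOnto_apply_left _ s
  have hPsu : ∀ p (u : U p), Ps p u = 0 := fun p u => Submodule.projectionOnto_apply_right _ u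
  have hPuu : ∀ p (u : U p), Pu p u = u := fun p u => Submodule.projectionOnto_apply_left _ u
  have hPus : ∀ p (s : S p), Pu p s = 0 := fun p s => Submodule.projectionOnto_apply_right _ s
  set Ass : ∀ p, S p →ₗ[ℝ] S (F p) := fun p => Ps (F p) ∘ₗ A p ∘ₗ (S p).subtype with hAss
  set Asu : ∀ p, U p →ₗ[ℝ] S (F p) := fun p => Ps (F p) ∘ₗ A p ∘ₗ (U p).subtype with hAsu
  set Aus : ∀ p, S p →ₗ[ℝ] U (F p) := fun p => Pu (F p) ∘ₗ A p ∘ₗ (S p).subtype with hAus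
  set Auu₀ : ∀ p, U p →ₗ[ℝ] U (F p) := fun p => Pu (F p) ∘ₗ A p ∘ₗ (U p).subtype with hAuu₀
  have huu₀ : ∀ p (u : U p), c * ‖u‖ ≤ ‖Auu₀ p u‖ := fun p u => huu p u u.2
  have hinj : ∀ p, Function.Injective (Auu₀ p) := fun p => by
    rw [injective_iff_map_eq_zero]
    intro u hu
    have := huu₀ p u
    rw [hu, norm_zero] at this
    exact norm_le_zero_iff.1 (nonpos_of_mul_nonpos_right this hc)
  -- The expansion bound gives injectivity, and equality of dimensions makes the block invertible.
  set Auu : ∀ p, U p ≃ₗ[ℝ] U (F p) := fun p =>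
    LinearMap.linearEquivOfInjective (Auu₀ p) (hinj p) (hrank p) with hAuu
  have hAuu' : ∀ p u, Auu p u = Auu₀ p u := fun p u => rfl
  have hdom' : ∀ p (s : S p) (u : U p), 2 * ‖Ass p s‖ * ‖u‖ ≤ ‖Auu p u‖ * ‖s‖ :=
    fun p s u => hdom p s s.2 u u.2
  have hsu' : ∀ p (u : U p), ‖Asu p u‖ ≤ δ * ‖u‖ := fun p u => hsu p u u.2
  have huu' : ∀ p (u : U p), c * ‖u‖ ≤ ‖Auu p u‖ := huu₀
  obtain ⟨G, hG, hinv⟩ := exists_invariant_graph (Ass := Ass) (Asu := Asu) (Aus := Aus)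
    (Auu := Auu) hc hδ hδc huu' hdom' hsu' (fun p s => hus p s s.2)
  have hPsA : ∀ p v, Ps (F p) (A p v) = Ass p (Ps p v) + Asu p (Pu p v) := by
    intro p v
    conv_lhs => rw [← hadd p v, map_add, map_add]
    rfl
  have hPuA : ∀ p v, Pu (F p) (A p v) = Aus p (Ps p v) + Auu p (Pu p v) := by
    intro p v
    conv_lhs => rw [← hadd p v, map_add, map_add]
    rfl
  have hcone : ∀ z : Σ p, V p, z ∈ stableCone hSU ↔ ‖Pu z.1 z.2‖ ≤ 1 / 2 * ‖Ps z.1 z.2‖ :=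
    fun z => Iff.rfl
  -- `D` is the deviation from the graph of `G`; its kernel is the required family. It remains to
  -- see that `D` vanishes exactly on orbits which never leave the cone.
  set D : ∀ p, V p →ₗ[ℝ] U p := fun p => Pu p - G p ∘ₗ Ps p with hD
  have hDdef : ∀ p v, D p v = Pu p v - G p (Ps p v) := fun p v => rfl
  have hDA : ∀ p v, D (F p) (A p v) = Auu p (D p v) - G (F p) (Asu p (D p v)) := by
    intro p v
    have := hinv p (Ps p v)
    simp only [hDdef, hPsA, hPuA, map_add, map_sub] at this ⊢
    rw [eq_sub_iff_add_eq.2 this]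
    abel
  have hDinv : ∀ p v, D p v = 0 → D (F p) (A p v) = 0 := fun p v hv => by
    rw [hDA, hv]; simp
  have hstep : ∀ p v, ‖Pu p v‖ ≤ 1 / 2 * ‖Ps p v‖ →
      ‖Ps (F p) (A p v)‖ * ‖D p v‖ ≤ 3 / 5 * (‖D (F p) (A p v)‖ * ‖Ps p v‖) := by
    intro p v hv
    rw [hPsA, hDA]
    exact norm_mul_norm_sub_le_of_dominated hc hδc huu' hdom' hsu' hG hv (D p v)
  set CS : Set (Σ p, V p) := {z | ∀ n, (cocycleStep A)^[n] z ∈ stableCone hSU} with hCS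
  have hCS0 : ∀ p v, ⟨p, v⟩ ∈ CS → ‖Pu p v‖ ≤ 1 / 2 * ‖Ps p v‖ := fun p v hz => hz 0
  have hCS1 : ∀ p v, ⟨p, v⟩ ∈ CS → (⟨F p, A p v⟩ : Σ p, V p) ∈ CS := fun p v hz n => hz (n + 1)
  -- In the cone the ratio `‖D‖ / ‖Ps‖` is at most 1, and one step backwards multiplies it by at
  -- most `3/5`. Applying this at the `n`-th image gives the bound.
  have hdecay : ∀ n : ℕ, ∀ p v, ⟨p, v⟩ ∈ CS → ‖D p v‖ ≤ (3 / 5 : ℝ) ^ n * ‖Ps p v‖ := by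
    intro n
    induction n with
    | zero =>
      intro p v hz
      rw [hDdef]
      have h1 := hCS0 p v hz
      have h2 := hG p (Ps p v)
      have h3 := norm_sub_le (Pu p v) (G p (Ps p v))
      simp only [pow_zero]
      linarith
    | succ n ih =>
      intro p v hz
      have h1 := ih (F p) (A p v) (hCS1 p v hz)
      have h2 := hstep p v (hCS0 p v hz)
      rcases (norm_nonneg (Ps (F p) (A p v))).eq_or_lt with h0 | h0
      -- Here the ratio at the image is not defined; its deviation is 0 and injectivity pulls this
      -- back.
      · rw [← h0, mul_zero] at h1
        have h3 : D (F p) (A p v) = 0 := norm_le_zero_iff.1 h1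
        have h4 : D p v = 0 :=
          eq_zero_of_sub_eq_zero_of_dominated hc hδc huu' hsu' hG ((hDA p v).symm.trans h3)
        rw [h4, norm_zero]
        positivity
      · have h3 : ‖Ps (F p) (A p v)‖ * ‖D p v‖ ≤
            ‖Ps (F p) (A p v)‖ * ((3 / 5 : ℝ) ^ (n + 1) * ‖Ps p v‖) := by
          calc _ ≤ 3 / 5 * (‖D (F p) (A p v)‖ * ‖Ps p v‖) := h2
            _ ≤ 3 / 5 * ((3 / 5 : ℝ) ^ n * ‖Ps (F p) (A p v)‖ * ‖Ps p v‖) :=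
              mul_le_mul_of_nonneg_left (mul_le_mul_of_nonneg_right h1 (norm_nonneg _))
                (by norm_num)
            _ = _ := by rw [pow_succ]; ring
        exact le_of_mul_le_mul_left h3 h0
  have hCSD : ∀ z : Σ p, V p, z ∈ CS ↔ D z.1 z.2 = 0 := by
    intro z
    constructor
    · intro hz
      have h1 : Tendsto (fun n : ℕ => (3 / 5 : ℝ) ^ n * ‖Ps z.1 z.2‖) atTop (𝓝 0) := by
        simpa using (tendsto_pow_atTop_nhds_zero_of_lt_one (r := (3 / 5 : ℝ)) (by norm_num)
          (by norm_num)).mul_const ‖Ps z.1 z.2‖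
      exact norm_le_zero_iff.1 (ge_of_tendsto' h1 fun n => hdecay n z.1 z.2 hz)
    · intro hz n
      have h1 : ∀ n, D ((cocycleStep A)^[n] z).1 ((cocycleStep A)^[n] z).2 = 0 := by
        intro n
        induction n with
        | zero => exact hz
        | succ n ih =>
          rw [Function.iterate_succ_apply']
          exact hDinv _ _ ih
      rw [hcone]
      have h2 := h1 n
      rw [hDdef, sub_eq_zero] at h2
      rw [h2]
      exact hG _ _
  refine ⟨fun p => LinearMap.ker (D p), fun p v => ?_, fun p => ?_⟩
  · exact (hCSD ⟨p, v⟩).symm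
  · refine ⟨Submodule.disjoint_def.2 fun v hv hvU => ?_, codisjoint_iff.2 (eq_top_iff.2 ?_)⟩
    · have h1 : D p v = 0 := hv
      have h2 : v = ((⟨v, hvU⟩ : U p) : V p) := rfl
      rw [hDdef, h2, hPsu, hPuu, map_zero, sub_zero] at h1
      exact congrArg Subtype.val h1
    · intro v _
      refine Submodule.mem_sup.2 ⟨Ps p v + G p (Ps p v), ?_, Pu p v - G p (Ps p v), ?_, ?_⟩
      · change D p _ = 0
        rw [hDdef, map_add, map_add, hPss, hPsu, hPus, hPuu]
        simp
      · exact Submodule.sub_mem _ (Subtype.mem _) (Subtype.mem _)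
      · rw [← hadd p v]
        simp only [hadd]
        conv_rhs => rw [← hadd p v]
        abel

end Cocycle

/-! ### Parametrized diffeomorphisms and their tangent maps -/

section Families

variable {d : ℕ} {M : Type*} [TopologicalSpace M]
    [ChartedSpace (EuclideanSpace ℝ (Fin d)) M] [IsManifold (𝓡 d) ∞ M]

lemma Diff2.mdifferentiable (g : Diff2 d M) : MDifferentiable (𝓡 d) (𝓡 d) g :=
  g.contMDiff_toFun.mdifferentiable (by norm_num)

/-- The tangent map of a diffeomorphism. -/
def Diff2.tmap (g : Diff2 d M) : TangentBundle (𝓡 d) M → TangentBundle (𝓡 d) M :=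
  tangentMap (𝓡 d) (𝓡 d) g

lemma Diff2.tmap_symm_tmap (g : Diff2 d M) (V : TangentBundle (𝓡 d) M) :
    Diff2.tmap g.symm (g.tmap V) = V := by
  have h := tangentMap_comp_at (I := 𝓡 d) (I' := 𝓡 d) (I'' := 𝓡 d) (f := g) (g := g.symm) V
    (Diff2.mdifferentiable (M := M) g.symm _) (g.mdifferentiable _)
  have h2 : (g.symm ∘ g : M → M) = id := funext fun x => g.symm_apply_apply x
  rw [h2, tangentMap_id] at h
  exact h.symm

lemma Diff2.tmap_tmap_symm (g : Diff2 d M) (V : TangentBundle (𝓡 d) M) :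
    g.tmap (Diff2.tmap g.symm V) = V := Diff2.tmap_symm_tmap g.symm V

lemma Diff2.tmap_mk (g : Diff2 d M) (x : M) (v : TangentSpace (𝓡 d) x) :
    g.tmap ⟨x, v⟩ = ⟨g x, mfderiv (𝓡 d) (𝓡 d) g x v⟩ := rfl

variable {𝒯 : Type*} [TopologicalSpace 𝒯]

/-- The derivatives of the diffeomorphisms `T w` depend continuously on the parameter `w`. -/
def IsC1Family (T : 𝒯 → Diff2 d M) : Prop :=
  Continuous fun z : 𝒯 × TangentBundle (𝓡 d) M => (T z.1).tmap z.2

/-- The second tangent bundle is locally compact, so evaluation is jointly continuous for the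
compact-open topology. Restricting to the zero section over `TM` and projecting recovers the first
tangent map. -/
theorem isC1Family_of_continuous {T : 𝒯 → Diff2 d M} (hT : Continuous T) : IsC1Family T := by
  have h1 : Continuous fun w => secondTangentMap (T w) := continuous_induced_dom.comp hT
  have : LocallyCompactSpace (TangentBundle (𝓡 d).tangent (TangentBundle (𝓡 d) M)) :=
    Manifold.locallyCompact_of_finiteDimensional (𝓡 d).tangent.tangent
  have h2 : Continuous fun z : 𝒯 × TangentBundle (𝓡 d).tangent (TangentBundle (𝓡 d) M) =>
      secondTangentMap (T z.1) z.2 :=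
    continuous_eval.comp ((h1.comp continuous_fst).prodMk continuous_snd)
  have h3 : Continuous fun V : TangentBundle (𝓡 d) M =>
      (⟨V, 0⟩ : TangentBundle (𝓡 d).tangent (TangentBundle (𝓡 d) M)) :=
    Bundle.Trivialization.continuous_zeroSection ℝ
  exact (FiberBundle.continuous_proj _ _).comp
    (h2.comp (continuous_fst.prodMk (h3.comp continuous_snd)))

variable {T : 𝒯 → Diff2 d M}

lemma IsC1Family.continuous_apply (hT : IsC1Family T) :
    Continuous fun z : 𝒯 × M => T z.1 z.2 := by
  have h3 : Continuous fun x : M => (⟨x, 0⟩ : TangentBundle (𝓡 d) M) :=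
    Bundle.Trivialization.continuous_zeroSection ℝ
  exact (FiberBundle.continuous_proj (EuclideanSpace ℝ (Fin d)) _).comp
    (hT.comp (continuous_fst.prodMk (h3.comp continuous_snd)))

/-- By compactness of `M` the preimages have a limit `x` along any ultrafilter, and joint continuity
of the direct maps forces `T w x = y`. -/
lemma IsC1Family.continuous_symm_apply [T2Space M] [CompactSpace M] (hT : IsC1Family T) :
    Continuous fun z : 𝒯 × M => (T z.1).symm z.2 := by
  rw [continuous_iff_ultrafilter]
  rintro ⟨w, y⟩ 𝒰 h𝒰
  obtain ⟨x, -, hx⟩ := isCompact_univ.ultrafilter_le_nhds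
    (𝒰.map fun z : 𝒯 × M => (T z.1).symm z.2) (by simp)
  have hx' : Tendsto (fun z : 𝒯 × M => (T z.1).symm z.2) 𝒰 (𝓝 x) := hx
  have h1 : Tendsto (fun z : 𝒯 × M => z.1) 𝒰 (𝓝 w) := (continuous_fst.tendsto _).mono_left h𝒰
  have h2 : Tendsto (fun z : 𝒯 × M => z.2) 𝒰 (𝓝 y) := (continuous_snd.tendsto _).mono_left h𝒰
  have h3 : Tendsto (fun z : 𝒯 × M => T z.1 ((T z.1).symm z.2)) 𝒰 (𝓝 (T w x)) :=
    (hT.continuous_apply.tendsto (w, x)).comp (h1.prodMk_nhds hx')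
  simp only [Diffeomorph.apply_symm_apply] at h3
  have h4 := tendsto_nhds_unique h2 h3
  rw [h4, Diffeomorph.symm_apply_apply]
  exact hx'

variable [RiemannianBundle (fun x : M => TangentSpace (𝓡 d) x)]
    [IsContMDiffRiemannianBundle (𝓡 d) ∞ (EuclideanSpace ℝ (Fin d))
      (fun x : M => TangentSpace (𝓡 d) x)]

/-- Along an ultrafilter, tangent vectors `Z i` converge after division by `1 + ‖Z i‖`. -/
lemma exists_tendsto_normalized [CompactSpace M] {ι : Type*} (𝒰 : Ultrafilter ι)
    (Z : ι → TangentBundle (𝓡 d) M) :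
    ∃ (t : ℝ) (ζ : TangentBundle (𝓡 d) M), ‖ζ.2‖ = 1 - t ∧
      Tendsto (fun i => (1 + ‖(Z i).2‖)⁻¹) 𝒰 (𝓝 t) ∧
      Tendsto (fun i => (⟨(Z i).1, (1 + ‖(Z i).2‖)⁻¹ • (Z i).2⟩ : TangentBundle (𝓡 d) M)) 𝒰
        (𝓝 ζ) := by
  have hpos : ∀ i, 0 < 1 + ‖(Z i).2‖ := fun i => by positivity
  obtain ⟨t, -, ht⟩ := (isCompact_Icc (a := (0 : ℝ)) (b := 1)).ultrafilter_le_nhds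
    (𝒰.map fun i => (1 + ‖(Z i).2‖)⁻¹) (tendsto_principal.2 (Filter.Eventually.of_forall fun i =>
      ⟨(inv_pos.2 (hpos i)).le, inv_le_one_of_one_le₀ (by linarith [norm_nonneg (Z i).2])⟩))
  have hnorm : ∀ i, ‖(1 + ‖(Z i).2‖)⁻¹ • (Z i).2‖ = 1 - (1 + ‖(Z i).2‖)⁻¹ := by
    intro i
    rw [norm_smul, norm_inv, Real.norm_of_nonneg (hpos i).le]
    have := (hpos i).ne'
    field_simp
    ring
  obtain ⟨ζ, -, hζ⟩ := (isCompact_norm_le_tangentBundle M (d := d) 1).ultrafilter_le_nhds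
    (𝒰.map fun i => (⟨(Z i).1, (1 + ‖(Z i).2‖)⁻¹ • (Z i).2⟩ : TangentBundle (𝓡 d) M))
    (tendsto_principal.2 (Filter.Eventually.of_forall fun i => by
      change ‖(1 + ‖(Z i).2‖)⁻¹ • (Z i).2‖ ≤ 1
      rw [hnorm]; linarith [inv_pos.2 (hpos i)]))
  refine ⟨t, ζ, ?_, ht, hζ⟩
  refine tendsto_nhds_unique (((continuous_norm_tangentBundle d M).tendsto ζ).comp hζ) ?_
  refine (tendsto_const_nhds.sub ht : Tendsto (fun i => 1 - (1 + ‖(Z i).2‖)⁻¹) 𝒰 _).congr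
    fun i => (hnorm i).symm

/-- Convergence of tangent vectors can be checked after normalization. -/
lemma tendsto_of_normalized [T2Space M] [CompactSpace M] {ι : Type*} {𝒰 : Ultrafilter ι}
    {Z : ι → TangentBundle (𝓡 d) M} {Z₀ : TangentBundle (𝓡 d) M}
    (h : ∀ (t : ℝ) (ζ : TangentBundle (𝓡 d) M),
      Tendsto (fun i => (1 + ‖(Z i).2‖)⁻¹) 𝒰 (𝓝 t) →
      Tendsto (fun i => (⟨(Z i).1, (1 + ‖(Z i).2‖)⁻¹ • (Z i).2⟩ : TangentBundle (𝓡 d) M)) 𝒰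
        (𝓝 ζ) → ζ = ⟨Z₀.1, t • Z₀.2⟩) :
    Tendsto Z 𝒰 (𝓝 Z₀) := by
  obtain ⟨t, ζ, hζn, ht, hζ⟩ := exists_tendsto_normalized 𝒰 Z
  have h6 := h t ζ ht hζ
  -- `t = 0` would make `ζ` the zero vector, although its norm is `1 - t = 1`.
  have ht0 : t ≠ 0 := by
    rintro rfl
    rw [h6] at hζn
    simp at hζn
  have h7 : Tendsto (fun i => (⟨(Z i).1, ((1 + ‖(Z i).2‖)⁻¹)⁻¹ •
      ((1 + ‖(Z i).2‖)⁻¹ • (Z i).2)⟩ : TangentBundle (𝓡 d) M)) 𝒰 (𝓝 ⟨ζ.1, t⁻¹ • ζ.2⟩) :=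
    Filter.Tendsto.totalSpace_smul (b := fun i => (Z i).1)
        (v := fun i => (1 + ‖(Z i).2‖)⁻¹ • (Z i).2) (ht.inv₀ ht0) hζ
  have h8 : (⟨ζ.1, t⁻¹ • ζ.2⟩ : TangentBundle (𝓡 d) M) = Z₀ := by
    rw [h6]
    simp [smul_smul, inv_mul_cancel₀ ht0]
  rw [h8] at h7
  refine h7.congr fun i => ?_
  have : (1 + ‖(Z i).2‖) ≠ 0 := by positivity
  simp [smul_smul, mul_inv_cancel₀ this]

lemma Diff2.tmap_smul (g : Diff2 d M) (c : ℝ) (Y : TangentBundle (𝓡 d) M) :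
    g.tmap ⟨Y.1, c • Y.2⟩ = ⟨(g.tmap Y).1, c • (g.tmap Y).2⟩ := by
  rw [Diff2.tmap_mk, map_smul]
  rfl

/-- No bound on the inverse derivatives is known beforehand, so the preimages are normalized: the
direct tangent map sends their limit to `t • V`, and injectivity identifies it. -/
theorem IsC1Family.symm [T2Space M] [CompactSpace M] (hT : IsC1Family T) :
    IsC1Family fun w => (T w).symm := by
  have : T2Space (TangentBundle (𝓡 d) M) :=
    t2Space_totalSpace (EuclideanSpace ℝ (Fin d)) (TangentSpace (𝓡 d) : M → Type _)
  rw [IsC1Family, continuous_iff_ultrafilter]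
  rintro ⟨w, V⟩ 𝒰 h𝒰
  set Z : 𝒯 × TangentBundle (𝓡 d) M → TangentBundle (𝓡 d) M :=
    fun z => Diff2.tmap (T z.1).symm z.2
  change Tendsto Z 𝒰 (𝓝 (Z (w, V)))
  have hZ : ∀ z, (T z.1).tmap (Z z) = z.2 := fun z => Diff2.tmap_tmap_symm (T z.1) z.2
  have h1 : Tendsto (fun z : 𝒯 × TangentBundle (𝓡 d) M => z.1) 𝒰 (𝓝 w) :=
    (continuous_fst.tendsto _).mono_left h𝒰
  have h2 : Tendsto (fun z : 𝒯 × TangentBundle (𝓡 d) M => z.2) 𝒰 (𝓝 V) :=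
    (continuous_snd.tendsto _).mono_left h𝒰
  refine tendsto_of_normalized fun t ζ ht hζ => ?_
  have h3 := (hT.tendsto (w, ζ)).comp (h1.prodMk_nhds hζ)
  have h4 : Tendsto (fun z : 𝒯 × TangentBundle (𝓡 d) M =>
      (⟨z.2.1, (1 + ‖(Z z).2‖)⁻¹ • z.2.2⟩ : TangentBundle (𝓡 d) M)) 𝒰 (𝓝 ⟨V.1, t • V.2⟩) :=
    Filter.Tendsto.totalSpace_smul (b := fun z : 𝒯 × TangentBundle (𝓡 d) M => z.2.1)
        (v := fun z => z.2.2) ht h2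
  have h5 : (T w).tmap ζ = ⟨V.1, t • V.2⟩ := by
    refine tendsto_nhds_unique h3 (h4.congr fun z => ?_)
    change _ = (T z.1).tmap _
    rw [Diff2.tmap_smul, hZ]
  rw [← Diff2.tmap_symm_tmap (T w) ζ, h5, Diff2.tmap_smul]

/-- If `v i → v₀` in the tangent bundle, then the components of `v i` in closed families of
complementary subspaces converge as well. -/
lemma IsClosedFamilyOn.tendsto_component [T2Space M] [CompactSpace M] {X ι : Type*}
    [TopologicalSpace X] {b : X → M}
    {E U : ∀ p : X, Submodule ℝ (TangentSpace (𝓡 d) (b p))} {S : Set X}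
    (hE : IsClosedFamilyOn b E S) (hU : IsClosedFamilyOn b U S)
    {l : Filter ι} {p : ι → X} {v e : ∀ i, TangentSpace (𝓡 d) (b (p i))} {p₀ : X}
    {v₀ e₀ : TangentSpace (𝓡 d) (b p₀)} (hp₀ : p₀ ∈ S) (hdisj : Disjoint (E p₀) (U p₀))
    (hp : Tendsto p l (𝓝 p₀)) (hb : Tendsto (fun i => b (p i)) l (𝓝 (b p₀)))
    (hS : ∀ᶠ i in l, p i ∈ S)
    (hv : Tendsto (fun i => (⟨b (p i), v i⟩ : TangentBundle (𝓡 d) M)) l (𝓝 ⟨b p₀, v₀⟩))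
    (he : ∀ᶠ i in l, e i ∈ E (p i)) (hve : ∀ᶠ i in l, v i - e i ∈ U (p i))
    (he₀ : e₀ ∈ E p₀) (hve₀ : v₀ - e₀ ∈ U p₀) :
    Tendsto (fun i => (⟨b (p i), e i⟩ : TangentBundle (𝓡 d) M)) l (𝓝 ⟨b p₀, e₀⟩) := by
  rw [tendsto_iff_ultrafilter]
  intro 𝒰 h𝒰
  refine tendsto_of_normalized fun t ζ ht hζ => ?_
  have hbase : ζ.1 = b p₀ :=
    tendsto_nhds_unique (((FiberBundle.continuous_proj _ _).tendsto ζ).comp hζ)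
      (hb.mono_left h𝒰)
  obtain ⟨y, z⟩ := ζ
  obtain rfl : y = b p₀ := hbase
  change Tendsto (fun i => (⟨b (p i), (1 + ‖e i‖)⁻¹ • e i⟩ : TangentBundle (𝓡 d) M)) 𝒰 _ at hζ
  change Tendsto (fun i => (1 + ‖e i‖)⁻¹) 𝒰 _ at ht
  have h1 : z ∈ E p₀ := hE.mem_of_tendsto hp₀ (hp.mono_left h𝒰) (hS.filter_mono h𝒰) hζ
    ((he.filter_mono h𝒰).mono fun i hi => Submodule.smul_mem _ _ hi)
  have h2 : t • v₀ - z ∈ U p₀ := by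
    refine hU.mem_of_tendsto hp₀ (hp.mono_left h𝒰) (hS.filter_mono h𝒰)
      ((Filter.Tendsto.totalSpace_smul ht (hv.mono_left h𝒰)).totalSpace_sub hζ)
      ((hve.filter_mono h𝒰).mono fun i hi => ?_)
    rw [← smul_sub]
    exact Submodule.smul_mem _ _ hi
  -- Both `z` and `t • e₀` are components of `t • v₀` in `E p₀` modulo `U p₀`, so transversality
  -- makes them equal.
  have h3 : z - t • e₀ ∈ U p₀ := by
    have : z - t • e₀ = t • (v₀ - e₀) - (t • v₀ - z) := by rw [smul_sub]; abel
    rw [this]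
    exact Submodule.sub_mem _ (Submodule.smul_mem _ _ hve₀) h2
  have h4 : z - t • e₀ = 0 :=
    Submodule.disjoint_def.1 hdisj _ (Submodule.sub_mem _ h1 (Submodule.smul_mem _ _ he₀)) h3
  rw [sub_eq_zero.1 h4]

lemma IsClosedFamilyOn.comp {X Y : Type*} [TopologicalSpace X] [TopologicalSpace Y] {b : X → M}
    {V : ∀ p : X, Submodule ℝ (TangentSpace (𝓡 d) (b p))} {S : Set X}
    (h : IsClosedFamilyOn b V S) {φ : Y → X} {S' : Set Y} (hφ : ContinuousOn φ S')
    (hS : MapsTo φ S' S) : IsClosedFamilyOn (fun q => b (φ q)) (fun q => V (φ q)) S' := by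
  intro q₀ hq₀ v₀ hv₀
  rw [mem_closure_iff_ultrafilter] at hv₀
  obtain ⟨𝒰, h𝒰, hlim⟩ := hv₀
  refine h _ (hS hq₀) v₀ ?_
  have h1 : Tendsto (fun z : Y × TangentBundle (𝓡 d) M => z.1) 𝒰 (𝓝[S'] q₀) :=
    tendsto_nhdsWithin_iff.2 ⟨(continuous_fst.tendsto _).mono_left hlim,
      by filter_upwards [h𝒰] with z hz using hz.1⟩
  have h2 : Tendsto (fun z : Y × TangentBundle (𝓡 d) M => z.2) 𝒰 (𝓝 ⟨b (φ q₀), v₀⟩) :=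
    (continuous_snd.tendsto _).mono_left hlim
  refine mem_closure_of_tendsto (((hφ q₀ hq₀).tendsto.comp h1).prodMk_nhds h2) ?_
  filter_upwards [h𝒰] with z hz using ⟨hS hz.1, hz.2⟩

lemma IsClosedFamilyOn.isClosed {V : ∀ x : M, Submodule ℝ (TangentSpace (𝓡 d) x)}
    (h : IsClosedFamilyOn (fun x : M => x) V univ) :
    IsClosed {Y : TangentBundle (𝓡 d) M | Y.2 ∈ V Y.1} := by
  refine isClosed_of_closure_subset fun Y hY => ?_
  refine h Y.1 (mem_univ _) Y.2 ?_
  have hc : Continuous fun Z : TangentBundle (𝓡 d) M => (Z.1, Z) :=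
    (FiberBundle.continuous_proj _ _).prodMk continuous_id
  refine closure_mono ?_ (hc.continuousOn.image_closure (mem_image_of_mem _ hY))
  rintro _ ⟨Z, hZ, rfl⟩
  exact ⟨mem_univ _, Z.2, hZ, rfl⟩

/-- The component in `S` of a tangent vector, relative to the splitting `S ⊕ U`. -/
def componentMap {S U : ∀ x : M, Submodule ℝ (TangentSpace (𝓡 d) x)}
    (hSU : ∀ x, IsCompl (S x) (U x)) (Y : TangentBundle (𝓡 d) M) : TangentBundle (𝓡 d) M :=
  ⟨Y.1, (S Y.1).projection (U Y.1) (hSU Y.1) Y.2⟩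

lemma continuous_componentMap [T2Space M] [CompactSpace M]
    {S U : ∀ x : M, Submodule ℝ (TangentSpace (𝓡 d) x)} (hSU : ∀ x, IsCompl (S x) (U x))
    (hS : IsClosedFamilyOn (fun x : M => x) S univ)
    (hU : IsClosedFamilyOn (fun x : M => x) U univ) : Continuous (componentMap hSU) := by
  rw [continuous_iff_continuousAt]
  intro Y
  have hb : Tendsto (fun Z : TangentBundle (𝓡 d) M => Z.1) (𝓝 Y) (𝓝 Y.1) :=
    (FiberBundle.continuous_proj (EuclideanSpace ℝ (Fin d)) _).tendsto Y
  exact hS.tendsto_component hU (p := fun Z : TangentBundle (𝓡 d) M => Z.1) (v := fun Z => Z.2)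
    (mem_univ _) (hSU _).disjoint hb hb (by simp) (tendsto_id (α := TangentBundle (𝓡 d) M))
    (Eventually.of_forall fun Z => Submodule.projection_apply_mem _ _)
    (Eventually.of_forall fun Z => Submodule.sub_projection_mem _ _)
    (Submodule.projection_apply_mem _ _) (Submodule.sub_projection_mem _ _)

end Families

/-! ### Near-domination is an open condition -/

section StableFamily

/-- Homogeneity: this and the next two lemmas reduce the block estimates to unit vectors, which form
a compact set. -/
lemma norm_le_mul_norm_of_unit {E F : Type*} [NormedAddCommGroup E] [NormedSpace ℝ E]
    [NormedAddCommGroup F] [NormedSpace ℝ F] (L : E →ₗ[ℝ] F) (S : Submodule ℝ E) {c : ℝ}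
    (h : ∀ s ∈ S, ‖s‖ = 1 → ‖L s‖ ≤ c) : ∀ s ∈ S, ‖L s‖ ≤ c * ‖s‖ := by
  intro s hs
  by_cases h0 : s = 0
  · simp [h0]
  have hpos : 0 < ‖s‖ := norm_pos_iff.2 h0
  have := h (‖s‖⁻¹ • s) (S.smul_mem _ hs) (by rw [norm_smul, norm_inv, norm_norm]; field_simp)
  rwa [map_smul, norm_smul, norm_inv, norm_norm, inv_mul_le_iff₀ hpos, mul_comm] at this

lemma mul_norm_le_norm_of_unit {E F : Type*} [NormedAddCommGroup E] [NormedSpace ℝ E]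
    [NormedAddCommGroup F] [NormedSpace ℝ F] (L : E →ₗ[ℝ] F) (S : Submodule ℝ E) {c : ℝ}
    (h : ∀ s ∈ S, ‖s‖ = 1 → c ≤ ‖L s‖) : ∀ s ∈ S, c * ‖s‖ ≤ ‖L s‖ := by
  intro s hs
  by_cases h0 : s = 0
  · simp [h0]
  have hpos : 0 < ‖s‖ := norm_pos_iff.2 h0
  have := h (‖s‖⁻¹ • s) (S.smul_mem _ hs) (by rw [norm_smul, norm_inv, norm_norm]; field_simp)
  rwa [map_smul, norm_smul, norm_inv, norm_norm, le_inv_mul_iff₀ hpos, mul_comm] at this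

lemma two_mul_norm_mul_norm_le_of_unit {E F : Type*} [NormedAddCommGroup E] [NormedSpace ℝ E]
    [NormedAddCommGroup F] [NormedSpace ℝ F] (L K : E →ₗ[ℝ] F) (S U : Submodule ℝ E)
    (h : ∀ s ∈ S, ‖s‖ = 1 → ∀ u ∈ U, ‖u‖ = 1 → 2 * ‖L s‖ ≤ ‖K u‖) :
    ∀ s ∈ S, ∀ u ∈ U, 2 * ‖L s‖ * ‖u‖ ≤ ‖K u‖ * ‖s‖ := by
  intro s hs u hu
  by_cases hu0 : u = 0
  · simp [hu0]
  have hupos : 0 < ‖u‖ := norm_pos_iff.2 hu0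
  have hu1 : ‖‖u‖⁻¹ • u‖ = 1 := by rw [norm_smul, norm_inv, norm_norm]; field_simp
  have B := norm_le_mul_norm_of_unit L S (c := ‖K (‖u‖⁻¹ • u)‖ / 2) (fun s hs hs1 => by
    have := h s hs hs1 _ (U.smul_mem _ hu) hu1
    linarith) s hs
  rw [map_smul, norm_smul, norm_inv, norm_norm] at B
  calc _ ≤ 2 * (‖u‖⁻¹ * ‖K u‖ / 2 * ‖s‖) * ‖u‖ := by gcongr
    _ = _ := by field_simp

variable {d : ℕ} {M : Type*} [TopologicalSpace M] [T2Space M] [CompactSpace M]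
    [ChartedSpace (EuclideanSpace ℝ (Fin d)) M] [IsManifold (𝓡 d) ∞ M]
    [RiemannianBundle (fun x : M => TangentSpace (𝓡 d) x)]
    [IsContMDiffRiemannianBundle (𝓡 d) ∞ (EuclideanSpace ℝ (Fin d))
      (fun x : M => TangentSpace (𝓡 d) x)]

/-- A continuous invariant splitting `S ⊕ U` such that `U` dominates `S`. -/
structure IsInvariantSplitting (f : Diff2 d M)
    (S U : ∀ x : M, Submodule ℝ (TangentSpace (𝓡 d) x)) : Prop where
  continuous_s : IsContinuousFamilyOn (fun x : M => x) S univ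
  continuous_u : IsContinuousFamilyOn (fun x : M => x) U univ
  isCompl : ∀ x, IsCompl (S x) (U x)
  map_s : ∀ x, ∀ s ∈ S x, mfderiv (𝓡 d) (𝓡 d) f x s ∈ S (f x)
  map_u : ∀ x, ∀ u ∈ U x, mfderiv (𝓡 d) (𝓡 d) f x u ∈ U (f x)
  dom : ∀ x, ∀ s ∈ S x, ∀ u ∈ U x, s ≠ 0 → u ≠ 0 →
    2 * ‖mfderiv (𝓡 d) (𝓡 d) f x s‖ * ‖u‖ < ‖mfderiv (𝓡 d) (𝓡 d) f x u‖ * ‖s‖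

variable {𝒯 : Type*} [TopologicalSpace 𝒯] {T : 𝒯 → Diff2 d M} {w₀ : 𝒯}
  {S U : ∀ x : M, Submodule ℝ (TangentSpace (𝓡 d) x)}

lemma Diff2.mfderiv_injective (g : Diff2 d M) (x : M) :
    Function.Injective (mfderiv (𝓡 d) (𝓡 d) g x) := by
  intro v w h
  have h1 : g.tmap ⟨x, v⟩ = g.tmap ⟨x, w⟩ := by rw [tmap_mk, tmap_mk, h]
  have h2 := congrArg (Diff2.tmap g.symm) h1
  rw [tmap_symm_tmap, tmap_symm_tmap] at h2
  simpa using h2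

lemma Diff2.mfderiv_surjective (g : Diff2 d M) (x : M) :
    Function.Surjective (mfderiv (𝓡 d) (𝓡 d) g x) :=
  LinearMap.injective_iff_surjective_of_finrank_eq_finrank
    (f := (mfderiv (𝓡 d) (𝓡 d) g x).toLinearMap) rfl |>.1 (g.mfderiv_injective x)

lemma isCompact_unit_tangentBundle : IsCompact {Y : TangentBundle (𝓡 d) M | ‖Y.2‖ = 1} :=
  (isCompact_norm_le_tangentBundle M 1).of_isClosed_subset
    (isClosed_eq (continuous_norm_tangentBundle d M) continuous_const) fun _ h => le_of_eq h

/-- At `w₀` the off-diagonal blocks vanish, the diagonal ones are bounded below on unit vectors, and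
domination is strict. These are strict inequalities between continuous functions on compact sets, so
they survive for all `w` near `w₀`. -/
lemma IsInvariantSplitting.eventually_unit_dominated (hT : IsC1Family T)
    (h : IsInvariantSplitting (T w₀) S U) {σ υ : TangentBundle (𝓡 d) M → TangentBundle (𝓡 d) M}
    (hσ : σ = componentMap h.isCompl) (hυ : υ = componentMap fun x => (h.isCompl x).symm) :
    ∃ c > 0, ∀ᶠ w in 𝓝 w₀,
      (∀ Y : TangentBundle (𝓡 d) M, ‖Y.2‖ = 1 ∧ Y.2 ∈ S Y.1 → ‖(υ ((T w).tmap Y)).2‖ < c / 8) ∧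
      (∀ Y : TangentBundle (𝓡 d) M, ‖Y.2‖ = 1 ∧ Y.2 ∈ U Y.1 → ‖(σ ((T w).tmap Y)).2‖ < c / 8) ∧
      (∀ Y : TangentBundle (𝓡 d) M, ‖Y.2‖ = 1 ∧ Y.2 ∈ U Y.1 → c < ‖(υ ((T w).tmap Y)).2‖) ∧
      (∀ Y : TangentBundle (𝓡 d) M, ‖Y.2‖ = 1 ∧ Y.2 ∈ S Y.1 → c < ‖(σ ((T w).tmap Y)).2‖) ∧
      (∀ Y : TangentBundle (𝓡 d) M × TangentBundle (𝓡 d) M,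
        ((‖Y.1.2‖ = 1 ∧ Y.1.2 ∈ S Y.1.1) ∧ ‖Y.2.2‖ = 1 ∧ Y.2.2 ∈ U Y.2.1) ∧ Y.1.1 = Y.2.1 →
        2 * ‖(σ ((T w).tmap Y.1)).2‖ < ‖(υ ((T w).tmap Y.2)).2‖) := by
  have hSc := h.continuous_s.isClosedFamilyOn continuous_id
  have hUc := h.continuous_u.isClosedFamilyOn continuous_id
  have hσc : Continuous σ := by rw [hσ]; exact continuous_componentMap h.isCompl hSc hUc
  have hυc : Continuous υ := by rw [hυ]; exact continuous_componentMap _ hUc hSc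
  have hn := continuous_norm_tangentBundle d M
  have hs : Continuous fun z : 𝒯 × TangentBundle (𝓡 d) M => ‖(σ ((T z.1).tmap z.2)).2‖ :=
    hn.comp (hσc.comp hT)
  have hu : Continuous fun z : 𝒯 × TangentBundle (𝓡 d) M => ‖(υ ((T z.1).tmap z.2)).2‖ :=
    hn.comp (hυc.comp hT)
  have hKS : IsCompact {Y : TangentBundle (𝓡 d) M | ‖Y.2‖ = 1 ∧ Y.2 ∈ S Y.1} :=
    isCompact_unit_tangentBundle.inter_right hSc.isClosed
  have hKU : IsCompact {Y : TangentBundle (𝓡 d) M | ‖Y.2‖ = 1 ∧ Y.2 ∈ U Y.1} :=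
    isCompact_unit_tangentBundle.inter_right hUc.isClosed
  -- Domination compares two vectors, so the compact set consists of pairs of unit vectors over a
  -- common base point.
  have hKSU : IsCompact {Y : TangentBundle (𝓡 d) M × TangentBundle (𝓡 d) M |
      Y ∈ {Y : TangentBundle (𝓡 d) M | ‖Y.2‖ = 1 ∧ Y.2 ∈ S Y.1} ×ˢ
        {Y : TangentBundle (𝓡 d) M | ‖Y.2‖ = 1 ∧ Y.2 ∈ U Y.1} ∧ Y.1.1 = Y.2.1} :=
    (hKS.prod hKU).inter_right (isClosed_eq
      ((FiberBundle.continuous_proj (EuclideanSpace ℝ (Fin d)) _).comp continuous_fst)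
      ((FiberBundle.continuous_proj (EuclideanSpace ℝ (Fin d)) _).comp continuous_snd))
  have hσs : ∀ x, ∀ s ∈ S x, σ ((T w₀).tmap ⟨x, s⟩) = (T w₀).tmap ⟨x, s⟩ := fun x s hs => by
    rw [Diff2.tmap_mk, hσ, componentMap]
    simp only [Submodule.projection_apply_of_mem_left _ (h.map_s x s hs)]
  have hσu : ∀ x, ∀ u ∈ U x, (σ ((T w₀).tmap ⟨x, u⟩)).2 = 0 := fun x u hux => by
    subst hσ hυ; exact (Submodule.projection_apply_eq_zero_iff (h.isCompl (T w₀ x))).2 (h.map_u x u hux)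
  have hυu : ∀ x, ∀ s ∈ U x, υ ((T w₀).tmap ⟨x, s⟩) = (T w₀).tmap ⟨x, s⟩ := fun x s hs => by
    rw [Diff2.tmap_mk, hυ, componentMap]
    simp only [Submodule.projection_apply_of_mem_left _ (h.map_u x s hs)]
  have hυs : ∀ x, ∀ u ∈ S x, (υ ((T w₀).tmap ⟨x, u⟩)).2 = 0 := fun x u hux => by
    subst hσ hυ; exact (Submodule.projection_apply_eq_zero_iff (h.isCompl (T w₀ x)).symm).2 (h.map_s x u hux)
  have hpos : ∀ (x : M) (v : TangentSpace (𝓡 d) x), ‖v‖ = 1 →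
      0 < ‖((T w₀).tmap ⟨x, v⟩).2‖ := by
    intro x v hv
    rw [norm_pos_iff]
    intro h0
    have : v = 0 := (T w₀).mfderiv_injective x (h0.trans (map_zero _).symm)
    simp [this] at hv
  obtain ⟨c, hc, hcle⟩ : ∃ c > 0, ∀ (x : M) (v : TangentSpace (𝓡 d) x), ‖v‖ = 1 →
      c < ‖((T w₀).tmap ⟨x, v⟩).2‖ := by
    have hcont : Continuous fun Y : TangentBundle (𝓡 d) M => ‖((T w₀).tmap Y).2‖ :=
      hn.comp (hT.comp (continuous_const.prodMk continuous_id))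
    obtain ⟨c, hc, hc'⟩ := isCompact_unit_tangentBundle.exists_forall_le' (a := 0)
      hcont.continuousOn (fun Y hY => hpos Y.1 Y.2 hY)
    -- Halving the minimum makes the lower bound strict, hence stable under perturbation.
    exact ⟨c / 2, by linarith, fun x v hv => by
      have := hc' ⟨x, v⟩ hv
      linarith⟩
  refine ⟨c, hc, ?_⟩
  have e1 := hKS.eventually_forall_of_forall_eventually (x₀ := w₀)
    (P := fun w Y => ‖(υ ((T w).tmap Y)).2‖ < c / 8) fun Y hY => by
      refine (hu.tendsto (w₀, Y)).eventually_lt_const ?_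
      rw [hυs Y.1 Y.2 hY.2, norm_zero]; positivity
  have e2 := hKU.eventually_forall_of_forall_eventually (x₀ := w₀)
    (P := fun w Y => ‖(σ ((T w).tmap Y)).2‖ < c / 8) fun Y hY => by
      refine (hs.tendsto (w₀, Y)).eventually_lt_const ?_
      rw [hσu Y.1 Y.2 hY.2, norm_zero]; positivity
  have e3 := hKU.eventually_forall_of_forall_eventually (x₀ := w₀)
    (P := fun w Y => c < ‖(υ ((T w).tmap Y)).2‖) fun Y hY => by
      refine (hu.tendsto (w₀, Y)).eventually_const_lt ?_
      rw [hυu Y.1 Y.2 hY.2]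
      exact hcle Y.1 Y.2 hY.1
  have e4 := hKS.eventually_forall_of_forall_eventually (x₀ := w₀)
    (P := fun w Y => c < ‖(σ ((T w).tmap Y)).2‖) fun Y hY => by
      refine (hs.tendsto (w₀, Y)).eventually_const_lt ?_
      rw [hσs Y.1 Y.2 hY.2]
      exact hcle Y.1 Y.2 hY.1
  have e5 := hKSU.eventually_forall_of_forall_eventually (x₀ := w₀)
    (P := fun w Y => 2 * ‖(σ ((T w).tmap Y.1)).2‖ < ‖(υ ((T w).tmap Y.2)).2‖) fun Y hY => by
      have c1 : Continuous fun z : 𝒯 × (TangentBundle (𝓡 d) M × TangentBundle (𝓡 d) M) =>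
          2 * ‖(σ ((T z.1).tmap z.2.1)).2‖ := continuous_const.mul
        (hs.comp (continuous_fst.prodMk (continuous_fst.comp continuous_snd)))
      have c2 : Continuous fun z : 𝒯 × (TangentBundle (𝓡 d) M × TangentBundle (𝓡 d) M) =>
          ‖(υ ((T z.1).tmap z.2.2)).2‖ :=
        hu.comp (continuous_fst.prodMk (continuous_snd.comp continuous_snd))
      refine (c1.tendsto (w₀, Y)).eventually_lt (c2.tendsto (w₀, Y)) ?_
      obtain ⟨⟨x, s⟩, ⟨y, u⟩⟩ := Y
      obtain ⟨⟨⟨hs1, hs2⟩, ⟨hu1, hu2⟩⟩, hxy⟩ := hY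
      obtain rfl : x = y := hxy
      dsimp only at hs1 hs2 hu1 hu2 ⊢
      rw [hσs x s hs2, hυu x u hu2]
      have := h.dom x s hs2 u hu2 (by rintro rfl; simp at hs1) (by rintro rfl; simp at hu1)
      rw [hs1, hu1, mul_one, mul_one] at this
      exact this
  filter_upwards [e1, e2, e3, e4, e5] with w h1 h2 h3 h4 h5
  exact ⟨h1, h2, h3, h4, h5⟩

/-- The diffeomorphism `T w` with `w` near `w₀` nearly preserves the splitting `S ⊕ U` and `U` still
dominates `S`. -/
lemma IsInvariantSplitting.eventually_nearly_dominated (hT : IsC1Family T)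
    (h : IsInvariantSplitting (T w₀) S U) :
    ∃ c δ : ℝ, 0 < c ∧ 0 ≤ δ ∧ 8 * δ ≤ c ∧ ∀ᶠ w in 𝓝 w₀, ∀ x,
      (∀ s ∈ S x, ‖(U (T w x)).projection (S (T w x)) (h.isCompl _).symm
        (mfderiv (𝓡 d) (𝓡 d) (T w) x s)‖ ≤ δ * ‖s‖) ∧
      (∀ u ∈ U x, ‖(S (T w x)).projection (U (T w x)) (h.isCompl _)
        (mfderiv (𝓡 d) (𝓡 d) (T w) x u)‖ ≤ δ * ‖u‖) ∧
      (∀ u ∈ U x, c * ‖u‖ ≤ ‖(U (T w x)).projection (S (T w x)) (h.isCompl _).symm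
        (mfderiv (𝓡 d) (𝓡 d) (T w) x u)‖) ∧
      (∀ s ∈ S x, c * ‖s‖ ≤ ‖(S (T w x)).projection (U (T w x)) (h.isCompl _)
        (mfderiv (𝓡 d) (𝓡 d) (T w) x s)‖) ∧
      (∀ s ∈ S x, ∀ u ∈ U x, 2 * ‖(S (T w x)).projection (U (T w x)) (h.isCompl _)
        (mfderiv (𝓡 d) (𝓡 d) (T w) x s)‖ * ‖u‖ ≤
        ‖(U (T w x)).projection (S (T w x)) (h.isCompl _).symm
          (mfderiv (𝓡 d) (𝓡 d) (T w) x u)‖ * ‖s‖) := by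
  obtain ⟨c, hc, hev⟩ := h.eventually_unit_dominated hT rfl rfl
  refine ⟨c, c / 8, hc, by positivity, by linarith, ?_⟩
  filter_upwards [hev] with w ⟨h1, h2, h3, h4, h5⟩ x
  refine ⟨?_, ?_, ?_, ?_, ?_⟩
  · exact norm_le_mul_norm_of_unit (((U (T w x)).projection (S (T w x)) (h.isCompl _).symm) ∘ₗ
      (mfderiv (𝓡 d) (𝓡 d) (T w) x).toLinearMap) (S x) fun s hs hs1 => (h1 ⟨x, s⟩ ⟨hs1, hs⟩).le
  · exact norm_le_mul_norm_of_unit (((S (T w x)).projection (U (T w x)) (h.isCompl _)) ∘ₗ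
      (mfderiv (𝓡 d) (𝓡 d) (T w) x).toLinearMap) (U x) fun s hs hs1 => (h2 ⟨x, s⟩ ⟨hs1, hs⟩).le
  · exact mul_norm_le_norm_of_unit (((U (T w x)).projection (S (T w x)) (h.isCompl _).symm) ∘ₗ
      (mfderiv (𝓡 d) (𝓡 d) (T w) x).toLinearMap) (U x) fun s hs hs1 => (h3 ⟨x, s⟩ ⟨hs1, hs⟩).le
  · exact mul_norm_le_norm_of_unit (((S (T w x)).projection (U (T w x)) (h.isCompl _)) ∘ₗ
      (mfderiv (𝓡 d) (𝓡 d) (T w) x).toLinearMap) (S x) fun s hs hs1 => (h4 ⟨x, s⟩ ⟨hs1, hs⟩).le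
  · exact two_mul_norm_mul_norm_le_of_unit (((S (T w x)).projection (U (T w x)) (h.isCompl _)) ∘ₗ
      (mfderiv (𝓡 d) (𝓡 d) (T w) x).toLinearMap)
      (((U (T w x)).projection (S (T w x)) (h.isCompl _).symm) ∘ₗ
      (mfderiv (𝓡 d) (𝓡 d) (T w) x).toLinearMap) (S x) (U x) fun s hs hs1 u hu hu1 =>
        (h5 ⟨⟨x, s⟩, ⟨x, u⟩⟩ ⟨⟨⟨hs1, hs⟩, ⟨hu1, hu⟩⟩, rfl⟩).le

end StableFamily

/-! ### Persistence of the stable subbundle -/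

section RandomFamily

variable {d : ℕ} {M : Type*} [TopologicalSpace M] [T2Space M] [CompactSpace M]
    [ChartedSpace (EuclideanSpace ℝ (Fin d)) M] [IsManifold (𝓡 d) ∞ M]
    [RiemannianBundle (fun x : M => TangentSpace (𝓡 d) x)]
    [IsContMDiffRiemannianBundle (𝓡 d) ∞ (EuclideanSpace ℝ (Fin d))
      (fun x : M => TangentSpace (𝓡 d) x)]

variable {𝒯 : Type*} [TopologicalSpace 𝒯] {T : 𝒯 → Diff2 d M} {w₀ : 𝒯}
  {S U : ∀ x : M, Submodule ℝ (TangentSpace (𝓡 d) x)}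

/-- Neither summand can lose dimension and the totals agree, so neither can gain. -/
lemma finrank_eq_of_isCompl_of_injective {V V' : Type*} [AddCommGroup V] [Module ℝ V]
    [AddCommGroup V'] [Module ℝ V'] [FiniteDimensional ℝ V] [FiniteDimensional ℝ V']
    (hV : Module.finrank ℝ V = Module.finrank ℝ V') {S U : Submodule ℝ V} {S' U' : Submodule ℝ V'}
    (h : IsCompl S U) (h' : IsCompl S' U') (f : S →ₗ[ℝ] S') (g : U →ₗ[ℝ] U')
    (hf : Function.Injective f) (hg : Function.Injective g) :
    Module.finrank ℝ U = Module.finrank ℝ U' := by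
  have h1 := Submodule.finrank_add_eq_of_isCompl h
  have h2 := Submodule.finrank_add_eq_of_isCompl h'
  have h3 := LinearMap.finrank_le_finrank_of_injective hf
  have h4 := LinearMap.finrank_le_finrank_of_injective hg
  omega

lemma finrank_eq_of_mul_norm_le_projection {V V' : Type*} [NormedAddCommGroup V] [NormedSpace ℝ V]
    [NormedAddCommGroup V'] [NormedSpace ℝ V'] [FiniteDimensional ℝ V] [FiniteDimensional ℝ V']
    (hV : Module.finrank ℝ V = Module.finrank ℝ V') {S U : Submodule ℝ V} {S' U' : Submodule ℝ V'}
    (h : IsCompl S U) (h' : IsCompl S' U') (L : V →ₗ[ℝ] V') {c : ℝ} (hc : 0 < c)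
    (hs : ∀ s ∈ S, c * ‖s‖ ≤ ‖S'.projection U' h' (L s)‖)
    (hu : ∀ u ∈ U, c * ‖u‖ ≤ ‖U'.projection S' h'.symm (L u)‖) :
    Module.finrank ℝ U = Module.finrank ℝ U' := by
  refine finrank_eq_of_isCompl_of_injective hV h h' (S'.projectionOnto U' h' ∘ₗ L ∘ₗ S.subtype)
    (U'.projectionOnto S' h'.symm ∘ₗ L ∘ₗ U.subtype) ?_ ?_
  · rw [injective_iff_map_eq_zero]
    intro s h0
    have h1 := hs s s.2
    rw [show S'.projection U' h' (L s) = 0 from congrArg Subtype.val h0, norm_zero] at h1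
    exact Subtype.ext (norm_le_zero_iff.1 (nonpos_of_mul_nonpos_right h1 hc))
  · rw [injective_iff_map_eq_zero]
    intro u h0
    have h1 := hu u u.2
    rw [show U'.projection S' h'.symm (L u) = 0 from congrArg Subtype.val h0, norm_zero] at h1
    exact Subtype.ext (norm_le_zero_iff.1 (nonpos_of_mul_nonpos_right h1 hc))

/-- The skew product on the tangent bundle. -/
def skewTangent (T : 𝒯 → Diff2 d M) (z : (ℤ → 𝒯) × TangentBundle (𝓡 d) M) :
    (ℤ → 𝒯) × TangentBundle (𝓡 d) M :=
  (fun k => z.1 (k + 1), (T (z.1 0)).tmap z.2)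

lemma continuous_skewTangent (hT : IsC1Family T) : Continuous (skewTangent T) :=
  ((continuous_pi fun k => continuous_apply (k + 1)).comp continuous_fst).prodMk
    (Continuous.comp (g := fun z : 𝒯 × TangentBundle (𝓡 d) M => (T z.1).tmap z.2)
      (f := fun z : (ℤ → 𝒯) × TangentBundle (𝓡 d) M => (z.1 0, z.2)) hT
      (((continuous_apply 0).comp continuous_fst).prodMk continuous_snd))

/-- The random parameters and points whose parameters lie in `W`. -/
def noiseDomain (M : Type*) (W : Set 𝒯) : Set ((ℤ → 𝒯) × M) := {p | ∀ k, p.1 k ∈ W}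

lemma skew_mem_noiseDomain {W : Set 𝒯} {p : (ℤ → 𝒯) × M} (hp : p ∈ noiseDomain M W) :
    skew T p ∈ noiseDomain M W := fun k => hp (k + 1)

/-- The bound on the `U`-component which defines the stable cone. -/
def tangentCone (hSU : ∀ x, IsCompl (S x) (U x)) : Set ((ℤ → 𝒯) × TangentBundle (𝓡 d) M) :=
  {z | ‖(componentMap (fun x => (hSU x).symm) z.2).2‖ ≤ 1 / 2 * ‖(componentMap hSU z.2).2‖}

/-- The abstract cocycle theorem is applied over the sequences with all terms near `w₀`. The last
clause, that the image of a nonzero vector of `U` misses the cone, is what later makes `E` map onto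
its image family. -/
lemma IsInvariantSplitting.exists_algebraic_stable_family (hT : IsC1Family T)
    (h : IsInvariantSplitting (T w₀) S U) :
    ∃ W ∈ 𝓝 w₀, ∃ E : ∀ p : (ℤ → 𝒯) × M, Submodule ℝ (TangentSpace (𝓡 d) p.2),
      (∀ p ∈ noiseDomain M W, ∀ v, v ∈ E p ↔
        ∀ n, (skewTangent T)^[n] (p.1, ⟨p.2, v⟩) ∈ tangentCone h.isCompl) ∧
      (∀ p ∈ noiseDomain M W, IsCompl (E p) (U p.2)) ∧
      (∀ p ∈ noiseDomain M W, ∀ u ∈ U p.2,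
        (skewTangent T (p.1, ⟨p.2, u⟩)) ∈ tangentCone h.isCompl → u = 0) := by
  classical
  obtain ⟨c, δ, hc, hδ, hδc, hev⟩ := h.eventually_nearly_dominated hT
  obtain ⟨W, hW, hWev⟩ := hev.exists_mem
  set P := {p : (ℤ → 𝒯) × M // p ∈ noiseDomain M W} with hP
  set F : P → P := fun p => ⟨skew T p.1, skew_mem_noiseDomain p.2⟩ with hF
  set A : ∀ p : P, TangentSpace (𝓡 d) p.1.2 →ₗ[ℝ] TangentSpace (𝓡 d) (F p).1.2 :=
    fun p => (mfderiv (𝓡 d) (𝓡 d) (T (p.1.1 0)) p.1.2).toLinearMap with hA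
  have hSU : ∀ p : P, IsCompl (S p.1.2) (U p.1.2) := fun p => h.isCompl _
  have hdom : IsNearlyDominated (V := fun p : P => TangentSpace (𝓡 d) p.1.2) (F := F) A hSU c δ := by
    refine ⟨hc, hδ, hδc, ?_, ?_, ?_, ?_, ?_⟩
    · exact fun p => (hWev _ (p.2 0) p.1.2).1
    · exact fun p => (hWev _ (p.2 0) p.1.2).2.1
    · exact fun p => (hWev _ (p.2 0) p.1.2).2.2.1
    · exact fun p => (hWev _ (p.2 0) p.1.2).2.2.2.2
    · intro p
      exact finrank_eq_of_mul_norm_le_projection (V := TangentSpace (𝓡 d) p.1.2)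
        (V' := TangentSpace (𝓡 d) (T (p.1.1 0) p.1.2)) rfl (h.isCompl _) (h.isCompl _)
        (mfderiv (𝓡 d) (𝓡 d) (T (p.1.1 0)) p.1.2).toLinearMap hc
        (hWev _ (p.2 0) p.1.2).2.2.2.1 (hWev _ (p.2 0) p.1.2).2.2.1
  obtain ⟨E, hE, hEU⟩ := hdom.exists_family
  have hiter : ∀ (n : ℕ) (z : Σ p : P, TangentSpace (𝓡 d) p.1.2),
      (fun z : Σ p : P, TangentSpace (𝓡 d) p.1.2 => ((z.1.1.1, ⟨z.1.1.2, z.2⟩) :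
        (ℤ → 𝒯) × TangentBundle (𝓡 d) M)) ((cocycleStep (F := F) A)^[n] z) =
      (skewTangent T)^[n] (z.1.1.1, ⟨z.1.1.2, z.2⟩) := by
    intro n z
    exact (Function.Semiconj.iterate_right (f := fun z : Σ p : P, TangentSpace (𝓡 d) p.1.2 =>
      ((z.1.1.1, ⟨z.1.1.2, z.2⟩) : (ℤ → 𝒯) × TangentBundle (𝓡 d) M)) (fun z => rfl) n) z
  refine ⟨W, hW, fun p => if hp : p ∈ noiseDomain M W then E ⟨p, hp⟩ else ⊥, ?_, ?_, ?_⟩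
  · intro p hp v
    simp only [dif_pos hp]
    rw [hE]
    refine forall_congr' fun n => ?_
    rw [← hiter n ⟨⟨p, hp⟩, v⟩]
    rfl
  · intro p hp
    simp only [dif_pos hp]
    exact hEU ⟨p, hp⟩
  · intro p hp u hu hcone
    obtain ⟨-, h2, h3, -⟩ := hWev _ (hp 0) p.2
    have h4 := h2 u hu
    have h5 := h3 u hu
    have h6 : ‖(U (T (p.1 0) p.2)).projection (S (T (p.1 0) p.2)) (h.isCompl _).symm
        (mfderiv (𝓡 d) (𝓡 d) (T (p.1 0)) p.2 u)‖ ≤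
      1 / 2 * ‖(S (T (p.1 0) p.2)).projection (U (T (p.1 0) p.2)) (h.isCompl _)
        (mfderiv (𝓡 d) (𝓡 d) (T (p.1 0)) p.2 u)‖ := hcone
    by_contra hne
    have hpos : 0 < ‖u‖ := norm_pos_iff.2 hne
    have h8 : 8 * δ * ‖u‖ ≤ c * ‖u‖ := by gcongr
    have h9 : 0 < c * ‖u‖ := by positivity
    linarith

lemma Submodule.eq_of_isCompl_of_le {V : Type*} [AddCommGroup V] [Module ℝ V]
    {S E U : Submodule ℝ V} (hS : IsCompl S U) (hE : IsCompl E U) (h : S ≤ E) : E = S :=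
  (eq_of_le_of_inf_le_of_sup_le h (z := U) (by rw [hE.inf_eq_bot]; exact bot_le)
    (by rw [hS.sup_eq_top]; exact le_top)).symm

/-- `E` and `S` have the common complement `U`, so projection along `U` carries `S` isomorphically
onto `E`. It takes a frame of `S` to a frame of `E`, which is continuous because components in
closed complementary families are. -/
lemma isContinuousFamilyOn_of_isCompl {E : ∀ p : (ℤ → 𝒯) × M, Submodule ℝ (TangentSpace (𝓡 d) p.2)}
    {Q : Set ((ℤ → 𝒯) × M)} (hE : IsClosedFamilyOn Prod.snd E Q)
    (hS : IsContinuousFamilyOn (fun x : M => x) S univ)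
    (hU : IsClosedFamilyOn (fun x : M => x) U univ) (hSU : ∀ x, IsCompl (S x) (U x))
    (hEU : ∀ p ∈ Q, IsCompl (E p) (U p.2)) : IsContinuousFamilyOn Prod.snd E Q := by
  classical
  intro p₀ hp₀
  obtain ⟨N, hN, k, s, hs, hspan⟩ := hS p₀.2 (mem_univ _)
  have hU' : IsClosedFamilyOn (X := (ℤ → 𝒯) × M) Prod.snd (fun p => U p.2) Q :=
    hU.comp continuous_snd.continuousOn (mapsTo_univ _ _)
  set e : Fin k → ∀ p : (ℤ → 𝒯) × M, TangentSpace (𝓡 d) p.2 := fun i p =>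
    if hp : p ∈ Q then (E p).projection (U p.2) (hEU p hp) (s i p.2) else 0 with he
  have he' : ∀ p (hp : p ∈ Q) i, e i p = (E p).projection (U p.2) (hEU p hp) (s i p.2) :=
    fun p hp i => by rw [he]; simp only [dif_pos hp]
  refine ⟨Prod.snd ⁻¹' N, continuous_snd.continuousAt hN, k, e, fun i p hp => ?_, fun p hp => ?_⟩
  · have h1 : Tendsto (fun q : (ℤ → 𝒯) × M => q) (𝓝[Prod.snd ⁻¹' N ∩ Q] p) (𝓝 p) :=
      tendsto_id.mono_left nhdsWithin_le_nhds
    have hQ : ∀ᶠ q in 𝓝[Prod.snd ⁻¹' N ∩ Q] p, q ∈ Q := by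
      filter_upwards [self_mem_nhdsWithin] with q hq using hq.2
    refine hE.tendsto_component hU' (p := fun q : (ℤ → 𝒯) × M => q) (v := fun q => s i q.2)
      (v₀ := s i p.2) hp.2 (hEU p hp.2).disjoint h1 ((continuous_snd.tendsto p).comp h1) hQ
      ?_ ?_ ?_ ?_ ?_
    · have h2 := (hs i p.2 ⟨hp.1, mem_univ _⟩).tendsto
      refine h2.comp (tendsto_nhdsWithin_iff.2 ⟨(continuous_snd.tendsto p).comp h1, ?_⟩)
      filter_upwards [self_mem_nhdsWithin] with q hq using ⟨hq.1, mem_univ _⟩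
    · filter_upwards [hQ] with q hq
      rw [he' q hq]
      exact Submodule.projection_apply_mem _ _
    · filter_upwards [hQ] with q hq
      rw [he' q hq]
      exact Submodule.sub_projection_mem _ _
    · rw [he' p hp.2]
      exact Submodule.projection_apply_mem _ _
    · rw [he' p hp.2]
      exact Submodule.sub_projection_mem _ _
  · obtain ⟨hli, hsp⟩ := hspan p.2 ⟨hp.1, mem_univ _⟩
    set r := (E p).projection (U p.2) (hEU p hp.2) with hr
    have heq : (fun i => e i p) = r ∘ fun i => s i p.2 := funext fun i => he' p hp.2 i
    rw [heq]
    constructor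
    · refine hli.map ?_
      rw [hsp, hr, Submodule.ker_projection]
      exact (hSU p.2).disjoint
    · rw [range_comp, ← Submodule.map_span, hsp]
      apply le_antisymm
      · rintro _ ⟨v, -, rfl⟩
        exact Submodule.projection_apply_mem _ _
      · intro v hv
        refine ⟨(S p.2).projection (U p.2) (hSU p.2) v, Submodule.projection_apply_mem _ _, ?_⟩
        have h1 := Submodule.sub_projection_mem (hSU p.2) v
        have h2 : r (v - (S p.2).projection (U p.2) (hSU p.2) v) = 0 := by
          rw [hr, Submodule.projection_apply_eq_zero_iff]; exact h1
        rw [map_sub, sub_eq_zero] at h2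
        rw [← h2, hr, Submodule.projection_apply_of_mem_left _ hv]

lemma isClosed_tangentCone (hSU : ∀ x, IsCompl (S x) (U x))
    (hS : IsClosedFamilyOn (fun x : M => x) S univ)
    (hU : IsClosedFamilyOn (fun x : M => x) U univ) :
    IsClosed (tangentCone (𝒯 := 𝒯) hSU) :=
  isClosed_le
    ((continuous_norm_tangentBundle d M).comp ((continuous_componentMap _ hU hS).comp
      continuous_snd))
    (continuous_const.mul ((continuous_norm_tangentBundle d M).comp
      ((continuous_componentMap hSU hS hU).comp continuous_snd)))

lemma isClosedFamilyOn_of_forall_iterate_mem (hT : IsC1Family T)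
    {C : Set ((ℤ → 𝒯) × TangentBundle (𝓡 d) M)} (hC : IsClosed C)
    {E : ∀ p : (ℤ → 𝒯) × M, Submodule ℝ (TangentSpace (𝓡 d) p.2)} {Q : Set ((ℤ → 𝒯) × M)}
    (hE : ∀ p ∈ Q, ∀ v, v ∈ E p ↔ ∀ n, (skewTangent T)^[n] (p.1, ⟨p.2, v⟩) ∈ C) :
    IsClosedFamilyOn Prod.snd E Q := by
  intro p₀ hp₀ v₀ hv₀
  rw [hE p₀ hp₀]
  intro n
  have hcont : Continuous fun z : ((ℤ → 𝒯) × M) × TangentBundle (𝓡 d) M =>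
      (skewTangent T)^[n] (z.1.1, z.2) := ((continuous_skewTangent hT).iterate n).comp
    ((continuous_fst.comp continuous_fst).prodMk continuous_snd)
  have hsub : familyGraph Prod.snd E Q ⊆
      (fun z : ((ℤ → 𝒯) × M) × TangentBundle (𝓡 d) M => (skewTangent T)^[n] (z.1.1, z.2)) ⁻¹' C := by
    intro z hz
    obtain ⟨hp, v, hv, hY⟩ := hz
    rw [mem_preimage, hY]
    exact (hE z.1 hp v).1 hv n
  exact closure_minimal hsub (hC.preimage hcont) hv₀

/-- The stable subbundle of a dominated splitting persists under random perturbations. -/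
theorem IsInvariantSplitting.exists_stable_family (hT : IsC1Family T)
    (h : IsInvariantSplitting (T w₀) S U) :
    ∃ W ∈ 𝓝 w₀, ∃ E : ∀ p : (ℤ → 𝒯) × M, Submodule ℝ (TangentSpace (𝓡 d) p.2),
      IsContinuousFamilyOn Prod.snd E (noiseDomain M W) ∧
      (∀ p ∈ noiseDomain M W,
        (E p).map (mfderiv (𝓡 d) (𝓡 d) (T (p.1 0)) p.2).toLinearMap = E (skew T p)) ∧
      (∀ x, E (fun _ => w₀, x) = S x) ∧
      (∀ p ∈ noiseDomain M W, IsCompl (E p) (U p.2)) ∧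
      (∀ p ∈ noiseDomain M W, ∀ v ∈ E p,
        ‖(U p.2).projection (S p.2) (h.isCompl p.2).symm v‖ ≤
          1 / 2 * ‖(S p.2).projection (U p.2) (h.isCompl p.2) v‖) := by
  obtain ⟨W, hW, E, hE, hEU, hcone⟩ := h.exists_algebraic_stable_family hT
  have hSc := h.continuous_s.isClosedFamilyOn continuous_id
  have hUc := h.continuous_u.isClosedFamilyOn continuous_id
  have hEc : IsClosedFamilyOn Prod.snd E (noiseDomain M W) :=
    isClosedFamilyOn_of_forall_iterate_mem hT (isClosed_tangentCone h.isCompl hSc hUc) hE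
  have hinv : ∀ p ∈ noiseDomain M W, ∀ v,
      v ∈ E p → mfderiv (𝓡 d) (𝓡 d) (T (p.1 0)) p.2 v ∈ E (skew T p) := by
    intro p hp v hv
    have h1 := (hE p hp v).1 hv
    exact (hE (skew T p) (skew_mem_noiseDomain hp) _).2 fun n => h1 (n + 1)
  have h0 : (fun _ => w₀) ∈ {w : ℤ → 𝒯 | ∀ k, w k ∈ W} := fun k => mem_of_mem_nhds hW
  refine ⟨W, hW, E, isContinuousFamilyOn_of_isCompl hEc h.continuous_s hUc h.isCompl hEU,
    ?_, ?_, hEU, ?_⟩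
  · intro p hp
    apply le_antisymm
    · rintro _ ⟨v, hv, rfl⟩
      exact hinv p hp v hv
    · intro y hy
      obtain ⟨v, rfl⟩ := (T (p.1 0)).mfderiv_surjective p.2 y
      refine ⟨v, ?_, rfl⟩
      -- The image of `v - e`, a vector of `U`, lies in `E` and hence in the cone, which forces `v =
      -- e`.
      set e := (E p).projection (U p.2) (hEU p hp) v with he
      have he1 : e ∈ E p := Submodule.projection_apply_mem _ _
      have he2 : v - e ∈ U p.2 := Submodule.sub_projection_mem _ _
      have h1 : mfderiv (𝓡 d) (𝓡 d) (T (p.1 0)) p.2 (v - e) ∈ E (skew T p) := by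
        rw [map_sub]
        exact Submodule.sub_mem _ hy (hinv p hp e he1)
      have h2 := hcone p hp (v - e) he2
        ((hE (skew T p) (skew_mem_noiseDomain hp) _).1 h1 0)
      rw [sub_eq_zero.1 h2]
      exact he1
  · intro x
    -- Under constant noise `w₀` a vector of `S` stays in `S`, hence in the cone. So `S ≤ E`, and
    -- the common complement `U` gives equality.
    refine Submodule.eq_of_isCompl_of_le (h.isCompl x) (hEU _ h0) fun v hv => ?_
    refine (hE (fun _ => w₀, x) h0 v).2 fun n => ?_
    have h1 : ∀ n, ((skewTangent T)^[n] (fun _ => w₀, ⟨x, v⟩)).1 = (fun _ => w₀) ∧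
        ((skewTangent T)^[n] (fun _ => w₀, ⟨x, v⟩)).2.2 ∈
          S ((skewTangent T)^[n] (fun _ => w₀, ⟨x, v⟩)).2.1 := by
      intro n
      induction n with
      | zero => exact ⟨rfl, hv⟩
      | succ n ih =>
        rw [Function.iterate_succ_apply']
        generalize (skewTangent T)^[n] (fun _ => w₀, ⟨x, v⟩) = z at ih ⊢
        obtain ⟨w, y, u⟩ := z
        obtain ⟨rfl, ih⟩ := ih
        exact ⟨rfl, h.map_s y u ih⟩
    have h2 := (h1 n).2
    generalize (skewTangent T)^[n] (fun _ => w₀, ⟨x, v⟩) = z at h2 ⊢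
    have h3 : (componentMap (fun x => (h.isCompl x).symm) z.2).2 = 0 :=
      (Submodule.projection_apply_eq_zero_iff (h.isCompl z.2.1).symm).2 h2
    change ‖_‖ ≤ _
    rw [h3, norm_zero]
    positivity
  · intro p hp v hv
    exact (hE p hp v).1 hv 0

end RandomFamily

/-! ### Semicontinuity of restricted norms; the splitting for the inverse map -/

section Semicontinuity

variable {d : ℕ} {M : Type*} [TopologicalSpace M] [T2Space M] [CompactSpace M]
    [ChartedSpace (EuclideanSpace ℝ (Fin d)) M] [IsManifold (𝓡 d) ∞ M]
    [RiemannianBundle (fun x : M => TangentSpace (𝓡 d) x)]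

lemma restrNorm_nonneg (g : M → M) (x : M) (V : Submodule ℝ (TangentSpace (𝓡 d) x)) :
    0 ≤ restrNorm g x V :=
  norm_nonneg ((mfderiv (𝓡 d) (𝓡 d) g x).comp V.subtypeL)

lemma norm_mfderiv_le_restrNorm (g : M → M) {x : M} {V : Submodule ℝ (TangentSpace (𝓡 d) x)}
    {v : TangentSpace (𝓡 d) x} (hv : v ∈ V) :
    ‖mfderiv (𝓡 d) (𝓡 d) g x v‖ ≤ restrNorm g x V * ‖v‖ :=
  ((mfderiv (𝓡 d) (𝓡 d) g x).comp V.subtypeL).le_opNorm ⟨v, hv⟩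

lemma restrNorm_le (g : M → M) {x : M} {V : Submodule ℝ (TangentSpace (𝓡 d) x)} {C : ℝ}
    (hC : 0 ≤ C) (h : ∀ v ∈ V, ‖mfderiv (𝓡 d) (𝓡 d) g x v‖ ≤ C * ‖v‖) : restrNorm g x V ≤ C :=
  ContinuousLinearMap.opNorm_le_bound _ hC fun v => h v v.2

variable [IsContMDiffRiemannianBundle (𝓡 d) ∞ (EuclideanSpace ℝ (Fin d))
      (fun x : M => TangentSpace (𝓡 d) x)]

/-- The norm of the derivative along a closed family of subspaces is upper semicontinuous. -/
lemma IsClosedFamilyOn.eventually_restrNorm_lt {X : Type*} [TopologicalSpace X] {b : X → M}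
    {E : ∀ p : X, Submodule ℝ (TangentSpace (𝓡 d) (b p))} {Q : Set X}
    (hE : IsClosedFamilyOn b E Q) (hb : Continuous b) {g : X → M → M}
    (hg : Continuous fun z : X × TangentBundle (𝓡 d) M => tangentMap (𝓡 d) (𝓡 d) (g z.1) z.2)
    {p₀ : X} (hp₀ : p₀ ∈ Q) {c : ℝ} (hc : restrNorm (g p₀) (b p₀) (E p₀) < c) :
    ∀ᶠ p in 𝓝[Q] p₀, restrNorm (g p) (b p) (E p) < c := by
  by_contra hcon
  obtain ⟨c', hc'1, hc'2⟩ := exists_between hc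
  have hfreq : ∃ᶠ p in 𝓝[Q] p₀, c ≤ restrNorm (g p) (b p) (E p) :=
    fun h0 => hcon (h0.mono fun p hp => not_le.1 hp)
  have hne : NeBot (𝓝[Q] p₀ ⊓ 𝓟 {p | c ≤ restrNorm (g p) (b p) (E p)}) :=
    frequently_mem_iff_neBot.1 hfreq
  set 𝒰 := Ultrafilter.of (𝓝[Q] p₀ ⊓ 𝓟 {p | c ≤ restrNorm (g p) (b p) (E p)})
  have h𝒰 := Ultrafilter.of_le (𝓝[Q] p₀ ⊓ 𝓟 {p | c ≤ restrNorm (g p) (b p) (E p)})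
  have h1 : Tendsto (fun p : X => p) 𝒰 (𝓝 p₀) :=
    h𝒰.trans (inf_le_left.trans nhdsWithin_le_nhds)
  have h2 : ∀ᶠ p in (𝒰 : Filter X), p ∈ Q := h𝒰.trans inf_le_left self_mem_nhdsWithin
  have h3 : ∀ᶠ p in (𝒰 : Filter X), c ≤ restrNorm (g p) (b p) (E p) :=
    h𝒰.trans inf_le_right (mem_principal_self _)
  -- Almost maximizing vectors at the points where the bound fails, 0 elsewhere. Their limit lies in
  -- `E p₀` and violates the bound there, the gap being secured by `c'`.
  have hv : ∀ p : X, ∃ v ∈ E p, ‖v‖ ≤ 1 ∧ (c ≤ restrNorm (g p) (b p) (E p) →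
      c' < ‖mfderiv (𝓡 d) (𝓡 d) (g p) (b p) v‖) := by
    intro p
    by_cases hp : c ≤ restrNorm (g p) (b p) (E p)
    · obtain ⟨v, hv1, hv2⟩ := ContinuousLinearMap.exists_lt_apply_of_lt_opNorm
        ((mfderiv (𝓡 d) (𝓡 d) (g p) (b p)).comp (E p).subtypeL) (hc'2.trans_le hp)
      exact ⟨v, v.2, le_of_lt hv1, fun _ => hv2⟩
    · exact ⟨0, Submodule.zero_mem _, by simp, fun h => absurd h hp⟩
  choose v hvE hv1 hvc using hv
  obtain ⟨Y, hY1, hY⟩ := (isCompact_norm_le_tangentBundle M (d := d) 1).ultrafilter_le_nhds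
    (𝒰.map fun p => (⟨b p, v p⟩ : TangentBundle (𝓡 d) M))
    (tendsto_principal.2 (Eventually.of_forall hv1))
  have hY' : Tendsto (fun p => (⟨b p, v p⟩ : TangentBundle (𝓡 d) M)) 𝒰 (𝓝 Y) := hY
  have hbase : Y.1 = b p₀ :=
    tendsto_nhds_unique (((FiberBundle.continuous_proj _ _).tendsto Y).comp hY')
      ((hb.tendsto p₀).comp h1)
  obtain ⟨y, u⟩ := Y
  obtain rfl : y = b p₀ := hbase
  have hu : u ∈ E p₀ := hE.mem_of_tendsto hp₀ h1 h2 hY' (Eventually.of_forall hvE)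
  have h4 : Tendsto (fun p => ‖mfderiv (𝓡 d) (𝓡 d) (g p) (b p) (v p)‖) 𝒰
      (𝓝 ‖mfderiv (𝓡 d) (𝓡 d) (g p₀) (b p₀) u‖) :=
    ((continuous_norm_tangentBundle d M).tendsto _).comp
      ((hg.tendsto (p₀, ⟨b p₀, u⟩)).comp (h1.prodMk_nhds hY'))
  have h5 : c' ≤ ‖mfderiv (𝓡 d) (𝓡 d) (g p₀) (b p₀) u‖ :=
    ge_of_tendsto h4 (h3.mono fun p hp => (hvc p hp).le)
  have h6 := norm_mfderiv_le_restrNorm (g p₀) hu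
  have h7 : restrNorm (g p₀) (b p₀) (E p₀) * ‖u‖ ≤ restrNorm (g p₀) (b p₀) (E p₀) * 1 :=
    mul_le_mul_of_nonneg_left hY1 (restrNorm_nonneg _ _ _)
  linarith

lemma norm_mfderiv_symm_mfderiv (g : Diff2 d M) (x : M) (v : TangentSpace (𝓡 d) x) :
    ‖mfderiv (𝓡 d) (𝓡 d) g.symm (g x) (mfderiv (𝓡 d) (𝓡 d) g x v)‖ = ‖v‖ :=
  congrArg (fun Y : TangentBundle (𝓡 d) M => ‖Y.2‖) (g.tmap_symm_tmap ⟨x, v⟩)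

lemma mfderiv_symm_mfderiv_mem_iff (g : Diff2 d M) (x : M) (v : TangentSpace (𝓡 d) x)
    (V : ∀ x : M, Submodule ℝ (TangentSpace (𝓡 d) x)) :
    mfderiv (𝓡 d) (𝓡 d) g.symm (g x) (mfderiv (𝓡 d) (𝓡 d) g x v) ∈ V (g.symm (g x)) ↔
      v ∈ V x :=
  iff_of_eq (congrArg (fun Y : TangentBundle (𝓡 d) M => Y.2 ∈ V Y.1) (g.tmap_symm_tmap ⟨x, v⟩))

variable {f : Diff2 d M} {Ecu Ecs : ∀ x : M, Submodule ℝ (TangentSpace (𝓡 d) x)}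

/-- Vector form of domination: `u` is the image of `Df u` under the inverse derivative, so `‖u‖` is
controlled by `‖Df u‖`. -/
lemma IsDominatedSplitting.two_mul_lt (h : IsDominatedSplitting f Ecu Ecs) {x : M}
    {s u : TangentSpace (𝓡 d) x} (hs : s ∈ Ecs x) (hu : u ∈ Ecu x) (hs0 : s ≠ 0) (hu0 : u ≠ 0) :
    2 * ‖mfderiv (𝓡 d) (𝓡 d) f x s‖ * ‖u‖ < ‖mfderiv (𝓡 d) (𝓡 d) f x u‖ * ‖s‖ := by
  have h1 := norm_mfderiv_le_restrNorm f hs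
  have hfu : mfderiv (𝓡 d) (𝓡 d) f x u ∈ Ecu (f x) := by
    rw [← h.map_cu x]; exact ⟨u, hu, rfl⟩
  have h2 := norm_mfderiv_le_restrNorm f.symm hfu
  rw [norm_mfderiv_symm_mfderiv] at h2
  have h3 := h.dominated x
  have hs1 : 0 < ‖s‖ := norm_pos_iff.2 hs0
  have hu1 : 0 < ‖mfderiv (𝓡 d) (𝓡 d) f x u‖ := by
    rw [norm_pos_iff]
    intro h0
    exact hu0 (f.mfderiv_injective x (h0.trans (map_zero _).symm))
  calc 2 * ‖mfderiv (𝓡 d) (𝓡 d) f x s‖ * ‖u‖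
      ≤ 2 * (restrNorm f x (Ecs x) * ‖s‖) *
        (restrNorm f.symm (f x) (Ecu (f x)) * ‖mfderiv (𝓡 d) (𝓡 d) f x u‖) := by
        have := restrNorm_nonneg (d := d) f x (Ecs x)
        gcongr
    _ = 2 * (restrNorm f x (Ecs x) * restrNorm f.symm (f x) (Ecu (f x))) *
        (‖mfderiv (𝓡 d) (𝓡 d) f x u‖ * ‖s‖) := by ring
    _ < 2 * (1 / 2) * (‖mfderiv (𝓡 d) (𝓡 d) f x u‖ * ‖s‖) := by gcongr
    _ = _ := by ring

lemma IsDominatedSplitting.isInvariantSplitting (h : IsDominatedSplitting f Ecu Ecs) :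
    IsInvariantSplitting f Ecs Ecu where
  continuous_s := h.continuous_cs
  continuous_u := h.continuous_cu
  isCompl x := (h.isCompl x).symm
  map_s x s hs := by rw [← h.map_cs x]; exact ⟨s, hs, rfl⟩
  map_u x u hu := by rw [← h.map_cu x]; exact ⟨u, hu, rfl⟩
  dom _ _ hs _ hu hs0 hu0 := h.two_mul_lt hs hu hs0 hu0

/-- For the inverse map the two bundles exchange roles; the vector inequality at `x` is read at `f
x` for the images. -/
lemma IsDominatedSplitting.isInvariantSplitting_symm (h : IsDominatedSplitting f Ecu Ecs) :
    IsInvariantSplitting (d := d) (M := M) f.symm Ecu Ecs where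
  continuous_s := h.continuous_cu
  continuous_u := h.continuous_cs
  isCompl := h.isCompl
  map_s y s hs := by
    obtain ⟨x, rfl⟩ : ∃ x, f x = y := f.surjective y
    rw [← h.map_cu x] at hs
    obtain ⟨v, hv, rfl⟩ := hs
    exact (mfderiv_symm_mfderiv_mem_iff f x v Ecu).2 hv
  map_u y s hs := by
    obtain ⟨x, rfl⟩ : ∃ x, f x = y := f.surjective y
    rw [← h.map_cs x] at hs
    obtain ⟨v, hv, rfl⟩ := hs
    exact (mfderiv_symm_mfderiv_mem_iff f x v Ecs).2 hv
  dom y u hu s hs hu0 hs0 := by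
    obtain ⟨x, rfl⟩ : ∃ x, f x = y := f.surjective y
    rw [← h.map_cu x] at hu
    rw [← h.map_cs x] at hs
    obtain ⟨u, hu, rfl⟩ := hu
    obtain ⟨s, hs, rfl⟩ := hs
    have h1 := h.two_mul_lt hs hu (by rintro rfl; simp at hs0) (by rintro rfl; simp at hu0)
    have h2 := norm_mfderiv_symm_mfderiv f x u
    have h3 := norm_mfderiv_symm_mfderiv f x s
    have h4 : 2 * ‖u‖ * ‖mfderiv (𝓡 d) (𝓡 d) f x s‖ < ‖s‖ * ‖mfderiv (𝓡 d) (𝓡 d) f x u‖ := by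
      linarith
    rw [← h2, ← h3] at h4
    exact h4

end Semicontinuity

/-! ### Support of the product measure -/

section NoiseSpace

variable {𝒯 : Type*} [MetricSpace 𝒯] [MeasurableSpace 𝒯] [BorelSpace 𝒯]

/-- A basic neighbourhood restricts finitely many coordinates, and the mass of such a box is a
finite product. Only measurable cylinders are evaluated, so the product and Borel σ-algebras need
not be compared. -/
lemma noiseSpace_eq (θ : ℝ → ProbabilityMeasure 𝒯) (ε : ℝ) :
    noiseSpace θ ε = {w | ∀ k, w k ∈ (θ ε : Measure 𝒯).support} := by
  ext w
  simp only [noiseSpace, Measure.mem_support_iff_forall, mem_ofPred_eq]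
  constructor
  · intro h k U hU
    obtain ⟨O, hOU, hO, hkO⟩ := mem_nhds_iff.1 hU
    have h1 := h ((fun v : ℤ → 𝒯 => v k) ⁻¹' O)
      ((continuous_apply k).continuousAt (hO.mem_nhds hkO))
    rw [(measurePreserving_eval_infinitePi (fun _ : ℤ => (θ ε : Measure 𝒯)) k).measure_preimage
      hO.measurableSet.nullMeasurableSet] at h1
    exact h1.trans_le (measure_mono hOU)
  · intro h U hU
    rw [nhds_pi, Filter.mem_pi] at hU
    obtain ⟨I, hI, t, ht, htU⟩ := hU
    have h1 : (Measure.infinitePi fun _ : ℤ => (θ ε : Measure 𝒯))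
        ((hI.toFinset : Set ℤ).pi fun k => interior (t k)) ≤
        (Measure.infinitePi fun _ : ℤ => (θ ε : Measure 𝒯)) U := by
      refine measure_mono (Subset.trans ?_ htU)
      rw [Finite.coe_toFinset]
      exact pi_mono fun k _ => interior_subset
    refine lt_of_lt_of_le ?_ h1
    rw [Measure.infinitePi_pi _ fun k _ => isOpen_interior.measurableSet]
    refine pos_iff_ne_zero.2 (Finset.prod_ne_zero_iff.2 fun k _ => ?_)
    exact (h k _ (interior_mem_nhds.2 (ht k))).ne'

lemma exists_forall_mem_of_mem_nhds_const {κ X : Type*} [TopologicalSpace X] {x : X}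
    {N : Set (κ → X)} (hN : N ∈ 𝓝 fun _ => x) : ∃ W ∈ 𝓝 x, ∀ w : κ → X, (∀ k, w k ∈ W) → w ∈ N := by
  rw [nhds_pi, Filter.mem_pi] at hN
  obtain ⟨I, hI, t, ht, htN⟩ := hN
  exact ⟨⋂ k ∈ I, t k, (biInter_mem hI).2 fun k _ => ht k,
    fun w hw => htN fun k hk => mem_iInter₂.1 (hw k) k hk⟩

end NoiseSpace

/-! ### Time reversal, transversality and openness of domination -/

section RandomSplitting

variable {d : ℕ} {M : Type*} [TopologicalSpace M]
    [ChartedSpace (EuclideanSpace ℝ (Fin d)) M] [IsManifold (𝓡 d) ∞ M]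

lemma IsContinuousFamilyOn.comp {X Y : Type*} [TopologicalSpace X] [TopologicalSpace Y] {b : X → M}
    {V : ∀ p : X, Submodule ℝ (TangentSpace (𝓡 d) (b p))} {S : Set X}
    (h : IsContinuousFamilyOn b V S) {φ : Y → X} (hφ : Continuous φ) {S' : Set Y}
    (hS : MapsTo φ S' S) : IsContinuousFamilyOn (fun q => b (φ q)) (fun q => V (φ q)) S' := by
  intro q₀ hq₀
  obtain ⟨N, hN, k, s, hs, hV⟩ := h _ (hS hq₀)
  refine ⟨φ ⁻¹' N, hφ.continuousAt hN, k, fun i q => s i (φ q), fun i => ?_, fun q hq => ?_⟩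
  · exact ContinuousOn.comp (hs i) hφ.continuousOn fun q hq => ⟨hq.1, hS hq.2⟩
  · exact hV _ ⟨hq.1, hS hq.2⟩

lemma IsContinuousFamilyOn.mono {X : Type*} [TopologicalSpace X] {b : X → M}
    {V : ∀ p : X, Submodule ℝ (TangentSpace (𝓡 d) (b p))} {S S' : Set X}
    (h : IsContinuousFamilyOn b V S) (hS : S' ⊆ S) : IsContinuousFamilyOn b V S' :=
  h.comp continuous_id hS

variable {𝒯 : Type*}

/-- Time reversal of the random parameters. -/
def reflect (p : (ℤ → 𝒯) × M) : (ℤ → 𝒯) × M := (fun k => p.1 (-1 - k), p.2)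

lemma continuous_reflect [TopologicalSpace 𝒯] : Continuous (reflect (𝒯 := 𝒯) (M := M)) :=
  ((continuous_pi fun k => continuous_apply (-1 - k)).comp continuous_fst).prodMk continuous_snd

lemma reflect_mem_noiseDomain {W : Set 𝒯} [TopologicalSpace 𝒯] {p : (ℤ → 𝒯) × M}
    (hp : p ∈ noiseDomain M W) : reflect p ∈ noiseDomain M W := fun k => hp (-1 - k)

lemma noiseDomain_mono [TopologicalSpace 𝒯] {W W' : Set 𝒯} (h : W ⊆ W') :
    noiseDomain M W ⊆ noiseDomain M W' :=
  fun _ hp k => h (hp k)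

/-- The index `-1 - k` exchanges the terms `0` and `-1`. Hence `reflect` conjugates the inverse of
`skew T` to the skew product of the inverse maps. -/
lemma reflect_skew (T : 𝒯 → Diff2 d M) (p : (ℤ → 𝒯) × M) :
    skew (fun w => (T w).symm) (reflect (skew T p)) = reflect p := by
  refine Prod.ext (funext fun k => ?_) ?_
  · change p.1 (-1 - (k + 1) + 1) = p.1 (-1 - k)
    exact congrArg p.1 (by ring)
  · change (T (p.1 (-1 - 0 + 1))).symm (T (p.1 0) p.2) = p.2
    exact (T (p.1 0)).symm_apply_apply p.2

variable [TopologicalSpace 𝒯] {T : 𝒯 → Diff2 d M}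

lemma continuous_skew (hT : IsC1Family T) : Continuous (skew T) :=
  ((continuous_pi fun k => continuous_apply (k + 1)).comp continuous_fst).prodMk
    (Continuous.comp (g := fun z : 𝒯 × M => T z.1 z.2)
      (f := fun z : (ℤ → 𝒯) × M => (z.1 0, z.2)) hT.continuous_apply
      (((continuous_apply 0).comp continuous_fst).prodMk continuous_snd))

variable [T2Space M] [CompactSpace M] [RiemannianBundle (fun x : M => TangentSpace (𝓡 d) x)]
    [IsContMDiffRiemannianBundle (𝓡 d) ∞ (EuclideanSpace ℝ (Fin d))
      (fun x : M => TangentSpace (𝓡 d) x)]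

/-- A family of subspaces which is invariant for the inverses of the maps `T w`, seen in the reversed
time, is invariant for the maps `T w`. -/
lemma map_reflect_eq {W : Set 𝒯} {E : ∀ p : (ℤ → 𝒯) × M, Submodule ℝ (TangentSpace (𝓡 d) p.2)}
    (hE : ∀ p ∈ noiseDomain M W,
      (E p).map (mfderiv (𝓡 d) (𝓡 d) (T (p.1 0)).symm p.2).toLinearMap =
        E (skew (fun w => (T w).symm) p)) {p : (ℤ → 𝒯) × M} (hp : p ∈ noiseDomain M W) :
    (E (reflect p)).map (mfderiv (𝓡 d) (𝓡 d) (T (p.1 0)) p.2).toLinearMap =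
      E (reflect (skew T p)) := by
  have hiff : ∀ q ∈ noiseDomain M W, ∀ y : TangentSpace (𝓡 d) q.2,
      y ∈ E q ↔ mfderiv (𝓡 d) (𝓡 d) (T (q.1 0)).symm q.2 y ∈
        E (skew (fun w => (T w).symm) q) := by
    intro q hq y
    rw [← hE q hq]
    refine ⟨fun h => ⟨y, h, rfl⟩, ?_⟩
    rintro ⟨z, hz, hzy⟩
    rwa [← Diff2.mfderiv_injective (M := M) (T (q.1 0)).symm q.2 hzy]
  have key : ∀ v : TangentSpace (𝓡 d) p.2,
      mfderiv (𝓡 d) (𝓡 d) (T (p.1 0)) p.2 v ∈ E (reflect (skew T p)) ↔ v ∈ E (reflect p) := by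
    intro v
    refine (hiff _ (reflect_mem_noiseDomain (skew_mem_noiseDomain hp)) _).trans ?_
    have h1 : (reflect (skew T p)).1 0 = p.1 0 := rfl
    have h2 : (fun k => (reflect (skew T p)).1 (k + 1)) = (reflect p).1 :=
      congrArg Prod.fst (reflect_skew T p)
    have h3 : Diff2.tmap (T (p.1 0)).symm ((T (p.1 0)).tmap ⟨p.2, v⟩) = ⟨p.2, v⟩ :=
      Diff2.tmap_symm_tmap _ _
    change (Diff2.tmap (T (p.1 0)).symm ((T (p.1 0)).tmap ⟨p.2, v⟩)).2 ∈
      E (fun k => (reflect (skew T p)).1 (k + 1),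
        (Diff2.tmap (T (p.1 0)).symm ((T (p.1 0)).tmap ⟨p.2, v⟩)).1) ↔ _
    rw [h2, h3]
    rfl
  apply le_antisymm
  · rintro _ ⟨v, hv, rfl⟩
    exact (key v).2 hv
  · intro y hy
    obtain ⟨v, rfl⟩ := (T (p.1 0)).mfderiv_surjective p.2 y
    exact ⟨v, (key v).1 hy, rfl⟩

/-- A common vector lies in both opposite cones of width `1/2` and is therefore zero. The dimensions
are complementary because `E` replaces `S` and `E'` replaces `U`. -/
lemma isCompl_of_cones {V : Type*} [NormedAddCommGroup V] [NormedSpace ℝ V]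
    [FiniteDimensional ℝ V] {S U E E' : Submodule ℝ V} (h : IsCompl S U) (hE : IsCompl E U)
    (hE' : IsCompl E' S)
    (hc : ∀ v ∈ E, ‖U.projection S h.symm v‖ ≤ 1 / 2 * ‖S.projection U h v‖)
    (hc' : ∀ v ∈ E', ‖S.projection U h v‖ ≤ 1 / 2 * ‖U.projection S h.symm v‖) :
    IsCompl E' E := by
  have h1 := Submodule.finrank_add_eq_of_isCompl h
  have h2 := Submodule.finrank_add_eq_of_isCompl hE
  have h3 := Submodule.finrank_add_eq_of_isCompl hE'
  refine (Submodule.isCompl_iff_disjoint _ _ (by omega)).2 (Submodule.disjoint_def.2 ?_)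
  intro v hv hv'
  have h4 := hc v hv'
  have h5 := hc' v hv
  have h6 : ‖S.projection U h v‖ = 0 := by
    linarith [norm_nonneg (S.projection U h v), norm_nonneg (U.projection S h.symm v)]
  have h7 : ‖U.projection S h.symm v‖ = 0 := by
    linarith [norm_nonneg (S.projection U h v), norm_nonneg (U.projection S h.symm v)]
  rw [← Submodule.projection_add_projection_eq_self h v, norm_eq_zero.1 h6, norm_eq_zero.1 h7,
    add_zero]

lemma exists_mul_lt_of_mul_lt {a b c : ℝ} (h : a * b < c) :
    ∃ a' b', a < a' ∧ b < b' ∧ a' * b' < c := by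
  have hc : Tendsto (fun t : ℝ => (a + t) * (b + t)) (𝓝[>] 0) (𝓝 (a * b)) := by
    have : Continuous fun t : ℝ => (a + t) * (b + t) := by fun_prop
    simpa using (this.tendsto 0).mono_left nhdsWithin_le_nhds
  obtain ⟨t, ht, ht'⟩ := ((hc.eventually_lt_const h).and self_mem_nhdsWithin).exists
  have ht0 : 0 < t := ht'
  exact ⟨a + t, b + t, by linarith, by linarith, ht⟩

lemma eventually_restrNorm_skew_lt (hT : IsC1Family T) {Q : Set ((ℤ → 𝒯) × M)}
    {Ecs : ∀ p : (ℤ → 𝒯) × M, Submodule ℝ (TangentSpace (𝓡 d) p.2)}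
    (hcs : IsClosedFamilyOn Prod.snd Ecs Q) {p₀ : (ℤ → 𝒯) × M} (h0 : p₀ ∈ Q) {a : ℝ}
    (ha : restrNorm (T (p₀.1 0)) p₀.2 (Ecs p₀) < a) :
    ∀ᶠ p in 𝓝 p₀, p ∈ Q → restrNorm (T (p.1 0)) p.2 (Ecs p) < a := by
  have hev : Continuous fun z : ((ℤ → 𝒯) × M) × TangentBundle (𝓡 d) M => (z.1.1 0, z.2) :=
    (((continuous_apply (0 : ℤ)).comp continuous_fst).comp continuous_fst).prodMk continuous_snd
  have hg1 : Continuous fun z : ((ℤ → 𝒯) × M) × TangentBundle (𝓡 d) M =>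
      tangentMap (𝓡 d) (𝓡 d) (T (z.1.1 0)) z.2 :=
    Continuous.comp (g := fun z : 𝒯 × TangentBundle (𝓡 d) M => (T z.1).tmap z.2) hT hev
  exact eventually_nhdsWithin_iff.1 (hcs.eventually_restrNorm_lt
    (g := fun p : (ℤ → 𝒯) × M => T (p.1 0)) continuous_snd hg1 h0 ha)

lemma eventually_restrNorm_skew_symm_lt (hT : IsC1Family T) {Q : Set ((ℤ → 𝒯) × M)}
    {Ecu : ∀ p : (ℤ → 𝒯) × M, Submodule ℝ (TangentSpace (𝓡 d) p.2)}
    (hQ : MapsTo (skew T) Q Q) (hcu : IsClosedFamilyOn Prod.snd Ecu Q)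
    {p₀ : (ℤ → 𝒯) × M} (h0 : p₀ ∈ Q) {a : ℝ}
    (ha : restrNorm (T (p₀.1 0)).symm (skew T p₀).2 (Ecu (skew T p₀)) < a) :
    ∀ᶠ p in 𝓝 p₀, p ∈ Q → restrNorm (T (p.1 0)).symm (skew T p).2 (Ecu (skew T p)) < a := by
  have hev : Continuous fun z : ((ℤ → 𝒯) × M) × TangentBundle (𝓡 d) M => (z.1.1 0, z.2) :=
    (((continuous_apply (0 : ℤ)).comp continuous_fst).comp continuous_fst).prodMk continuous_snd
  have hg2 : Continuous fun z : ((ℤ → 𝒯) × M) × TangentBundle (𝓡 d) M =>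
      tangentMap (𝓡 d) (𝓡 d) (T (z.1.1 0)).symm z.2 :=
    Continuous.comp (g := fun z : 𝒯 × TangentBundle (𝓡 d) M => Diff2.tmap (T z.1).symm z.2)
      hT.symm hev
  have hcu' : IsClosedFamilyOn (fun p : (ℤ → 𝒯) × M => (skew T p).2) (fun p => Ecu (skew T p)) Q :=
    hcu.comp (continuous_skew hT).continuousOn hQ
  exact eventually_nhdsWithin_iff.1 (hcu'.eventually_restrNorm_lt
    (g := fun p : (ℤ → 𝒯) × M => (T (p.1 0)).symm)
    (continuous_snd.comp (continuous_skew hT)) hg2 h0 ha)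

/-- Each factor is upper semicontinuous at constant noise; the strict inequality leaves room for
both, and compactness of `M` makes the neighbourhood of the noise independent of `x`. -/
lemma eventually_dominated (hT : IsC1Family T) {w₀ : 𝒯} {Q : Set ((ℤ → 𝒯) × M)}
    {Ecu Ecs : ∀ p : (ℤ → 𝒯) × M, Submodule ℝ (TangentSpace (𝓡 d) p.2)}
    (hQ : MapsTo (skew T) Q Q) (hcu : IsClosedFamilyOn Prod.snd Ecu Q)
    (hcs : IsClosedFamilyOn Prod.snd Ecs Q)
    (h0 : ∀ x : M, (fun _ => w₀, x) ∈ Q)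
    (hdom : ∀ x : M, restrNorm (T w₀) x (Ecs (fun _ => w₀, x)) *
      restrNorm (T w₀).symm (T w₀ x) (Ecu (fun _ => w₀, T w₀ x)) < 1 / 2) :
    ∀ᶠ w : ℤ → 𝒯 in 𝓝 fun _ => w₀, ∀ x ∈ (univ : Set M), (w, x) ∈ Q →
      restrNorm (T (w 0)) x (Ecs (w, x)) *
        restrNorm (T (w 0)).symm (skew T (w, x)).2 (Ecu (skew T (w, x))) < 1 / 2 := by
  refine isCompact_univ.eventually_forall_of_forall_eventually fun x _ => ?_
  obtain ⟨a, b, ha, hb, hab⟩ := exists_mul_lt_of_mul_lt (hdom x)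
  have h1 := eventually_restrNorm_skew_lt hT hcs (h0 x) ha
  have h2 := eventually_restrNorm_skew_symm_lt hT hQ hcu (h0 x) hb
  filter_upwards [h1, h2] with p hp1 hp2 hp
  have h3 : restrNorm (T (p.1 0)) p.2 (Ecs p) < a := hp1 hp
  have h4 : restrNorm (T (p.1 0)).symm (skew T p).2 (Ecu (skew T p)) < b := hp2 hp
  exact lt_of_le_of_lt (mul_le_mul h3.le h4.le (restrNorm_nonneg _ _ _)
    ((restrNorm_nonneg _ _ _).trans h3.le)) hab

end RandomSplitting

/-! ### Existence of random dominated splittings -/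

section Existence

variable {d : ℕ} {M : Type*} [TopologicalSpace M] [T2Space M] [CompactSpace M]
    [ChartedSpace (EuclideanSpace ℝ (Fin d)) M] [IsManifold (𝓡 d) ∞ M]
    [RiemannianBundle (fun x : M => TangentSpace (𝓡 d) x)]
    [IsContMDiffRiemannianBundle (𝓡 d) ∞ (EuclideanSpace ℝ (Fin d))
      (fun x : M => TangentSpace (𝓡 d) x)]
    {𝒯 : Type*} [MetricSpace 𝒯]

/-- Dominated splittings persist under random perturbations. -/
theorem exists_randomDominatedSplitting {f : Diff2 d M}
    {Ecu₀ Ecs₀ : ∀ x : M, Submodule ℝ (TangentSpace (𝓡 d) x)}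
    (hf : IsDominatedSplitting f Ecu₀ Ecs₀) {T : 𝒯 → Diff2 d M} {w₀ : 𝒯} (hT : IsC1Family T)
    (hw₀ : T w₀ = f) :
    ∃ W ∈ 𝓝 w₀, ∀ Ω : Set (ℤ → 𝒯), (∀ w ∈ Ω, ∀ k, w k ∈ W) →
      ∃ Ecu Ecs : ∀ p : (ℤ → 𝒯) × M, Submodule ℝ (TangentSpace (𝓡 d) p.2),
        IsRandomDominatedSplitting T w₀ Ecu₀ Ecs₀ Ω Ecu Ecs := by
  subst hw₀
  obtain ⟨W₁, hW₁, E₁, hE₁c, hE₁m, hE₁0, hE₁i, hE₁n⟩ := hf.isInvariantSplitting.exists_stable_family hT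
  obtain ⟨W₂, hW₂, E₂, hE₂c, hE₂m, hE₂0, hE₂i, hE₂n⟩ :=
    IsInvariantSplitting.exists_stable_family (T := fun w => (T w).symm) (w₀ := w₀) hT.symm
      hf.isInvariantSplitting_symm
  set Q := noiseDomain M (W₁ ∩ W₂) with hQdef
  have hQ₁ : Q ⊆ noiseDomain M W₁ := noiseDomain_mono inter_subset_left
  have hQ₂ : Q ⊆ noiseDomain M W₂ := noiseDomain_mono inter_subset_right
  have hcs : IsContinuousFamilyOn Prod.snd E₁ Q := hE₁c.mono hQ₁
  have hcu : IsContinuousFamilyOn Prod.snd (fun p => E₂ (reflect p)) Q :=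
    hE₂c.comp continuous_reflect fun p hp => reflect_mem_noiseDomain (hQ₂ hp)
  have h0 : ∀ x : M, (fun _ => w₀, x) ∈ Q := fun x k =>
    ⟨mem_of_mem_nhds hW₁, mem_of_mem_nhds hW₂⟩
  have hdom := eventually_dominated (w₀ := w₀) hT
    (fun p hp => skew_mem_noiseDomain hp : MapsTo (skew T) Q Q)
    (hcu.isClosedFamilyOn continuous_snd) (hcs.isClosedFamilyOn continuous_snd) h0 (fun x => by
      have h1 := hf.dominated x
      rw [← hE₁0 x, ← hE₂0 (T w₀ x)] at h1
      exact h1)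
  obtain ⟨W₃, hW₃, hW₃dom⟩ := exists_forall_mem_of_mem_nhds_const hdom
  refine ⟨W₁ ∩ W₂ ∩ W₃, inter_mem (inter_mem hW₁ hW₂) hW₃, fun Ω hΩ =>
    ⟨fun p => E₂ (reflect p), E₁, ?_⟩⟩
  have hΩQ : Ω ×ˢ (univ : Set M) ⊆ Q := fun p hp k => (hΩ p.1 hp.1 k).1
  refine ⟨hcu.mono hΩQ, hcs.mono hΩQ, ?_, ?_, ?_, ?_, ?_, ?_⟩
  · intro p hp
    exact isCompl_of_cones (hf.isCompl p.2).symm (hE₁i p (hQ₁ (hΩQ hp)))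
      (hE₂i (reflect p) (reflect_mem_noiseDomain (hQ₂ (hΩQ hp)))) (hE₁n p (hQ₁ (hΩQ hp)))
      (hE₂n (reflect p) (reflect_mem_noiseDomain (hQ₂ (hΩQ hp))))
  · exact fun p hp => map_reflect_eq hE₂m (hQ₂ (hΩQ hp))
  · exact fun p hp => hE₁m p (hQ₁ (hΩQ hp))
  · exact fun p hp => hW₃dom p.1 (fun k => (hΩ p.1 hp.1 k).2) p.2 (mem_univ _) (hΩQ hp)
  · exact hE₂0
  · exact hE₁0

end Existence

/-! ### Prepending an independent term to an i.i.d. sequence -/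

section Cons

variable {𝒯 : Type*} [MeasurableSpace 𝒯]

/-- Prepending a term to a sequence. -/
def seqCons (z : 𝒯 × (ℕ → 𝒯)) : ℕ → 𝒯
  | 0 => z.1
  | k + 1 => z.2 k

lemma measurable_seqCons : Measurable (seqCons (𝒯 := 𝒯)) := by
  refine measurable_pi_iff.2 fun k => ?_
  cases k with
  | zero => exact measurable_fst
  | succ k => exact (measurable_pi_apply k).comp measurable_snd

/-- An i.i.d. sequence is an i.i.d. sequence preceded by an independent term of the same law. -/
lemma map_seqCons_infinitePi (θ : Measure 𝒯) [IsProbabilityMeasure θ] :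
    (θ.prod (Measure.infinitePi fun _ : ℕ => θ)).map seqCons = Measure.infinitePi fun _ : ℕ => θ := by
  refine Measure.eq_infinitePi _ fun s t ht => ?_
  rw [Measure.map_apply measurable_seqCons (.pi s.countable_toSet fun _ _ => ht _)]
  have hinj : InjOn Nat.succ (Nat.succ ⁻¹' (s : Set ℕ)) := Nat.succ_injective.injOn
  have hset : seqCons ⁻¹' ((s : Set ℕ).pi t) =
      (if 0 ∈ s then t 0 else univ) ×ˢ
        (((s.preimage Nat.succ hinj : Finset ℕ) : Set ℕ).pi fun k => t (k + 1)) := by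
    ext z
    simp only [mem_preimage, Set.mem_pi, Finset.mem_coe, mem_prod, Finset.mem_preimage]
    constructor
    · intro h
      refine ⟨?_, fun k hk => h (k + 1) hk⟩
      split_ifs with h0
      · exact h 0 h0
      · trivial
    · rintro ⟨h1, h2⟩ k hk
      cases k with
      | zero =>
        change z.1 ∈ t 0
        simpa [hk] using h1
      | succ k => exact h2 k hk
  rw [hset, Measure.prod_prod, Measure.infinitePi_pi _ fun k _ => ht (k + 1)]
  have hprod : ∏ k ∈ s.preimage Nat.succ hinj, θ (t (k + 1)) = ∏ k ∈ s.erase 0, θ (t k) := by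
    refine Finset.prod_bij (fun k _ => k + 1) ?_ ?_ ?_ ?_
    · intro k hk
      simpa using hk
    · intro a _ b _ h
      exact Nat.succ_injective h
    · intro b hb
      obtain ⟨hb0, hb⟩ := Finset.mem_erase.1 hb
      obtain ⟨k, rfl⟩ := Nat.exists_eq_succ_of_ne_zero hb0
      exact ⟨k, by simpa using hb, rfl⟩
    · intro a _
      rfl
  rw [hprod]
  split_ifs with h0
  · exact Finset.mul_prod_erase s (fun k => θ (t k)) h0
  · rw [measure_univ, one_mul, Finset.erase_eq_of_notMem h0]

end Cons

/-! ### The one-sided skew product and determination by the future -/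

section Lift

variable {d : ℕ} {M : Type*} [TopologicalSpace M]
    [ChartedSpace (EuclideanSpace ℝ (Fin d)) M] [MeasurableSpace M] {𝒯 : Type*}

/-- The one-sided skew product. -/
def oneSidedSkew (T : 𝒯 → Diff2 d M) (p : (ℕ → 𝒯) × M) : (ℕ → 𝒯) × M :=
  (fun k => p.1 (k + 1), T (p.1 0) p.2)

/-- Forgetting the past. -/
def forgetPast (p : (ℤ → 𝒯) × M) : (ℕ → 𝒯) × M := (fun k : ℕ => p.1 k, p.2)

lemma forgetPast_skew (T : 𝒯 → Diff2 d M) (p : (ℤ → 𝒯) × M) :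
    forgetPast (skew T p) = oneSidedSkew T (forgetPast p) := rfl

variable [MeasurableSpace 𝒯]

lemma measurable_forgetPast : Measurable (forgetPast (𝒯 := 𝒯) (M := M)) := by
  refine Measurable.prodMk (measurable_pi_iff.2 fun k => ?_) measurable_snd
  exact (measurable_pi_apply (k : ℤ)).comp measurable_fst

variable {T : 𝒯 → Diff2 d M}

lemma measurable_oneSidedSkew (hT : Measurable fun z : 𝒯 × M => T z.1 z.2) :
    Measurable (oneSidedSkew T) :=
  (measurable_pi_iff.2 fun k => (measurable_pi_apply (k + 1)).comp measurable_fst).prodMk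
    (Measurable.comp (g := fun z : 𝒯 × M => T z.1 z.2)
      (f := fun p : (ℕ → 𝒯) × M => (p.1 0, p.2)) hT
      (((measurable_pi_apply 0).comp measurable_fst).prodMk measurable_snd))

lemma measurable_skew (hT : Measurable fun z : 𝒯 × M => T z.1 z.2) :
    Measurable (skew T) :=
  (measurable_pi_iff.2 fun k => (measurable_pi_apply (k + 1)).comp measurable_fst).prodMk
    (Measurable.comp (g := fun z : 𝒯 × M => T z.1 z.2)
      (f := fun p : (ℤ → 𝒯) × M => (p.1 0, p.2)) hT
      (((measurable_pi_apply 0).comp measurable_fst).prodMk measurable_snd))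

lemma measurable_skew_symm (hT : Measurable fun z : 𝒯 × M => (T z.1).symm z.2) :
    Measurable (skew T).symm :=
  (measurable_pi_iff.2 fun k => (measurable_pi_apply (k - 1)).comp measurable_fst).prodMk
    (Measurable.comp (g := fun z : 𝒯 × M => (T z.1).symm z.2)
      (f := fun p : (ℤ → 𝒯) × M => (p.1 (-1), p.2)) hT
      (((measurable_pi_apply (-1)).comp measurable_fst).prodMk measurable_snd))

/-- The product of the law of the noise with a stationary measure is invariant under the one-sided
skew product. -/
lemma IsStationaryMeasure.map_oneSidedSkew {θ : Measure 𝒯} [IsProbabilityMeasure θ]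
    {μ : Measure M} [IsProbabilityMeasure μ] (h : IsStationaryMeasure T θ μ)
    (hT : Measurable fun z : 𝒯 × M => T z.1 z.2) :
    ((Measure.infinitePi fun _ : ℕ => θ).prod μ).map (oneSidedSkew T) =
      (Measure.infinitePi fun _ : ℕ => θ).prod μ := by
  refine (Measure.prod_eq fun A B hA hB => ?_).symm
  have h1 : (Measure.infinitePi fun _ : ℕ => θ).prod μ =
      ((θ.prod (Measure.infinitePi fun _ : ℕ => θ)).prod μ).map (Prod.map seqCons id) := by
    rw [← Measure.map_prod_map _ _ measurable_seqCons measurable_id, map_seqCons_infinitePi,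
      Measure.map_id]
  have hcons : Measurable (Prod.map (seqCons (𝒯 := 𝒯)) (id : M → M)) :=
    measurable_seqCons.prodMap measurable_id
  rw [Measure.map_apply (measurable_oneSidedSkew hT) (hA.prod hB)]
  conv_lhs => rw [h1]
  rw [Measure.map_apply hcons (measurable_oneSidedSkew hT (hA.prod hB)),
    Measure.prod_apply (hcons (measurable_oneSidedSkew hT (hA.prod hB)))]
  -- With the first noise term split off, the preimage constrains the tail and the image point
  -- separately. The integral factors, and stationarity evaluates the second factor.
  have h2 : ∀ z : 𝒯 × (ℕ → 𝒯),
      μ (Prod.mk z ⁻¹' (Prod.map seqCons id ⁻¹' (oneSidedSkew T ⁻¹' (A ×ˢ B)))) =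
        μ (T z.1 ⁻¹' B) * A.indicator 1 z.2 := by
    intro z
    by_cases hz : z.2 ∈ A
    · rw [indicator_of_mem hz, Pi.one_apply, mul_one]
      congr 1
      ext x
      exact and_iff_right hz
    · rw [indicator_of_notMem hz, mul_zero]
      convert measure_empty (μ := μ)
      ext x
      simp only [mem_empty_iff_false, iff_false]
      exact fun hx => hz hx.1
  rw [lintegral_congr h2, lintegral_prod_mul
    (f := fun w => μ (T w ⁻¹' B)) (g := fun v => A.indicator 1 v)
    (measurable_measure_prodMk_left (hT hB)).aemeasurable
    ((measurable_one.indicator hA).aemeasurable), h B hB, lintegral_indicator_one hA, mul_comm]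

/-- A probability measure on `𝒯^ℤ × M` is determined by the images of its translates under
`forgetPast`. -/
lemma ext_of_map_forgetPast_iterate (hT : Measurable fun z : 𝒯 × M => T z.1 z.2)
    (hT' : Measurable fun z : 𝒯 × M => (T z.1).symm z.2)
    {m m' : Measure ((ℤ → 𝒯) × M)} [IsProbabilityMeasure m] [IsProbabilityMeasure m']
    (h : ∀ j : ℕ, m.map (fun p => forgetPast ((skew T).symm^[j] p)) =
      m'.map (fun p => forgetPast ((skew T).symm^[j] p))) : m = m' := by
  have hG : ∀ j : ℕ, Measurable fun p => forgetPast ((skew T).symm^[j] p) := fun j =>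
    measurable_forgetPast.comp ((measurable_skew_symm hT').iterate j)
  have hstep : ∀ j : ℕ, ∀ p, forgetPast ((skew T).symm^[j] p) =
      oneSidedSkew T (forgetPast ((skew T).symm^[j + 1] p)) := by
    intro j p
    rw [← forgetPast_skew, Function.iterate_succ_apply', Equiv.apply_symm_apply]
  -- Starting further in the past only adds information, so two such events can be written at a
  -- common past time. This makes `C` below a π-system.
  have hlift : ∀ k j : ℕ, ∀ A : Set ((ℕ → 𝒯) × M), MeasurableSet A →
      ∃ A' : Set ((ℕ → 𝒯) × M), MeasurableSet A' ∧
        (fun p => forgetPast ((skew T).symm^[j] p)) ⁻¹' A =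
          (fun p => forgetPast ((skew T).symm^[j + k] p)) ⁻¹' A' := by
    intro k
    induction k with
    | zero => exact fun j A hA => ⟨A, hA, rfl⟩
    | succ k ih =>
      intro j A hA
      obtain ⟨A', hA', h'⟩ := ih j A hA
      refine ⟨_, measurable_oneSidedSkew hT hA', h'.trans ?_⟩
      ext p
      rw [mem_preimage, hstep]
      rfl
  have hcoord : ∀ (j : ℕ) (p : (ℤ → 𝒯) × M) (k : ℤ), ((skew T).symm^[j] p).1 k = p.1 (k - j) := by
    intro j
    induction j with
    | zero => intro p k; simp
    | succ j ih =>
      intro p k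
      rw [Function.iterate_succ_apply']
      refine (ih p (k - 1)).trans (congrArg p.1 ?_)
      push_cast
      ring
  set C : Set (Set ((ℤ → 𝒯) × M)) := {S | ∃ (j : ℕ) (A : Set ((ℕ → 𝒯) × M)), MeasurableSet A ∧
    (fun p => forgetPast ((skew T).symm^[j] p)) ⁻¹' A = S} with hC
  refine ext_of_generate_finite C ?_ ?_ ?_ (by simp)
  · apply le_antisymm
    · have hfst : ∀ k : ℤ, Measurable[MeasurableSpace.generateFrom C]
          fun p : (ℤ → 𝒯) × M => p.1 k := by
        intro k A hA
        -- Going back `|k|` steps turns coordinate `k` into coordinate `k + |k| ≥ 0`, which the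
        -- one-sided sequence sees.
        refine MeasurableSpace.measurableSet_generateFrom ⟨k.natAbs, {q | q.1 (k + k.natAbs).toNat ∈ A},
          ((measurable_pi_apply _).comp measurable_fst) hA, ?_⟩
        ext p
        change ((skew T).symm^[k.natAbs] p).1 ((k + k.natAbs).toNat : ℤ) ∈ A ↔ p.1 k ∈ A
        rw [hcoord]
        have : ((k + k.natAbs).toNat : ℤ) - k.natAbs = k := by omega
        rw [this]
      have hsnd : Measurable[MeasurableSpace.generateFrom C] fun p : (ℤ → 𝒯) × M => p.2 := by
        intro A hA
        exact MeasurableSpace.measurableSet_generateFrom ⟨0, {q | q.2 ∈ A}, measurable_snd hA, rfl⟩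
      have hid : Measurable[MeasurableSpace.generateFrom C] fun p : (ℤ → 𝒯) × M => (p.1, p.2) :=
        Measurable.prodMk (@measurable_pi_lambda _ _ _ (MeasurableSpace.generateFrom C) _ _ hfst) hsnd
      exact fun S hS => hid hS
    · refine MeasurableSpace.generateFrom_le ?_
      rintro _ ⟨j, A, hA, rfl⟩
      exact hG j hA
  · rintro _ ⟨j, A, hA, rfl⟩ _ ⟨k, B, hB, rfl⟩ -
    obtain ⟨A', hA', hA''⟩ := hlift k j A hA
    obtain ⟨B', hB', hB''⟩ := hlift j k B hB
    refine ⟨j + k, A' ∩ B', hA'.inter hB', ?_⟩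
    rw [hA'', hB'', add_comm k j]
    rfl
  · rintro _ ⟨j, A, hA, rfl⟩
    rw [← Measure.map_apply (hG j) hA, ← Measure.map_apply (hG j) hA, h j]

end Lift

/-! ### Existence of the lift -/

section LiftExistence

variable {d : ℕ} {M : Type*} [TopologicalSpace M]
    [ChartedSpace (EuclideanSpace ℝ (Fin d)) M] {𝒯 : Type*} [TopologicalSpace 𝒯]
    {T : 𝒯 → Diff2 d M}

lemma continuous_skew_of_continuous (hT : Continuous fun z : 𝒯 × M => T z.1 z.2) :
    Continuous (skew T) :=
  ((continuous_pi fun k => continuous_apply (k + 1)).comp continuous_fst).prodMk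
    (Continuous.comp (g := fun z : 𝒯 × M => T z.1 z.2)
      (f := fun z : (ℤ → 𝒯) × M => (z.1 0, z.2)) hT
      (((continuous_apply 0).comp continuous_fst).prodMk continuous_snd))

lemma continuous_skew_symm_of_continuous (hT : Continuous fun z : 𝒯 × M => (T z.1).symm z.2) :
    Continuous (skew T).symm :=
  ((continuous_pi fun k => continuous_apply (k - 1)).comp continuous_fst).prodMk
    (Continuous.comp (g := fun z : 𝒯 × M => (T z.1).symm z.2)
      (f := fun z : (ℤ → 𝒯) × M => (z.1 (-1), z.2)) hT
      (((continuous_apply (-1)).comp continuous_fst).prodMk continuous_snd))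

lemma continuous_forgetPast : Continuous (forgetPast (𝒯 := 𝒯) (M := M)) := by
  refine Continuous.prodMk (continuous_pi fun k => ?_) continuous_snd
  exact (continuous_apply (k : ℤ)).comp continuous_fst

end LiftExistence

section LiftCompact

variable {d : ℕ} {M : Type*} [TopologicalSpace M] [T2Space M] [CompactSpace M]
    [ChartedSpace (EuclideanSpace ℝ (Fin d)) M] [MeasurableSpace M] [BorelSpace M]
    {K : Type*} [MetricSpace K] [CompactSpace K] [MeasurableSpace K] [BorelSpace K]
    {T : K → Diff2 d M}

/-- Existence of the lift of a stationary measure for a compact space of maps. -/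
lemma IsStationaryMeasure.exists_isLift_of_compactSpace
    (hT : Continuous fun z : K × M => T z.1 z.2)
    (hT' : Continuous fun z : K × M => (T z.1).symm z.2)
    {θ : Measure K} [IsProbabilityMeasure θ] {μ : Measure M} [IsProbabilityMeasure μ]
    (h : IsStationaryMeasure T θ μ) :
    ∃ m : Measure ((ℤ → K) × M), IsProbabilityMeasure m ∧ IsLift T θ μ m := by
  have : SecondCountableTopology M :=
    ChartedSpace.secondCountable_of_sigmaCompact (EuclideanSpace ℝ (Fin d)) M
  have : TopologicalSpace.MetrizableSpace M := Manifold.metrizableSpace (𝓡 d) M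
  have hTm : Measurable fun z : K × M => T z.1 z.2 := hT.measurable
  have hTm' : Measurable fun z : K × M => (T z.1).symm z.2 := hT'.measurable
  have hsk := continuous_skew_of_continuous hT
  have hsk' := continuous_skew_symm_of_continuous hT'
  set ν : Measure ((ℕ → K) × M) := (Measure.infinitePi fun _ : ℕ => θ).prod μ with hν
  let ν' : ProbabilityMeasure ((ℕ → K) × M) := ⟨ν, by rw [hν]; infer_instance⟩
  let m₀ : ProbabilityMeasure ((ℤ → K) × M) :=
    ⟨(Measure.infinitePi fun _ : ℤ => θ).prod μ, inferInstance⟩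
  -- After `n` steps the law seen from any past time `-j` with `j ≤ n` is already `ν`, by one-sided
  -- invariance. In the limit this holds for every `j`.
  let m : ℕ → ProbabilityMeasure ((ℤ → K) × M) := fun n =>
    m₀.map (hsk.iterate n).measurable.aemeasurable
  have hforget : ∀ n j : ℕ, j ≤ n →
      (m n).map (continuous_forgetPast.comp (hsk'.iterate j)).measurable.aemeasurable = ν' := by
    intro n j hj
    obtain ⟨k, rfl⟩ := Nat.exists_eq_add_of_le hj
    apply Subtype.ext
    change ((m₀ : Measure _).map (skew T)^[j + k]).map (forgetPast ∘ (skew T).symm^[j]) = ν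
    rw [Measure.map_map (measurable_forgetPast.comp (hsk'.iterate j).measurable)
      (hsk.iterate _).measurable]
    have h1 : (forgetPast ∘ (skew T).symm^[j]) ∘ (skew T)^[j + k] =
        (oneSidedSkew T)^[k] ∘ forgetPast := by
      funext p
      have h2 : (skew T).symm^[j] ((skew T)^[j + k] p) = (skew T)^[k] p := by
        rw [Function.iterate_add_apply]
        exact (Function.LeftInverse.iterate (skew T).symm_apply_apply j) _
      have h3 : Function.Semiconj (forgetPast (𝒯 := K) (M := M)) (skew T) (oneSidedSkew T) :=
        fun p => forgetPast_skew T p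
      simp only [Function.comp_apply, h2]
      exact (h3.iterate_right k) p
    rw [h1, ← Measure.map_map ((measurable_oneSidedSkew hTm).iterate k) measurable_forgetPast]
    have h4 : (m₀ : Measure _).map forgetPast = ν := by
      change ((Measure.infinitePi fun _ : ℤ => θ).prod μ).map
        (Prod.map (fun (v : ℤ → K) (k : ℕ) => v k) (id : M → M)) = ν
      rw [← Measure.map_prod_map _ _
        (measurable_pi_iff.2 fun k : ℕ => measurable_pi_apply (k : ℤ)) measurable_id,
        Measure.map_infinitePi_infinitePi_of_inj (f := fun k : ℕ => (k : ℤ))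
          Nat.cast_injective, Measure.map_id]
    rw [h4]
    have h5 : MeasurePreserving (oneSidedSkew T) ν ν :=
      ⟨measurable_oneSidedSkew hTm, h.map_oneSidedSkew hTm⟩
    exact (h5.iterate k).map_eq
  obtain ⟨mlim, -, hmlim⟩ := isCompact_univ.ultrafilter_le_nhds ((hyperfilter ℕ).map m) (by simp)
  have hmlim' : Tendsto m (hyperfilter ℕ : Filter ℕ) (𝓝 mlim) := hmlim
  have hproj : ∀ j : ℕ, (mlim : Measure _).map (forgetPast ∘ (skew T).symm^[j]) = ν := by
    intro j
    have h1 := ((ProbabilityMeasure.continuous_map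
      (continuous_forgetPast.comp (hsk'.iterate j))).tendsto mlim).comp hmlim'
    have h2 : ∀ᶠ n in (hyperfilter ℕ : Filter ℕ), j ≤ n :=
      (Nat.hyperfilter_le_atTop) (eventually_ge_atTop j)
    have h3 := tendsto_nhds_unique h1
      (tendsto_const_nhds.congr' (h2.mono fun n hn => (hforget n j hn).symm))
    exact congrArg ProbabilityMeasure.toMeasure h3
  refine ⟨mlim, inferInstance, ⟨hsk.measurable, ?_⟩, hproj 0⟩
  have : IsProbabilityMeasure ((mlim : Measure _).map (skew T)) :=
    Measure.isProbabilityMeasure_map hsk.measurable.aemeasurable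
  refine ext_of_map_forgetPast_iterate hTm hTm' fun j => ?_
  refine Eq.trans ?_ (hproj j).symm
  refine (Measure.map_map (measurable_forgetPast.comp (hsk'.iterate j).measurable)
    hsk.measurable).trans ?_
  -- The future from time 0 needs one-sided invariance of `ν`; for `j + 1` one inverse step cancels
  -- against `skew T`.
  cases j with
  | zero =>
    change (mlim : Measure _).map (forgetPast ∘ skew T) = ν
    have h1 : forgetPast ∘ skew T = oneSidedSkew T ∘ forgetPast :=
      rfl
    rw [h1, ← Measure.map_map (measurable_oneSidedSkew hTm) measurable_forgetPast]
    exact (congrArg (Measure.map (oneSidedSkew T)) (hproj 0)).trans (h.map_oneSidedSkew hTm)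
  | succ j =>
    have h1 : (forgetPast ∘ (skew T).symm^[j + 1]) ∘ skew T =
        forgetPast ∘ (skew T).symm^[j] := by
      funext p
      simp
    rw [h1, hproj j]

end LiftCompact

section Lift

variable {d : ℕ} {M : Type*} [TopologicalSpace M] [T2Space M] [CompactSpace M]
    [ChartedSpace (EuclideanSpace ℝ (Fin d)) M] [MeasurableSpace M] [BorelSpace M]
    {𝒯 : Type*} [MetricSpace 𝒯] [MeasurableSpace 𝒯] [BorelSpace 𝒯]
    {T : 𝒯 → Diff2 d M}

/-- Existence of the lift of a stationary measure when the noise is carried by a compact set. -/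
lemma IsStationaryMeasure.exists_isLift
    (hT : Continuous fun z : 𝒯 × M => T z.1 z.2)
    (hT' : Continuous fun z : 𝒯 × M => (T z.1).symm z.2)
    {θ : Measure 𝒯} [IsProbabilityMeasure θ] {μ : Measure M} [IsProbabilityMeasure μ]
    {K : Set 𝒯} (hK : IsCompact K) (hθK : θ Kᶜ = 0) (h : IsStationaryMeasure T θ μ) :
    ∃ m : Measure ((ℤ → 𝒯) × M), IsLift T θ μ m := by
  have : SecondCountableTopology M :=
    ChartedSpace.secondCountable_of_sigmaCompact (EuclideanSpace ℝ (Fin d)) M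
  have : CompactSpace K := isCompact_iff_compactSpace.1 hK
  have hval : Continuous fun z : K × M => ((z.1 : 𝒯), z.2) :=
    (continuous_subtype_val.comp continuous_fst).prodMk continuous_snd
  have hemb : MeasurableEmbedding (Subtype.val : K → 𝒯) :=
    MeasurableEmbedding.subtype_coe hK.measurableSet
  -- The noise is restricted to its compact carrier, where the lift is known, and the result is
  -- pushed forward.
  set θK : Measure K := θ.comap Subtype.val with hθKdef
  have hmap : θK.map Subtype.val = θ := by
    rw [hθKdef, hemb.map_comap, Subtype.range_coe]
    exact Measure.restrict_eq_self_of_ae_mem (measure_eq_zero_iff_ae_notMem.1 hθK |>.mono fun w hw => not_not.1 hw)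
  have : IsProbabilityMeasure θK := by
    constructor
    rw [← preimage_univ (f := (Subtype.val : K → 𝒯)), ← hemb.map_apply, hmap, measure_univ]
  have hstat : IsStationaryMeasure (fun w : K => T w) θK μ := by
    intro A hA
    rw [← h A hA]
    conv_rhs => rw [← hmap]
    rw [hemb.lintegral_map]
  have hTK : Continuous fun z : K × M => T z.1 z.2 :=
    Continuous.comp (g := fun z : 𝒯 × M => T z.1 z.2) (f := fun z : K × M => ((z.1 : 𝒯), z.2))
      hT hval
  have hTK' : Continuous fun z : K × M => (T z.1).symm z.2 :=
    Continuous.comp (g := fun z : 𝒯 × M => (T z.1).symm z.2)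
      (f := fun z : K × M => ((z.1 : 𝒯), z.2)) hT' hval
  obtain ⟨m, hm, hmF, hmP⟩ :=
    IsStationaryMeasure.exists_isLift_of_compactSpace (T := fun w : K => T w) hTK hTK' hstat
  set ι : (ℤ → K) × M → (ℤ → 𝒯) × M := fun p => (fun k => p.1 k, p.2) with hι
  have hιm : Measurable ι := by
    refine Measurable.prodMk (measurable_pi_iff.2 fun k => ?_) measurable_snd
    exact measurable_subtype_coe.comp ((measurable_pi_apply k).comp measurable_fst)
  have hsk := measurable_skew hT.measurable
  refine ⟨m.map ι, ⟨hsk, ?_⟩, ?_⟩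
  · rw [Measure.map_map hsk hιm]
    have h1 : skew T ∘ ι = ι ∘ skew (fun w : K => T w) := rfl
    rw [h1, ← Measure.map_map hιm hmF.measurable, hmF.map_eq]
  · change (m.map ι).map forgetPast = _
    rw [Measure.map_map measurable_forgetPast hιm]
    have hpi : Measurable fun (v : ℕ → K) (k : ℕ) => (v k : 𝒯) :=
      measurable_pi_iff.2 fun k => measurable_subtype_coe.comp (measurable_pi_apply k)
    have h1 : forgetPast ∘ ι = Prod.map (fun (v : ℕ → K) (k : ℕ) => (v k : 𝒯)) (id : M → M) ∘
        forgetPast := rfl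
    rw [h1, ← Measure.map_map (hpi.prodMap measurable_id) measurable_forgetPast]
    refine (congrArg (Measure.map _) hmP).trans ?_
    rw [← Measure.map_prod_map _ _ hpi measurable_id, Measure.map_id,
      Measure.infinitePi_map_pi (μ := fun _ : ℕ => θK) (f := fun _ => (Subtype.val : K → 𝒯))
        (fun _ => measurable_subtype_coe), hmap]

end Lift

/-! ### A maximal ergodic inequality for visits to a set -/

section MaximalErgodic

open scoped ENNReal

variable {Y : Type*}

/-- The largest excess, over at most `n` steps, of the time spent in `H` (counted with weight `c`)
over the time spent outside `H` (counted with weight `b`). -/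
def visitExcess (F : Y → Y) (H : Set Y) (b c : ℝ≥0∞) : ℕ → Y → ℝ≥0∞
  | 0 => 0
  | n + 1 => fun y => H.indicator (fun _ => c) y + visitExcess F H b c n (F y) -
      Hᶜ.indicator (fun _ => b) y

variable {F : Y → Y} {H : Set Y} {b c : ℝ≥0∞}

lemma visitExcess_le_succ (n : ℕ) (y : Y) :
    visitExcess F H b c n y ≤ visitExcess F H b c (n + 1) y := by
  induction n generalizing y with
  | zero => exact zero_le
  | succ n ih => exact tsub_le_tsub_right (add_le_add_right (ih (F y)) _) _

lemma visitExcess_le (n : ℕ) (y : Y) : visitExcess F H b c n y ≤ n * c := by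
  induction n generalizing y with
  | zero => simp [visitExcess]
  | succ n ih =>
    refine tsub_le_self.trans ?_
    push_cast
    rw [add_mul, one_mul, add_comm]
    exact add_le_add (ih _) (indicator_le_self' (fun _ _ => zero_le) y)

/-- Truncated subtraction only enlarges the excess, so a vanishing excess certifies the comparison
of the two weighted visit counts. -/
lemma sum_indicator_le_add_visitExcess (n : ℕ) (y : Y) :
    ∑ i ∈ Finset.range n, H.indicator (fun _ => c) (F^[i] y) ≤
      ∑ i ∈ Finset.range n, Hᶜ.indicator (fun _ => b) (F^[i] y) + visitExcess F H b c n y := by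
  induction n generalizing y with
  | zero => simp
  | succ n ih =>
    rw [Finset.sum_range_succ', Finset.sum_range_succ']
    simp only [Function.iterate_succ_apply, Function.iterate_zero, id_eq]
    have h1 : H.indicator (fun _ => c) y + visitExcess F H b c n (F y) ≤
      visitExcess F H b c (n + 1) y + Hᶜ.indicator (fun _ => b) y := le_tsub_add
    calc _ ≤ ∑ i ∈ Finset.range n, Hᶜ.indicator (fun _ => b) (F^[i] (F y)) +
          visitExcess F H b c n (F y) + H.indicator (fun _ => c) y := by gcongr; exact ih (F y)
      _ = ∑ i ∈ Finset.range n, Hᶜ.indicator (fun _ => b) (F^[i] (F y)) +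
          (H.indicator (fun _ => c) y + visitExcess F H b c n (F y)) := by ring
      _ ≤ ∑ i ∈ Finset.range n, Hᶜ.indicator (fun _ => b) (F^[i] (F y)) +
          (visitExcess F H b c (n + 1) y + Hᶜ.indicator (fun _ => b) y) := by gcongr
      _ = _ := by ring

variable [MeasurableSpace Y] {m : Measure Y}

lemma measurable_visitExcess (hF : Measurable F) (hH : MeasurableSet H) (n : ℕ) :
    Measurable (visitExcess F H b c n) := by
  induction n with
  | zero => exact measurable_const
  | succ n ih =>
    exact ((measurable_const.indicator hH).add (ih.comp hF)).sub
      (measurable_const.indicator hH.compl)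

/-- The maximal ergodic inequality for the visits to a set. -/
lemma MeasureTheory.MeasurePreserving.mul_measure_visitExcess_le [IsFiniteMeasure m]
    (hF : MeasurePreserving F m m) (hH : MeasurableSet H) (hc : c ≠ ⊤) (n : ℕ) :
    b * m {y | visitExcess F H b c n y ≠ 0} ≤ (c + b) * m H := by
  cases n with
  | zero => simp [visitExcess]
  | succ n =>
  set g := visitExcess F H b c (n + 1) with hg
  have hgm : Measurable g := measurable_visitExcess hF.measurable hH _
  set E := {y | g y ≠ 0} with hE
  have hEm : MeasurableSet E := hgm (measurableSet_singleton 0).compl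
  -- On `E` the subtraction is not truncated. Integrated, this becomes the inequality sought,
  -- because `g` and `g ∘ F` have the same finite integral.
  have h1 : ∀ y ∈ E, g y + Hᶜ.indicator (fun _ => b) y ≤ H.indicator (fun _ => c) y + g (F y) := by
    intro y hy
    have h2 : Hᶜ.indicator (fun _ => b) y ≤
        H.indicator (fun _ => c) y + visitExcess F H b c n (F y) := by
      by_contra hlt
      exact hy (tsub_eq_zero_of_le (not_le.1 hlt).le)
    calc g y + Hᶜ.indicator (fun _ => b) y
        = H.indicator (fun _ => c) y + visitExcess F H b c n (F y) := tsub_add_cancel_of_le h2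
      _ ≤ _ := add_le_add_right (visitExcess_le_succ n (F y)) _
  have hgE : ∫⁻ y in E, g y ∂m = ∫⁻ y, g y ∂m :=
    setLIntegral_eq_of_support_subset (fun y hy => hy)
  have hfin : ∫⁻ y, g y ∂m ≠ ⊤ := by
    refine ((lintegral_mono fun y => visitExcess_le (n + 1) y).trans_lt ?_).ne
    rw [lintegral_const]
    exact ENNReal.mul_lt_top (ENNReal.mul_lt_top (by simp) hc.lt_top) (measure_lt_top _ _)
  have h3 : ∫⁻ y, g y ∂m + b * m (Hᶜ ∩ E) ≤ ∫⁻ y, g y ∂m + c * m H := by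
    calc ∫⁻ y, g y ∂m + b * m (Hᶜ ∩ E)
        = ∫⁻ y in E, (g y + Hᶜ.indicator (fun _ => b) y) ∂m := by
          rw [lintegral_add_left hgm, hgE, lintegral_indicator_const hH.compl,
            Measure.restrict_apply hH.compl]
      _ ≤ ∫⁻ y in E, (H.indicator (fun _ => c) y + g (F y)) ∂m :=
          setLIntegral_mono' hEm h1
      _ ≤ ∫⁻ y, (H.indicator (fun _ => c) y + g (F y)) ∂m := setLIntegral_le_lintegral _ _
      _ = _ := by
          rw [lintegral_add_left (measurable_const.indicator hH), lintegral_indicator_const hH,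
            hF.lintegral_comp hgm, add_comm]
  have h4 : b * m (Hᶜ ∩ E) ≤ c * m H := (ENNReal.add_le_add_iff_left hfin).1 h3
  calc b * m E ≤ b * (m (Hᶜ ∩ E) + m H) := by
        gcongr
        refine (measure_mono fun y hy => ?_).trans (measure_union_le _ _)
        by_cases hyH : y ∈ H
        · exact Or.inr hyH
        · exact Or.inl ⟨hyH, hy⟩
    _ = b * m (Hᶜ ∩ E) + b * m H := mul_add _ _ _
    _ ≤ c * m H + b * m H := by gcongr
    _ = (c + b) * m H := (add_mul _ _ _).symm

lemma MeasureTheory.MeasurePreserving.mul_measure_exists_sum_lt_le [IsFiniteMeasure m]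
    (hF : MeasurePreserving F m m) (hH : MeasurableSet H) (hc : c ≠ ⊤) :
    b * m {y | ∃ n, ∑ i ∈ Finset.range n, Hᶜ.indicator (fun _ => b) (F^[i] y) <
      ∑ i ∈ Finset.range n, H.indicator (fun _ => c) (F^[i] y)} ≤ (c + b) * m H := by
  have h1 : {y | ∃ n, ∑ i ∈ Finset.range n, Hᶜ.indicator (fun _ => b) (F^[i] y) <
      ∑ i ∈ Finset.range n, H.indicator (fun _ => c) (F^[i] y)} ⊆
      ⋃ n, {y | visitExcess F H b c n y ≠ 0} := by
    rintro y ⟨n, hn⟩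
    refine mem_iUnion.2 ⟨n, fun h0 => ?_⟩
    have h2 := sum_indicator_le_add_visitExcess (F := F) (H := H) (b := b) (c := c) n y
    rw [h0, add_zero] at h2
    exact absurd hn h2.not_gt
  have hmono : Monotone fun n => {y | visitExcess F H b c n y ≠ 0} := by
    refine monotone_nat_of_le_succ fun n y hy h0 => hy ?_
    exact le_antisymm ((visitExcess_le_succ n y).trans h0.le) zero_le
  refine (mul_le_mul_right (measure_mono h1) b).trans ?_
  rw [hmono.measure_iUnion, ENNReal.mul_iSup]
  exact iSup_le fun n => hF.mul_measure_visitExcess_le hH hc n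

/-- If `a ≤ e^{-β}` off a small set `H` and `a ≤ e^C` everywhere, then the products of `a` along
the orbits decay at rate `α < β` except for a small set of initial conditions. -/
lemma MeasureTheory.MeasurePreserving.mul_measure_not_forall_prod_le [IsFiniteMeasure m]
    (hF : MeasurePreserving F m m) (hH : MeasurableSet H) {a : Y → ℝ} (ha : ∀ y, 0 ≤ a y)
    {α β C : ℝ} (hαβ : α < β) (hC : 0 ≤ C + α)
    (h1 : ∀ᵐ y ∂m, y ∉ H → a y ≤ Real.exp (-β)) (h2 : ∀ᵐ y ∂m, a y ≤ Real.exp C) :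
    ENNReal.ofReal (β - α) *
      m {y | ¬ ∀ n : ℕ, ∏ i ∈ Finset.range n, a (F^[i] y) ≤ Real.exp (-α * n)} ≤
      ENNReal.ofReal (C + β) * m H := by
  have hb : 0 ≤ β - α := by linarith
  -- The weights compare `log a` with the target `-α`: a visit to `H` loses at most `C + α`, a step
  -- outside gains at least `β - α`.
  have h3 := hF.mul_measure_exists_sum_lt_le (b := ENNReal.ofReal (β - α))
    (c := ENNReal.ofReal (C + α)) hH ENNReal.ofReal_ne_top
  rw [← ENNReal.ofReal_add hC hb, show C + α + (β - α) = C + β by ring] at h3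
  refine le_trans (mul_le_mul_right (measure_mono_ae ?_) _) h3
  have hit : ∀ᵐ y ∂m, ∀ i : ℕ, (F^[i] y ∉ H → a (F^[i] y) ≤ Real.exp (-β)) ∧
      a (F^[i] y) ≤ Real.exp C :=
    ae_all_iff.2 fun i => (hF.iterate i).quasiMeasurePreserving.ae (h1.and h2)
  filter_upwards [hit] with y hy hbad
  change ¬ ∀ n : ℕ, ∏ i ∈ Finset.range n, a (F^[i] y) ≤ Real.exp (-α * n) at hbad
  by_contra hcon
  apply hbad
  intro n
  have h4 : ∑ i ∈ Finset.range n, H.indicator (fun _ => ENNReal.ofReal (C + α)) (F^[i] y) ≤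
      ∑ i ∈ Finset.range n, Hᶜ.indicator (fun _ => ENNReal.ofReal (β - α)) (F^[i] y) :=
    not_lt.1 fun hlt => hcon ⟨n, hlt⟩
  have hreal : ∀ (S : Set Y) (t : ℝ) (z : Y), S.indicator (fun _ => ENNReal.ofReal t) z =
      ENNReal.ofReal (S.indicator (fun _ => t) z) := by
    intro S t z
    by_cases hz : z ∈ S <;> simp [hz]
  simp only [hreal] at h4
  rw [← ENNReal.ofReal_sum_of_nonneg fun i _ => indicator_nonneg (fun _ _ => hC) _,
    ← ENNReal.ofReal_sum_of_nonneg fun i _ => indicator_nonneg (fun _ _ => hb) _,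
    ENNReal.ofReal_le_ofReal_iff (Finset.sum_nonneg fun i _ => indicator_nonneg (fun _ _ => hb) _)]
    at h4
  have h5 : ∀ i : ℕ, a (F^[i] y) ≤ Real.exp (-α + H.indicator (fun _ => C + α) (F^[i] y) -
      Hᶜ.indicator (fun _ => β - α) (F^[i] y)) := by
    intro i
    by_cases hz : F^[i] y ∈ H
    · simpa [hz] using (hy i).2
    · have h6 : -α - (β - α) = -β := by ring
      simpa [hz, h6] using (hy i).1 hz
  calc ∏ i ∈ Finset.range n, a (F^[i] y)
      ≤ ∏ i ∈ Finset.range n, Real.exp (-α + H.indicator (fun _ => C + α) (F^[i] y) -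
          Hᶜ.indicator (fun _ => β - α) (F^[i] y)) :=
        Finset.prod_le_prod (fun i _ => ha _) fun i _ => h5 i
    _ = Real.exp (∑ i ∈ Finset.range n, (-α + H.indicator (fun _ => C + α) (F^[i] y) -
          Hᶜ.indicator (fun _ => β - α) (F^[i] y))) := (Real.exp_sum _ _).symm
    _ ≤ Real.exp (-α * n) := by
        rw [Real.exp_le_exp, Finset.sum_sub_distrib, Finset.sum_add_distrib, Finset.sum_const,
          Finset.card_range, nsmul_eq_mul]
        linarith

end MaximalErgodic

/-! ### From almost sure decay in the limit to uniform decay for the lifts -/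

section BlockEstimate

open scoped ENNReal

variable {𝒯 X : Type*} [TopologicalSpace 𝒯] [MeasurableSpace 𝒯] [TopologicalSpace X] [CompactSpace X]
  [TopologicalSpace.MetrizableSpace X] [MeasurableSpace X] [BorelSpace X]

/-- Let `a` be upper semicontinuous along `Q` at the points `(w₀^ℤ, x)`. A compact set on which
`a (w₀^ℤ, ·) < c` has an open neighbourhood on which `a < c`, for all noises close to `w₀`. -/
lemma exists_open_forall_lt_of_isCompact {Q : Set ((ℤ → 𝒯) × X)} {w₀ : 𝒯} {a : (ℤ → 𝒯) × X → ℝ}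
    {c : ℝ} {K : Set X} (hK : IsCompact K)
    (h : ∀ x ∈ K, ∀ᶠ p in 𝓝[Q] ((fun _ => w₀, x) : (ℤ → 𝒯) × X), a p < c) :
    ∃ V ∈ 𝓝 w₀, ∃ U : Set X, IsOpen U ∧ K ⊆ U ∧
      ∀ p ∈ Q, (∀ k, p.1 k ∈ V) → p.2 ∈ U → a p < c := by
  obtain ⟨u, U, hu, hU, hwu, hKU, huU⟩ := generalized_tube_lemma
    (isCompact_singleton (x := fun _ : ℤ => w₀)) hK
    (isOpen_interior (s := {p : (ℤ → 𝒯) × X | p ∈ Q → a p < c})) (by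
      rintro ⟨w, x⟩ ⟨hw, hx⟩
      obtain rfl : w = fun _ => w₀ := hw
      exact mem_interior_iff_mem_nhds.2 (eventually_nhdsWithin_iff.1 (h x hx)))
  obtain ⟨V, hV, hVu⟩ := exists_forall_mem_of_mem_nhds_const (hu.mem_nhds (hwu rfl))
  exact ⟨V, hV, U, hU, hKU, fun p hp hpV hpU =>
    interior_subset (huU (show (p.1, p.2) ∈ u ×ˢ U from ⟨hVu _ hpV, hpU⟩)) hp⟩

/-- Let `m n` be invariant measures whose noise concentrates at `w₀` and whose marginals on `X`
converge to `μlim`. If `a ℓ (w₀^ℤ, x) < e^{-βℓ}` eventually, for `μlim`-almost all `x`, then for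
large `ℓ` the averages of `a ℓ` along the orbits of length multiples of `ℓ` decay at rate `α < β`,
outside a set of small `m n`-measure. -/
lemma eventually_measure_not_forall_prod_le {Q : Set ((ℤ → 𝒯) × X)} {w₀ : 𝒯}
    (hQ : ∀ x, ((fun _ => w₀, x) : (ℤ → 𝒯) × X) ∈ Q)
    {F : (ℤ → 𝒯) × X → (ℤ → 𝒯) × X} {a : ℕ → (ℤ → 𝒯) × X → ℝ} (ha : ∀ ℓ p, 0 ≤ a ℓ p)
    (husc : ∀ ℓ x c, a ℓ (fun _ => w₀, x) < c →
      ∀ᶠ p in 𝓝[Q] ((fun _ => w₀, x) : (ℤ → 𝒯) × X), a ℓ p < c)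
    {W : Set 𝒯} (hW : W ∈ 𝓝 w₀) {C : ℝ} (hC0 : 0 ≤ C)
    (hC : ∀ ℓ p, (∀ k, p.1 k ∈ W) → a ℓ p ≤ Real.exp (C * ℓ))
    {m : ℕ → Measure ((ℤ → 𝒯) × X)} (hm : ∀ n, MeasurePreserving F (m n) (m n))
    {μ : ℕ → ProbabilityMeasure X} (hmμ : ∀ n, (m n).map Prod.snd = μ n)
    (hmQ : ∀ V ∈ 𝓝 w₀, ∀ᶠ n in atTop, ∀ᵐ p ∂m n, p ∈ Q ∧ ∀ k, p.1 k ∈ V)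
    {μlim : ProbabilityMeasure X} (hμ : Tendsto μ atTop (𝓝 μlim)) {α β : ℝ} (hα : 0 < α)
    (hαβ : α < β)
    (hlim : ∀ᵐ x ∂(μlim : Measure X), ∀ᶠ ℓ : ℕ in atTop,
      a ℓ (fun _ => w₀, x) < Real.exp (-(β * ℓ))) {δ : ℝ} (hδ : 0 < δ) :
    ∀ᶠ ℓ : ℕ in atTop, ∀ᶠ n in atTop, m n {p | ¬ ∀ j : ℕ,
      ∏ i ∈ Finset.range j, a ℓ (F^[i * ℓ] p) ≤ Real.exp (-α * ℓ * j)} ≤ ENNReal.ofReal δ := by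
  have hmprob : ∀ n, IsProbabilityMeasure (m n) := fun n => by
    constructor
    rw [← preimage_univ (f := (Prod.snd : (ℤ → 𝒯) × X → X)),
      ← Measure.map_apply measurable_snd .univ, hmμ n, measure_univ]
  -- These sets are open by upper semicontinuity, and their measures tend to 1 since almost every
  -- point eventually belongs to them.
  set G : ℕ → Set X := fun ℓ => {x | a ℓ (fun _ => w₀, x) < Real.exp (-(β * ℓ))} with hG
  have hGo : ∀ ℓ, IsOpen (G ℓ) := by
    intro ℓ
    refine isOpen_iff_mem_nhds.2 fun x hx => ?_
    have h1 : Tendsto (fun y : X => ((fun _ => w₀, y) : (ℤ → 𝒯) × X)) (𝓝 x)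
        (𝓝[Q] (fun _ => w₀, x)) :=
      tendsto_nhdsWithin_iff.2 ⟨(Continuous.prodMk_right _).tendsto x,
        Eventually.of_forall fun y => hQ y⟩
    exact h1 (husc ℓ x _ hx)
  have hGlim : Tendsto (fun ℓ => (μlim : Measure X) (G ℓ)) atTop (𝓝 1) := by
    have h1 := tendsto_measure_of_ae_tendsto_indicator_of_isFiniteMeasure (μ := (μlim : Measure X))
      (As := G) atTop MeasurableSet.univ (fun ℓ => (hGo ℓ).measurableSet)
      (hlim.mono fun x hx => hx.mono fun ℓ hℓ => iff_of_true hℓ (mem_univ x))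
    rwa [measure_univ] at h1
  -- Chosen so that `(C + β) δ' = (β - α) δ`, which balances the maximal inequality.
  set δ' : ℝ≥0∞ := ENNReal.ofReal (δ * (β - α) / (C + β)) with hδ'
  have hβα : 0 < β - α := by linarith
  have hCβ : 0 < C + β := by linarith
  have hδ'0 : 0 < δ' := ENNReal.ofReal_pos.2 (by positivity)
  have hev : ∀ᶠ ℓ in atTop, 1 - δ' < (μlim : Measure X) (G ℓ) :=
    hGlim.eventually_const_lt (ENNReal.sub_lt_self (by simp) (by simp) hδ'0.ne')
  filter_upwards [hev, eventually_gt_atTop 0] with ℓ hℓ hℓ0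
  obtain ⟨K, hKG, hK, hKm⟩ := (hGo ℓ).exists_lt_isCompact hℓ
  obtain ⟨V, hV, U, hU, hKU, hVU⟩ := exists_open_forall_lt_of_isCompact (Q := Q) (w₀ := w₀)
    (a := a ℓ) hK fun x hx => husc ℓ x _ (hKG hx)
  have hUlim : ∀ᶠ n in atTop, 1 - δ' < (μ n : Measure X) U :=
    eventually_lt_of_lt_liminf ((hKm.trans_le (measure_mono hKU)).trans_le
      (ProbabilityMeasure.le_liminf_measure_open_of_tendsto hμ hU))
  filter_upwards [hUlim, hmQ _ (inter_mem hV hW)] with n hn hnQ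
  have := hmprob n
  have hHm : MeasurableSet (Prod.snd ⁻¹' Uᶜ : Set ((ℤ → 𝒯) × X)) :=
    measurable_snd hU.measurableSet.compl
  have hH : m n (Prod.snd ⁻¹' Uᶜ) ≤ δ' := by
    rw [← Measure.map_apply measurable_snd hU.measurableSet.compl, hmμ n,
      prob_compl_eq_one_sub hU.measurableSet]
    exact tsub_le_iff_tsub_le.1 hn.le
  have hℓ' : (0 : ℝ) < ℓ := Nat.cast_pos.2 hℓ0
  -- For `F^[ℓ]` all rates carry the same factor `ℓ`, which cancels at the end; hence `δ'` could be
  -- fixed before `ℓ`.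
  have key := ((hm n).iterate ℓ).mul_measure_not_forall_prod_le hHm (a := a ℓ) (ha ℓ)
    (α := α * ℓ) (β := β * ℓ) (C := C * ℓ) (by gcongr) (by positivity)
    (hnQ.mono fun p hp hpH => (hVU p hp.1 (fun k => (hp.2 k).1) (not_not.1 hpH)).le)
    (hnQ.mono fun p hp => hC ℓ p fun k => (hp.2 k).2)
  have hset : {p | ¬ ∀ j : ℕ, ∏ i ∈ Finset.range j, a ℓ (F^[i * ℓ] p) ≤
      Real.exp (-α * ℓ * j)} = {p | ¬ ∀ j : ℕ, ∏ i ∈ Finset.range j, a ℓ ((F^[ℓ])^[i] p) ≤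
      Real.exp (-(α * ℓ) * j)} := by
    simp only [← Function.iterate_mul, mul_comm ℓ, neg_mul]
  rw [hset]
  have hle : ENNReal.ofReal (C * ℓ + β * ℓ) * m n (Prod.snd ⁻¹' Uᶜ) ≤
      ENNReal.ofReal (β * ℓ - α * ℓ) * ENNReal.ofReal δ := by
    refine (mul_le_mul_right hH _).trans ?_
    rw [hδ', ← ENNReal.ofReal_mul (by nlinarith), ← ENNReal.ofReal_mul (by nlinarith)]
    refine ENNReal.ofReal_le_ofReal (le_of_eq ?_)
    field_simp
  exact (ENNReal.mul_le_mul_iff_right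
    (ENNReal.ofReal_pos.2 (by nlinarith)).ne' ENNReal.ofReal_ne_top).1 (key.trans hle)

end BlockEstimate

/-! ### Forward and backward cocycles as compositions of diffeomorphisms -/

section Compositions

variable {d : ℕ} {M : Type*} [TopologicalSpace M]
    [ChartedSpace (EuclideanSpace ℝ (Fin d)) M] [IsManifold (𝓡 d) ∞ M]

/-- The composition `g (n - 1) ∘ ⋯ ∘ g 0`. -/
def compDiff (g : ℕ → Diff2 d M) : ℕ → M → M
  | 0 => id
  | n + 1 => g n ∘ compDiff g n

lemma mdifferentiable_compDiff (g : ℕ → Diff2 d M) (n : ℕ) :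
    MDifferentiable (𝓡 d) (𝓡 d) (compDiff g n) := by
  induction n with
  | zero => exact mdifferentiable_id
  | succ n ih => exact (g n).mdifferentiable.comp ih

lemma tangentMap_compDiff_zero (g : ℕ → Diff2 d M) (Y : TangentBundle (𝓡 d) M) :
    tangentMap (𝓡 d) (𝓡 d) (compDiff g 0) Y = Y :=
  congrFun (tangentMap_id (I := 𝓡 d) (M := M)) Y

lemma tangentMap_compDiff_succ (g : ℕ → Diff2 d M) (n : ℕ) (Y : TangentBundle (𝓡 d) M) :
    tangentMap (𝓡 d) (𝓡 d) (compDiff g (n + 1)) Y =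
      (g n).tmap (tangentMap (𝓡 d) (𝓡 d) (compDiff g n) Y) :=
  tangentMap_comp_at Y ((g n).mdifferentiable _) (mdifferentiable_compDiff g n _)

lemma continuous_tangentMap_compDiff {X : Type*} [TopologicalSpace X] {g : X → ℕ → Diff2 d M}
    (hg : ∀ k, Continuous fun z : X × TangentBundle (𝓡 d) M => (g z.1 k).tmap z.2) (n : ℕ) :
    Continuous fun z : X × TangentBundle (𝓡 d) M =>
      tangentMap (𝓡 d) (𝓡 d) (compDiff (g z.1) n) z.2 := by
  induction n with
  | zero => simpa only [tangentMap_compDiff_zero] using continuous_snd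
  | succ n ih =>
    simp only [tangentMap_compDiff_succ]
    exact Continuous.comp (g := fun z : X × TangentBundle (𝓡 d) M => (g z.1 n).tmap z.2)
      (f := fun z : X × TangentBundle (𝓡 d) M =>
        (z.1, tangentMap (𝓡 d) (𝓡 d) (compDiff (g z.1) n) z.2)) (hg n)
      (continuous_fst.prodMk ih)

lemma compDiff_const (g : Diff2 d M) (n : ℕ) : compDiff (fun _ => g) n = g^[n] := by
  induction n with
  | zero => rfl
  | succ n ih => rw [Function.iterate_succ', ← ih]; rfl

variable {𝒯 : Type*}

lemma fwd_eq_compDiff (T : 𝒯 → Diff2 d M) (w : ℤ → 𝒯) (n : ℕ) :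
    fwd T w n = compDiff (fun k => T (w k)) n := by
  induction n with
  | zero => rfl
  | succ n ih => exact congrArg (T (w n) ∘ ·) ih

lemma bwd_eq_compDiff (T : 𝒯 → Diff2 d M) (w : ℤ → 𝒯) (n : ℕ) :
    bwd T w n = compDiff (fun k : ℕ => (T (w (-((k : ℤ) + 1)))).symm) n := by
  induction n with
  | zero => rfl
  | succ n ih => exact congrArg ((T (w (-((n : ℤ) + 1)))).symm ∘ ·) ih

variable [RiemannianBundle (fun x : M => TangentSpace (𝓡 d) x)]

lemma norm_tangentMap_compDiff_le {g : ℕ → Diff2 d M} {C : ℝ} (hC : 0 ≤ C)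
    (hg : ∀ k (Y : TangentBundle (𝓡 d) M), ‖((g k).tmap Y).2‖ ≤ C * ‖Y.2‖) (n : ℕ)
    (Y : TangentBundle (𝓡 d) M) :
    ‖(tangentMap (𝓡 d) (𝓡 d) (compDiff g n) Y).2‖ ≤ C ^ n * ‖Y.2‖ := by
  induction n with
  | zero => rw [tangentMap_compDiff_zero, pow_zero, one_mul]
  | succ n ih =>
    rw [tangentMap_compDiff_succ, pow_succ', mul_assoc]
    exact (hg n _).trans (mul_le_mul_of_nonneg_left ih hC)

variable [T2Space M] [CompactSpace M] [IsContMDiffRiemannianBundle (𝓡 d) ∞ (EuclideanSpace ℝ (Fin d))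
      (fun x : M => TangentSpace (𝓡 d) x)]

lemma restrNorm_compDiff_le {g : ℕ → Diff2 d M} {C : ℝ} (hC : 0 ≤ C)
    (hg : ∀ k (Y : TangentBundle (𝓡 d) M), ‖((g k).tmap Y).2‖ ≤ C * ‖Y.2‖) (n : ℕ) (x : M)
    (V : Submodule ℝ (TangentSpace (𝓡 d) x)) : restrNorm (compDiff g n) x V ≤ C ^ n :=
  restrNorm_le _ (pow_nonneg hC n) fun v _ => norm_tangentMap_compDiff_le hC hg n ⟨x, v⟩

/-- The derivatives of a `C¹` family are bounded, locally uniformly in the parameter. -/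
lemma IsC1Family.exists_norm_tmap_le [TopologicalSpace 𝒯] {T : 𝒯 → Diff2 d M} (hT : IsC1Family T)
    (w₀ : 𝒯) : ∃ C : ℝ, ∀ᶠ w in 𝓝 w₀, ∀ Y : TangentBundle (𝓡 d) M,
      ‖((T w).tmap Y).2‖ ≤ C * ‖Y.2‖ := by
  have hcont : Continuous fun z : 𝒯 × TangentBundle (𝓡 d) M => ‖((T z.1).tmap z.2).2‖ :=
    (continuous_norm_tangentBundle d M).comp hT
  obtain ⟨C, hC⟩ := (isCompact_unit_tangentBundle (d := d) (M := M)).bddAbove_image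
    (hcont.comp (Continuous.prodMk_right w₀)).continuousOn
  refine ⟨C + 1, ?_⟩
  have h1 : ∀ᶠ w in 𝓝 w₀, ∀ Y ∈ {Y : TangentBundle (𝓡 d) M | ‖Y.2‖ = 1},
      ‖((T w).tmap Y).2‖ < C + 1 := by
    refine isCompact_unit_tangentBundle.eventually_forall_of_forall_eventually fun Y hY => ?_
    have h2 : ‖((T w₀).tmap Y).2‖ ≤ C := hC ⟨Y, hY, rfl⟩
    exact hcont.continuousAt.eventually_lt_const (h2.trans_lt (lt_add_one C))
  filter_upwards [h1] with w hw Y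
  exact norm_le_mul_norm_of_unit (mfderiv (𝓡 d) (𝓡 d) (T w) Y.1).toLinearMap ⊤
    (fun s _ hs => (hw ⟨Y.1, s⟩ hs).le) Y.2 trivial

end Compositions

/-! ### From exponents to exponential bounds -/

section LyapunovExponent

variable {d : ℕ} {M : Type*} [TopologicalSpace M]
    [ChartedSpace (EuclideanSpace ℝ (Fin d)) M] [IsManifold (𝓡 d) ∞ M]
    [RiemannianBundle (fun x : M => TangentSpace (𝓡 d) x)]

/-- A zero norm, for instance on a zero subspace, satisfies the bound trivially and is separated
before taking a real logarithm. -/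
lemma eventually_restrNorm_lt_exp {g : ℕ → M → M} {x : M}
    {V : Submodule ℝ (TangentSpace (𝓡 d) x)} {L : EReal} {β : ℝ} (hL : L < ((-β : ℝ) : EReal))
    (h : Tendsto (fun n : ℕ => logRestrNorm (g n) x V / (n : EReal)) atTop (𝓝 L)) :
    ∀ᶠ n : ℕ in atTop, restrNorm (g n) x V < Real.exp (-(β * n)) := by
  filter_upwards [h.eventually_lt_const hL, eventually_gt_atTop 0] with n hn hn0
  rw [EReal.div_lt_iff (by exact_mod_cast hn0) (EReal.natCast_ne_top n)] at hn
  rcases le_or_gt (restrNorm (g n) x V) 0 with h0 | h0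
  · exact h0.trans_lt (Real.exp_pos _)
  · rw [logRestrNorm, ENNReal.log_ofReal_of_pos h0] at hn
    have h1 : Real.log (restrNorm (g n) x V) < -β * n := by exact_mod_cast hn
    rw [← neg_mul]
    exact (Real.log_lt_iff_lt_exp h0).1 h1

end LyapunovExponent

/-! ### Marginals and invertibility of the lift -/

section LiftProperties

variable {d : ℕ} {M : Type*} [TopologicalSpace M]
    [ChartedSpace (EuclideanSpace ℝ (Fin d)) M] [MeasurableSpace M]
    {𝒯 : Type*} [MeasurableSpace 𝒯] {T : 𝒯 → Diff2 d M} {θ : Measure 𝒯} [IsProbabilityMeasure θ]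
    {μ : Measure M} [IsProbabilityMeasure μ] {m : Measure ((ℤ → 𝒯) × M)}

lemma IsLift.map_snd (h : IsLift T θ μ m) : m.map Prod.snd = μ := by
  have h1 : (m.map forgetPast).map Prod.snd = m.map Prod.snd := by
    rw [Measure.map_map measurable_snd measurable_forgetPast]
    rfl
  rw [← h1]
  refine (congrArg (Measure.map Prod.snd) h.2).trans ?_
  rw [Measure.map_snd_prod, measure_univ, one_smul]

lemma IsLift.measurePreserving_symm (h : IsLift T θ μ m)
    (hT' : Measurable fun z : 𝒯 × M => (T z.1).symm z.2) :
    MeasurePreserving (skew T).symm m m := by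
  refine ⟨measurable_skew_symm hT', ?_⟩
  conv_lhs => rw [← h.1.map_eq]
  rw [Measure.map_map (measurable_skew_symm hT') h.1.measurable]
  have h1 : (skew T).symm ∘ skew T = id := funext (skew T).symm_apply_apply
  rw [h1, Measure.map_id]

lemma skew_iterate_fst (T : 𝒯 → Diff2 d M) (j : ℕ) (p : (ℤ → 𝒯) × M) (k : ℤ) :
    ((skew T)^[j] p).1 k = p.1 (k + j) := by
  induction j generalizing k with
  | zero => simp
  | succ j ih =>
    rw [Function.iterate_succ_apply']
    refine (ih (k + 1)).trans (congrArg p.1 ?_)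
    push_cast
    ring

/-- The noise of the lift is carried by any set which carries the law of the noise. -/
lemma IsLift.ae_forall_mem (h : IsLift T θ μ m) {S : Set 𝒯} (hS : MeasurableSet S)
    (hθ : θ Sᶜ = 0) : ∀ᵐ p ∂m, ∀ k, p.1 k ∈ S := by
  have hnat : ∀ k : ℕ, ∀ᵐ p ∂m, p.1 (k : ℤ) ∈ S := by
    intro k
    have h1 : MeasurableSet {q : (ℕ → 𝒯) × M | q.1 k ∈ Sᶜ} :=
      ((measurable_pi_apply k).comp measurable_fst) hS.compl
    have h2 : ((Measure.infinitePi fun _ : ℕ => θ).prod μ) {q : (ℕ → 𝒯) × M | q.1 k ∈ Sᶜ} = 0 := by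
      have h3 : {q : (ℕ → 𝒯) × M | q.1 k ∈ Sᶜ} = {v : ℕ → 𝒯 | v k ∈ Sᶜ} ×ˢ univ := by
        ext q
        simp
      rw [h3, Measure.prod_prod]
      have h4 := (measurePreserving_eval_infinitePi (fun _ : ℕ => θ) k).measure_preimage
        hS.compl.nullMeasurableSet
      rw [hθ] at h4
      exact mul_eq_zero_of_left h4 _
    rw [← h.2] at h2
    exact (Measure.map_apply measurable_forgetPast h1).symm.trans h2
  refine ae_all_iff.2 fun k => ?_
  rcases Int.eq_nat_or_neg k with ⟨j, rfl | rfl⟩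
  · exact hnat j
  -- Invariance under `j` steps transfers the statement from coordinate 0 to coordinate `-j`.
  · have h1 : {p : (ℤ → 𝒯) × M | p.1 (-(j : ℤ)) ∈ S} =ᵐ[m] univ := by
      refine eventuallyEq_univ.2 ?_
      have h2 : MeasurableSet {p : (ℤ → 𝒯) × M | p.1 (-(j : ℤ)) ∈ Sᶜ} :=
        ((measurable_pi_apply _).comp measurable_fst) hS.compl
      have h3 := (h.1.iterate j).measure_preimage h2.nullMeasurableSet
      have h4 : (skew T)^[j] ⁻¹' {p : (ℤ → 𝒯) × M | p.1 (-(j : ℤ)) ∈ Sᶜ} =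
          {p : (ℤ → 𝒯) × M | p.1 ((0 : ℕ) : ℤ) ∈ Sᶜ} := by
        ext p
        change ((skew T)^[j] p).1 (-(j : ℤ)) ∈ Sᶜ ↔ _
        rw [skew_iterate_fst, neg_add_cancel]
        rfl
      rw [h4] at h3
      exact h3.symm.trans (hnat 0)
    exact eventuallyEq_univ.1 h1

end LiftProperties

/-! ### Supports of the noise -/

section RegularPerturbation

open scoped ENNReal

variable {d : ℕ} {M : Type*} [TopologicalSpace M]
    [ChartedSpace (EuclideanSpace ℝ (Fin d)) M] [IsManifold (𝓡 d) ∞ M] [MeasurableSpace M]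
    {𝒯 : Type*} [MetricSpace 𝒯] [MeasurableSpace 𝒯] {f : Diff2 d M} {T : 𝒯 → Diff2 d M} {w₀ : 𝒯}
    {θ : ℝ → ProbabilityMeasure 𝒯}

lemma IsRegularPerturbation.exists_support_subset (hT : IsRegularPerturbation f T w₀ θ) {W : Set 𝒯}
    (hW : W ∈ 𝓝 w₀) : ∃ ε₀ > 0, ∀ ε, 0 < ε → ε ≤ ε₀ → (θ ε : Measure 𝒯).support ⊆ W := by
  obtain ⟨ε₀, hε₀, hε₀pos⟩ := ((tendsto_smallSets_iff.1 hT.tendsto_support W hW).and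
    self_mem_nhdsWithin).exists
  exact ⟨ε₀, hε₀pos, fun ε hε hle => (hT.nested ε ε₀ hε hle).trans hε₀⟩

/-- Otherwise the supports at small scales, which shrink to `w₀` and are nested in this closed set,
would be empty while carrying full mass. -/
lemma IsRegularPerturbation.mem_support (hT : IsRegularPerturbation f T w₀ θ) {ε : ℝ} (hε : 0 < ε) :
    w₀ ∈ (θ ε : Measure 𝒯).support := by
  by_contra h0
  obtain ⟨ε₁, hε₁, h1⟩ := hT.exists_support_subset
    ((hT.isCompact_support ε hε).isClosed.isOpen_compl.mem_nhds h0)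
  have hmin : 0 < min ε ε₁ := lt_min hε hε₁
  have h2 : (θ (min ε ε₁) : Measure 𝒯).support = ∅ :=
    eq_empty_of_forall_notMem fun w hw => h1 _ hmin (min_le_right _ _) hw
      (hT.nested _ _ hmin (min_le_left _ _) hw)
  have h3 := hT.compl_support _ hmin
  rw [h2, compl_empty, measure_univ] at h3
  exact one_ne_zero h3

end RegularPerturbation

/-! ### The block estimate for derivative cocycles -/

section Blocks

open scoped ENNReal

variable {d : ℕ} {M : Type*} [TopologicalSpace M] [T2Space M] [CompactSpace M]
    [ChartedSpace (EuclideanSpace ℝ (Fin d)) M] [IsManifold (𝓡 d) ∞ M]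
    [RiemannianBundle (fun x : M => TangentSpace (𝓡 d) x)]
    [IsContMDiffRiemannianBundle (𝓡 d) ∞ (EuclideanSpace ℝ (Fin d))
      (fun x : M => TangentSpace (𝓡 d) x)]
    [MeasurableSpace M] [BorelSpace M]
    {𝒯 : Type*} [TopologicalSpace 𝒯] [MeasurableSpace 𝒯]

/-- The estimate of `eventually_measure_not_forall_prod_le` for the derivatives of compositions of
random diffeomorphisms along a closed family of subspaces. -/
lemma eventually_measure_not_forall_prod_restrNorm_le {S : 𝒯 → Diff2 d M} (hS : IsC1Family S)
    (s : ℕ → ℤ) {Ω : Set (ℤ → 𝒯)} {w₀ : 𝒯} (hΩ : (fun _ => w₀) ∈ Ω)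
    {E : ∀ p : (ℤ → 𝒯) × M, Submodule ℝ (TangentSpace (𝓡 d) p.2)}
    (hE : IsContinuousFamilyOn Prod.snd E (Ω ×ˢ univ)) {F : (ℤ → 𝒯) × M → (ℤ → 𝒯) × M}
    {m : ℕ → Measure ((ℤ → 𝒯) × M)} (hm : ∀ n, MeasurePreserving F (m n) (m n))
    {μ : ℕ → ProbabilityMeasure M} (hmμ : ∀ n, (m n).map Prod.snd = μ n)
    (hmΩ : ∀ V ∈ 𝓝 w₀, ∀ᶠ n in atTop, ∀ᵐ p ∂m n, p.1 ∈ Ω ∧ ∀ k, p.1 k ∈ V)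
    {μlim : ProbabilityMeasure M} (hμ : Tendsto μ atTop (𝓝 μlim)) {α β : ℝ} (hα : 0 < α)
    (hαβ : α < β)
    (hlim : ∀ᵐ x ∂(μlim : Measure M), ∀ᶠ ℓ : ℕ in atTop,
      restrNorm ((S w₀)^[ℓ]) x (E (fun _ => w₀, x)) < Real.exp (-(β * ℓ))) {δ : ℝ} (hδ : 0 < δ) :
    ∀ᶠ ℓ : ℕ in atTop, ∀ᶠ n in atTop, m n {p | ¬ ∀ j : ℕ,
      ∏ i ∈ Finset.range j, restrNorm (compDiff (fun k => S ((F^[i * ℓ] p).1 (s k))) ℓ)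
        (F^[i * ℓ] p).2 (E (F^[i * ℓ] p)) ≤ Real.exp (-α * ℓ * j)} ≤ ENNReal.ofReal δ := by
  have : TopologicalSpace.MetrizableSpace M := Manifold.metrizableSpace (𝓡 d) M
  obtain ⟨C, hC⟩ := hS.exists_norm_tmap_le w₀
  -- The rate `log (max C 1)` is nonnegative and its exponential still bounds one step of the
  -- cocycle.
  refine eventually_measure_not_forall_prod_le (Q := Ω ×ˢ univ) (w₀ := w₀)
    (a := fun ℓ p => restrNorm (compDiff (fun k => S (p.1 (s k))) ℓ) p.2 (E p))
    (fun x => ⟨hΩ, mem_univ x⟩) (fun ℓ p => restrNorm_nonneg _ _ _) ?_ hC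
    (C := Real.log (max C 1)) (Real.log_nonneg (le_max_right _ _)) ?_ hm hmμ ?_ hμ hα hαβ ?_ hδ
  · intro ℓ x c hc
    refine (hE.isClosedFamilyOn continuous_snd).eventually_restrNorm_lt continuous_snd
      (g := fun p : (ℤ → 𝒯) × M => compDiff (fun k => S (p.1 (s k))) ℓ)
      (continuous_tangentMap_compDiff (g := fun (p : (ℤ → 𝒯) × M) k => S (p.1 (s k)))
        (fun k => ?_) ℓ) (p₀ := (fun _ => w₀, x)) ⟨hΩ, mem_univ x⟩ hc
    exact Continuous.comp (g := fun z : 𝒯 × TangentBundle (𝓡 d) M => (S z.1).tmap z.2)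
      (f := fun z : ((ℤ → 𝒯) × M) × TangentBundle (𝓡 d) M => (z.1.1 (s k), z.2)) hS
      ((((continuous_apply (s k)).comp continuous_fst).comp continuous_fst).prodMk continuous_snd)
  · intro ℓ p hp
    have h0 : (0 : ℝ) < max C 1 := lt_of_lt_of_le one_pos (le_max_right _ _)
    rw [mul_comm, Real.exp_nat_mul, Real.exp_log h0]
    exact restrNorm_compDiff_le h0.le (fun k Y => (hp (s k) Y).trans
      (mul_le_mul_of_nonneg_right (le_max_left _ _) (norm_nonneg _))) ℓ p.2 (E p)
  · exact fun V hV => (hmΩ V hV).mono fun n hn => hn.mono fun p hp => ⟨⟨hp.1, mem_univ _⟩, hp.2⟩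
  · simpa only [compDiff_const] using hlim

end Blocks

/-! ### Assembly of the estimates -/

section Main

open scoped ENNReal

/-- Only subadditivity is used, so the sets `B ℓ` need not be measurable. -/
lemma tendsto_liminf_one_of_eventually {Y : Type*} [MeasurableSpace Y] {m : ℕ → Measure Y}
    [∀ n, IsProbabilityMeasure (m n)] {B : ℕ → Set Y}
    (h : ∀ δ : ℝ, 0 < δ → ∀ᶠ ℓ : ℕ in atTop, ∀ᶠ n in atTop, m n (B ℓ)ᶜ ≤ ENNReal.ofReal δ) :
    Tendsto (fun ℓ => liminf (fun n => m n (B ℓ)) atTop) atTop (𝓝 1) := by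
  refine tendsto_order.2 ⟨fun a ha => ?_, fun a ha => Eventually.of_forall fun ℓ => ?_⟩
  · obtain ⟨b, hab, hb⟩ := exists_between ha
    have hb0 : 0 < 1 - b := tsub_pos_of_lt hb
    have hbt : 1 - b ≠ ⊤ := ne_top_of_le_ne_top ENNReal.one_ne_top tsub_le_self
    filter_upwards [h (1 - b).toReal (ENNReal.toReal_pos hb0.ne' hbt)] with ℓ hℓ
    refine hab.trans_le (le_liminf_of_le (by isBoundedDefault) (hℓ.mono fun n hn => ?_))
    rw [ENNReal.ofReal_toReal hbt] at hn
    have h1 : 1 ≤ m n (B ℓ) + m n (B ℓ)ᶜ := by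
      rw [← measure_univ (μ := m n), ← union_compl_self (B ℓ)]
      exact measure_union_le _ _
    have h2 : b + (1 - b) ≤ m n (B ℓ) + (1 - b) := by
      rw [add_tsub_cancel_of_le hb.le]
      exact h1.trans (by gcongr)
    exact (ENNReal.add_le_add_iff_right hbt).1 h2
  · refine lt_of_le_of_lt ?_ ha
    exact (liminf_le_liminf (Eventually.of_forall fun n => prob_le_one)).trans (by simp)

end Main

end

theorem mainTheorem4 {d : ℕ} {M : Type*} [TopologicalSpace M] [T2Space M] [CompactSpace M]
    [ChartedSpace (EuclideanSpace ℝ (Fin d)) M] [IsManifold (𝓡 d) ∞ M]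
    [RiemannianBundle (fun x : M => TangentSpace (𝓡 d) x)]
    [IsContMDiffRiemannianBundle (𝓡 d) ∞ (EuclideanSpace ℝ (Fin d))
      (fun x : M => TangentSpace (𝓡 d) x)]
    [MeasurableSpace M] [BorelSpace M]
    {𝒯 : Type*} [MetricSpace 𝒯] [MeasurableSpace 𝒯] [BorelSpace 𝒯]
    (f : Diff2 d M) (Ecu₀ Ecs₀ : ∀ x : M, Submodule ℝ (TangentSpace (𝓡 d) x))
    (hf : IsDominatedSplitting f Ecu₀ Ecs₀)
    (T : 𝒯 → Diff2 d M) (w₀ : 𝒯) (θ : ℝ → ProbabilityMeasure 𝒯)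
    (hT : IsRegularPerturbation f T w₀ θ) :
    (∃ ε₀ > 0, ∃ Ecu Ecs : ∀ p : (ℤ → 𝒯) × M, Submodule ℝ (TangentSpace (𝓡 d) p.2),
      IsRandomDominatedSplitting T w₀ Ecu₀ Ecs₀ (noiseSpace θ ε₀) Ecu Ecs) ∧
    ∀ ε₀ > 0, ∀ Ecu Ecs : ∀ p : (ℤ → 𝒯) × M, Submodule ℝ (TangentSpace (𝓡 d) p.2),
      IsRandomDominatedSplitting T w₀ Ecu₀ Ecs₀ (noiseSpace θ ε₀) Ecu Ecs →
      ∀ (α β : ℝ), 0 < α → α < β →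
      ∀ (ε : ℕ → ℝ) (μ : ℕ → ProbabilityMeasure M) (μlim : ProbabilityMeasure M),
        (∀ n, 0 < ε n) → Tendsto ε atTop (𝓝 0) →
        (∀ n, IsStationaryMeasure T (θ (ε n) : Measure 𝒯) (μ n : Measure M)) →
        Tendsto μ atTop (𝓝 μlim) →
        (∀ᵐ x ∂(μlim : Measure M),
          (∃ L : EReal, L < ((-β : ℝ) : EReal) ∧
            Tendsto (fun n : ℕ => logRestrNorm (f^[n]) x (Ecs₀ x) / (n : EReal)) atTop (𝓝 L)) ∧
          (∃ L : EReal, L < ((-β : ℝ) : EReal) ∧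
            Tendsto (fun n : ℕ => logRestrNorm (f.symm^[n]) x (Ecu₀ x) / (n : EReal)) atTop
              (𝓝 L))) →
        Tendsto (fun ℓ : ℕ => liminf (fun n : ℕ =>
            liftedMeasure T (θ (ε n) : Measure 𝒯) (μ n : Measure M)
              (hyperbolicBlock T (noiseSpace θ ε₀) Ecu Ecs α ℓ)) atTop)
          atTop (𝓝 1) := by
  have hC1 : IsC1Family T := isC1Family_of_continuous hT.continuous_T
  constructor
  · obtain ⟨W, hW, h⟩ := exists_randomDominatedSplitting hf hC1 hT.T_base
    obtain ⟨ε₀, hε₀, hsub⟩ := hT.exists_support_subset hW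
    refine ⟨ε₀, hε₀, h _ fun w hw k => ?_⟩
    rw [noiseSpace_eq] at hw
    exact hsub ε₀ hε₀ le_rfl (hw k)
  intro ε₀ hε₀ Ecu Ecs hE α β hα hαβ ε μ μlim hε hε0 hμ hμlim hexp
  have : SecondCountableTopology M :=
    ChartedSpace.secondCountable_of_sigmaCompact (EuclideanSpace ℝ (Fin d)) M
  set m : ℕ → Measure ((ℤ → 𝒯) × M) := fun n =>
    liftedMeasure T (θ (ε n) : Measure 𝒯) (μ n : Measure M) with hmdef
  have hlift : ∀ n, IsLift T (θ (ε n) : Measure 𝒯) (μ n : Measure M) (m n) := by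
    intro n
    have h := (hμ n).exists_isLift hC1.continuous_apply hC1.continuous_symm_apply
      (hT.isCompact_support _ (hε n)) (hT.compl_support _ (hε n))
    -- Existence selects the branch of `liftedMeasure` with a genuine lift; the argument applies to
    -- whichever lift is chosen.
    rw [hmdef]
    simp only [liftedMeasure, dif_pos h]
    exact h.choose_spec
  have hmμ : ∀ n, (m n).map Prod.snd = μ n := fun n => (hlift n).map_snd
  have hmprob : ∀ n, IsProbabilityMeasure (m n) := fun n => by
    constructor
    rw [← preimage_univ (f := (Prod.snd : (ℤ → 𝒯) × M → M)),
      ← Measure.map_apply measurable_snd .univ, hmμ n, measure_univ]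
  have hmΩ : ∀ V ∈ 𝓝 w₀, ∀ᶠ n in atTop, ∀ᵐ p ∂m n, p.1 ∈ noiseSpace θ ε₀ ∧ ∀ k, p.1 k ∈ V := by
    intro V hV
    obtain ⟨ε₁, hε₁, hsub⟩ := hT.exists_support_subset hV
    filter_upwards [hε0.eventually_lt_const hε₁, hε0.eventually_lt_const hε₀] with n hn1 hn0
    filter_upwards [(hlift n).ae_forall_mem (hT.isCompact_support _ (hε n)).measurableSet
      (hT.compl_support _ (hε n))] with p hp
    rw [noiseSpace_eq]
    exact ⟨fun k => hT.nested _ _ (hε n) hn0.le (hp k), fun k => hsub _ (hε n) hn1.le (hp k)⟩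
  have hΩ : (fun _ => w₀) ∈ noiseSpace θ ε₀ := by
    rw [noiseSpace_eq]
    exact fun _ => hT.mem_support hε₀
  refine tendsto_liminf_one_of_eventually fun δ hδ => ?_
  have hcs := eventually_measure_not_forall_prod_restrNorm_le hC1 (fun k => (k : ℤ)) hΩ
    hE.continuous_cs (fun n => (hlift n).1) hmμ hmΩ hμlim hα hαβ (hexp.mono fun x hx => by
      obtain ⟨L, hL, hlim⟩ := hx.1
      rw [hT.T_base, hE.extends_cs]
      exact eventually_restrNorm_lt_exp hL hlim) (half_pos hδ)
  -- The same estimate for the inverse maps and the inverse skew product; the noise is read at `-1,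
  -- -2, …`, hence the index `-(k + 1)`.
  have hcu := eventually_measure_not_forall_prod_restrNorm_le hC1.symm
    (fun k => -((k : ℤ) + 1)) hΩ hE.continuous_cu
    (fun n => (hlift n).measurePreserving_symm hC1.continuous_symm_apply.measurable) hmμ hmΩ hμlim
    hα hαβ (hexp.mono fun x hx => by
      obtain ⟨L, hL, hlim⟩ := hx.2
      rw [hT.T_base, hE.extends_cu]
      exact eventually_restrNorm_lt_exp hL hlim) (half_pos hδ)
  filter_upwards [hcs, hcu] with ℓ hcsℓ hcuℓ
  filter_upwards [hcsℓ, hcuℓ, hmΩ univ univ_mem] with n hcsn hcun hn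
  rw [← add_halves δ, ENNReal.ofReal_add (half_pos hδ).le (half_pos hδ).le]
  -- Almost every noise lies in `Ω`, so a point outside the block fails the forward or the backward
  -- estimate.
  refine (measure_mono_ae ?_).trans ((measure_union_le _ _).trans (add_le_add hcsn hcun))
  filter_upwards [hn] with p hp hbad
  by_contra hcon
  refine hbad ⟨hp.1, fun j => ⟨?_, ?_⟩⟩
  · have h1 := not_not.1 (fun h => hcon (Or.inl h)) j
    simpa only [fwd_eq_compDiff] using h1
  · have h1 := not_not.1 (fun h => hcon (Or.inr h)) j
    simpa only [bwd_eq_compDiff] using h1
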